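/- \textbf{Mixed restriction estimates.} Write $e(\beta)=e^{2\pi i\beta}$ and, for real $X\ge 0$, $[X]=\{n\in\mathbb{Z}: 1\le n\le X\}$. For finitely supported $f:\mathbb{Z}\to\mathbb{C}$ put $$\hat f(\alpha)=\sum_{n\in\mathbb{Z}} f(n)e(\alpha n),\qquad \tilde f(\alpha)=\sum_{x\in\mathbb{Z}} f(x)e(\alpha x^2),$$ and write $\int_{\mathbb{T}}F(\alpha)\,d\alpha=\int_0^1F(\alpha)\,d\alpha$. An integer is $w$-smooth if all of its prime divisors are at most $w$. For positive integers $N$, $W$ and $\xi\in[W]$ with $W$ even, define $\nu_{W,\xi}:\mathbb{Z}\to[0,\infty)$ by $\nu_{W,\xi}(n)=Wx+\xi$ if $n\in[N]$ and $n=\frac{(Wx+\xi)^2-\xi^2}{2W}$ for some $x\in\mathbb{Z}$ with $Wx+\xi\ge 0$, and $\nu_{W,\xi}(n)=0$ otherwise. Let $p>2$ be real and let $K\ge 1$. There are constants $A$ and $C$, depending only on $p$ and $K$, such that the following holds. Let $b_1,b_2$ be non-zero integers with $|b_1|,|b_2|\le K$. Let $w$ be a real number, let $W_1$ and $W_2$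 be $w$-smooth positive integers such that $W_1$ is divisible by $2\prod_{q\le w,\ q\text{ prime}}q$, let $\xi\in[W_1]$ satisfy $\mathrm{hcf}(\xi,W_1)=1$, let $N$ be a positive integer, and let $\nu=\nu_{W_1,\xi}$. Then either $N\le C(W_1W_2)^{A}$ or, for every $f:\mathbb{Z}\to\mathbb{C}$ with $|f|\le 1_{[N]}+\nu$ pointwise and every $B\subset[(N/W_2)^{1/2}]$, all four of the following bounds hold: $$\int_{\mathbb{T}}\bigl|\hat f(b_1\alpha)\,\hat 1_B(b_2\alpha)\bigr|^p\,d\alpha\le C\,N^{\frac{3p}{2}-1}W_2^{-\frac p2},\qquad \int_{\mathbb{T}}\bigl|\hat f(b_1\alpha)\,\tilde 1_B(b_2W_2\alpha)\bigr|^p\,d\alpha\le C\,N^{\frac{3p}{2}-1}W_2^{-\frac p2},$$ $$\int_{\mathbb{T}}\bigl|\tilde 1_B(b_1W_2\alpha)\,\hat 1_B(b_2\alpha)\bigr|^p\,d\alpha\le C\,N^{p-1}W_2^{-p},\qquad \int_{\mathbb{T}}\bigl|\hat f(\alpha)\bigr|^{2p}\,d\alpha\le C\,N^{2p-1}.$$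 -/

import Mathlib

open scoped BigOperators

noncomputable section

/-- `e(β) = exp(2πiβ)`. -/
def addChar (β : ℝ) : ℂ := Complex.exp (2 * Real.pi * Complex.I * (β : ℂ))

/-- The Fourier transform `f̂(α) = ∑ₙ f(n) e(αn)` of a finitely supported `f : ℤ → ℂ`,
as a `1`-periodic function of a real variable. -/
def fourierHat (f : ℤ → ℂ) (α : ℝ) : ℂ := ∑ᶠ n : ℤ, f n * addChar (α * (n : ℝ))

/-- The quadratic Fourier transform `f̃(α) = ∑ₓ f(x) e(αx²)` of a finitely supported
`f : ℤ → ℂ`. -/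
def fourierTilde (f : ℤ → ℂ) (α : ℝ) : ℂ := ∑ᶠ x : ℤ, f x * addChar (α * (x : ℝ) ^ 2)

/-- `[X] = {1, 2, …, ⌊X⌋}`, as a set of integers. -/
def initialInterval (X : ℝ) : Set ℤ := {n : ℤ | 1 ≤ n ∧ (n : ℝ) ≤ X}

/-- `n` is `w`-smooth if all of its prime divisors are at most `w`. -/
def IsWSmooth (w : ℝ) (n : ℕ) : Prop := ∀ q : ℕ, q.Prime → q ∣ n → (q : ℝ) ≤ w

open Classical in
/-- The majorant `ν_{W,ξ}` for squares on `[N]`, extended by zero to `ℤ`: its value at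
`n ∈ [N]` is `Wx + ξ` if `n = ((Wx + ξ)² - ξ²) / (2W)` for some integer `x` with
`Wx + ξ ≥ 0` (there is at most one such `x` when `W ≥ 1`), and is `0` otherwise. -/
def squareMajorant (N W ξ : ℕ) (n : ℤ) : ℝ :=
  if h : n ∈ initialInterval N ∧ ∃ x : ℤ, 0 ≤ (W : ℤ) * x + ξ ∧
      2 * (W : ℤ) * n = ((W : ℤ) * x + ξ) ^ 2 - (ξ : ℤ) ^ 2
  then (W : ℝ) * (h.2.choose : ℝ) + ξ
  else 0

/-- The value of the majorant does not depend on any choice. -/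
theorem squareMajorant_eq {N W ξ : ℕ} {n x : ℤ} (hn : n ∈ initialInterval N)
    (hx : 0 ≤ (W : ℤ) * x + ξ)
    (h : 2 * (W : ℤ) * n = ((W : ℤ) * x + ξ) ^ 2 - (ξ : ℤ) ^ 2) :
    squareMajorant N W ξ n = (W : ℝ) * (x : ℝ) + ξ := by
  have hex : n ∈ initialInterval N ∧ ∃ x : ℤ, 0 ≤ (W : ℤ) * x + ξ ∧
      2 * (W : ℤ) * n = ((W : ℤ) * x + ξ) ^ 2 - (ξ : ℤ) ^ 2 := ⟨hn, x, hx, h⟩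
  rw [squareMajorant, dif_pos hex]
  obtain ⟨h1, h2⟩ := hex.2.choose_spec
  have h3 : ((W : ℤ) * hex.2.choose + ξ) ^ 2 = ((W : ℤ) * x + ξ) ^ 2 := by linarith
  have h4 : (W : ℤ) * hex.2.choose + ξ = (W : ℤ) * x + ξ :=
    (sq_eq_sq₀ h1 hx).1 h3
  exact_mod_cast h4

end

/-! The proof is Bourgain's restriction argument, run once in an abstract form and then fed with
four kernels.

Let `F` be an exponential sum with coefficients `c j`, where `‖c j‖² ≤ ω j * v j` and both `ω` and
`v` have mass at most `T`; the aim is `∫ |F|^p ≪ T^p / N`. By duality (`level_set_sq_le`) the set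
`E` on which `|F| ≥ δ T` satisfies `(δ T |E|)² ≤ T ∬_{E×E} B(α - β)` for any continuous bounded `B`
above the modulus of the kernel `∑ ω j e(k j θ)`. Suppose this kernel is a power of `N` below `T`,
or at most `C₀ T (q (1 + N|θ - a/q|))^{-s}` for some fraction `a/q`. Cut the arcs into dyadic pieces
and majorise each piece by Fejér kernels summed over all residues modulo `q`. The Fourier
coefficients of such a majorant count divisors `q ≤ R`, so Bessel's inequality and moments of the
restricted divisor function give `|E| ≪ δ^{-2/s-κ} / N` as long as `δ` is not below a small negative
power of `N` (`exists_level_set_le`). Summing over dyadic `δ` settles every `p > 2/s`; the remaining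
tiny values of `F` are handled by a lower moment known up to `N^ε` (`exists_integral_norm_rpow_le`).
That lossy moment comes from counting solutions with the divisor bound.

A product of two exponential sums is one exponential sum over pairs, and its kernel is the product
of the two kernels. So for `p > 2` it suffices that the product kernel decays with some `s > 2/p`,
although each quadratic kernel alone only saves `q^{-1/2}`. There are three mechanisms. A Dirichlet
kernel is large only near integers, which leaves boundedly many `q` (`kernel_hat_hat`,
`kernel_tilde_hat`). Two quadratic kernels save `q^{-1/2}` each, and their denominators are
comparable because the `W`-trick annihilates the Gauss sums whose denominator shares too much with
`W₁` (`quadGauss_eq_zero`, `kernel_hat_tilde`). Finally, a plain sum of `e(β x²)` decays only like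
`|β|^{-1/2}` near zero; writing the bound `1` on the coefficients as `(x/M)^τ (x/M)^{-τ}` and using
the first factor in the kernel improves the exponent to `(1 + τ)/2`, while the second factor still
has mass `O(M)` since `τ < 1`.

The last estimate has a single factor; its kernel has `s = 1/2`, so exponents above `4` are
admissible, and `2p > 4`. -/

namespace MixedRestriction
open MeasureTheory Complex

/-! ### The additive character -/

theorem addChar_eq (x : ℝ) : addChar x = Complex.exp ((2 * Real.pi * x : ℝ) * Complex.I) := by
  unfold addChar
  congr 1
  push_cast
  ring

theorem addChar_zero : addChar 0 = 1 := by simp [addChar]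

theorem addChar_add (x y : ℝ) : addChar (x + y) = addChar x * addChar y := by
  unfold addChar
  rw [← Complex.exp_add]
  congr 1
  push_cast
  ring

theorem addChar_nsmul (n : ℕ) (x : ℝ) : addChar (n * x) = addChar x ^ n := by
  unfold addChar
  rw [← Complex.exp_nat_mul]
  congr 1
  push_cast
  ring

theorem addChar_intCast (n : ℤ) : addChar n = 1 := by
  unfold addChar
  rw [Complex.exp_eq_one_iff]
  exact ⟨n, by push_cast; ring⟩

theorem addChar_add_intCast (x : ℝ) (n : ℤ) : addChar (x + n) = addChar x := by
  rw [addChar_add, addChar_intCast, mul_one]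

theorem norm_addChar (x : ℝ) : ‖addChar x‖ = 1 := by
  rw [addChar_eq, Complex.norm_exp_ofReal_mul_I]

theorem conj_addChar (x : ℝ) : (starRingEnd ℂ) (addChar x) = addChar (-x) := by
  unfold addChar
  rw [← Complex.exp_conj]
  congr 1
  simp [map_ofNat]

theorem continuous_addChar : Continuous addChar := by
  unfold addChar
  fun_prop

theorem norm_addChar_sub_one_le (x : ℝ) : ‖addChar x - 1‖ ≤ 2 * Real.pi * |x| := by
  have := Real.norm_exp_I_mul_ofReal_sub_one_le (x := 2 * Real.pi * x)
  rw [addChar_eq, mul_comm _ Complex.I]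
  refine this.trans_eq ?_
  rw [Real.norm_eq_abs, abs_mul, abs_of_pos Real.two_pi_pos]

theorem norm_addChar_sub_addChar_le (x y : ℝ) :
    ‖addChar x - addChar y‖ ≤ 2 * Real.pi * |x - y| := by
  have h : addChar x - addChar y = addChar y * (addChar (x - y) - 1) := by
    rw [mul_sub, ← addChar_add]
    simp
  rw [h, norm_mul, norm_addChar, one_mul]
  exact norm_addChar_sub_one_le _

theorem norm_addChar_sub_one_sub_le {x : ℝ} (hx : 2 * Real.pi * |x| ≤ 1) :
    ‖addChar x - 1 - 2 * Real.pi * x * Complex.I‖ ≤ (2 * Real.pi * |x|) ^ 2 := by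
  have hn : ‖(((2 * Real.pi * x : ℝ) : ℂ) * Complex.I)‖ = 2 * Real.pi * |x| := by
    rw [norm_mul, Complex.norm_I, mul_one, Complex.norm_real, Real.norm_eq_abs, abs_mul,
      abs_of_pos Real.two_pi_pos]
  have := Complex.norm_exp_sub_one_sub_id_le (x := ((2 * Real.pi * x : ℝ) : ℂ) * Complex.I)
    (by rw [hn]; exact hx)
  rw [hn] at this
  rw [addChar_eq]
  convert this using 3
  push_cast
  ring

theorem norm_addChar_sub_one (x : ℝ) : ‖addChar x - 1‖ = 2 * |Real.sin (Real.pi * x)| := by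
  have h : addChar x - 1 = addChar (x / 2) * (2 * Complex.I * Real.sin (Real.pi * x)) := by
    have h2 : addChar x = addChar (x / 2) * addChar (x / 2) := by
      rw [← addChar_add]; ring_nf
    have h3 : (1 : ℂ) = addChar (x / 2) * addChar (-(x / 2)) := by
      rw [← addChar_add]; simp [addChar_zero]
    rw [h2, h3, ← mul_sub]
    congr 1
    rw [addChar_eq, addChar_eq, Complex.ofReal_sin, Complex.sin]
    have e1 : (((2 * Real.pi * (x / 2) : ℝ) : ℂ) * Complex.I) = (Real.pi * x : ℝ) * Complex.I := by
      push_cast; ring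
    have e2 : (((2 * Real.pi * (-(x / 2)) : ℝ) : ℂ) * Complex.I)
        = -((Real.pi * x : ℝ) : ℂ) * Complex.I := by
      push_cast; ring
    rw [e1, e2]
    have hI : Complex.I * Complex.I = -1 := Complex.I_mul_I
    linear_combination (Complex.exp ((Real.pi * x : ℝ) * Complex.I)
      - Complex.exp (-((Real.pi * x : ℝ) : ℂ) * Complex.I)) * hI
  rw [h, norm_mul, norm_addChar, one_mul, norm_mul, norm_mul, Complex.norm_I, Complex.norm_real,
    Real.norm_eq_abs]
  simp

/-- Jordan's inequality `2 t / π ≤ sin t`, applied at `t = π |x - round x|`, which lies in `[0,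
π/2]`. -/
theorem four_mul_abs_sub_round_le (x : ℝ) : 4 * |x - round x| ≤ ‖addChar x - 1‖ := by
  have h0 : addChar x = addChar (x - round x) := by
    conv_lhs => rw [← sub_add_cancel x (round x : ℝ)]
    exact addChar_add_intCast _ _
  have h1 : |x - round x| ≤ 1 / 2 := abs_sub_round x
  rw [h0, norm_addChar_sub_one]
  set y := x - round x
  have h2 : |Real.sin (Real.pi * y)| = Real.sin (Real.pi * |y|) := by
    have hnn : 0 ≤ Real.sin (Real.pi * |y|) := by
      apply Real.sin_nonneg_of_nonneg_of_le_pi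
      · positivity
      · nlinarith [Real.pi_pos]
    rcases abs_cases y with ⟨h, _⟩ | ⟨h, _⟩
    · rw [h] at hnn ⊢; exact abs_of_nonneg hnn
    · rw [h] at hnn ⊢
      rw [mul_neg, Real.sin_neg] at hnn ⊢
      exact abs_of_nonpos (by linarith)
  rw [h2]
  have h3 := Real.mul_le_sin (x := Real.pi * |y|) (by positivity) (by nlinarith [Real.pi_pos])
  have h4 : 2 / Real.pi * (Real.pi * |y|) = 2 * |y| := by
    field_simp
  linarith

theorem norm_sum_addChar_le_card {ι : Type*} (s : Finset ι) (k : ι → ℝ) :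
    ‖∑ i ∈ s, addChar (k i)‖ ≤ s.card := by
  refine (norm_sum_le _ _).trans ?_
  simp [norm_addChar]

/-- The product form avoids dividing by `addChar θ - 1`, so integral `θ` needs no separate
treatment. -/
theorem norm_geom_sum_addChar_mul_le (L : ℕ) (θ : ℝ) :
    ‖∑ x ∈ Finset.range L, addChar (x * θ)‖ * (2 * |θ - round θ|) ≤ 1 := by
  have h1 : (∑ x ∈ Finset.range L, addChar (x * θ)) * (addChar θ - 1) = addChar θ ^ L - 1 := by
    simp_rw [addChar_nsmul]
    exact geom_sum_mul _ _
  have h2 : ‖addChar θ ^ L - 1‖ ≤ 2 := by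
    refine (norm_sub_le _ _).trans ?_
    rw [norm_pow, norm_addChar]
    norm_num
  have h3 := four_mul_abs_sub_round_le θ
  rw [← h1, norm_mul] at h2
  have := mul_le_mul_of_nonneg_left h3 (norm_nonneg (∑ x ∈ Finset.range L, addChar (x * θ)))
  linarith

theorem integral_addChar_int_mul (k : ℤ) :
    ∫ α in (0 : ℝ)..1, addChar (k * α) = if k = 0 then 1 else 0 := by
  split_ifs with h
  · simp [h, addChar_zero]
  · have hc : (2 * Real.pi * Complex.I * k : ℂ) ≠ 0 := by
      have : (Real.pi : ℂ) ≠ 0 := by exact_mod_cast Real.pi_ne_zero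
      have hk : (k : ℂ) ≠ 0 := by exact_mod_cast h
      simp [this, hk]
    have := integral_exp_mul_complex (a := 0) (b := 1) hc
    have h2 : ∀ α : ℝ, addChar (k * α) = Complex.exp (2 * Real.pi * Complex.I * k * α) := by
      intro α
      unfold addChar
      congr 1
      push_cast
      ring
    simp_rw [h2]
    rw [this]
    have h3 : Complex.exp (2 * Real.pi * Complex.I * k * (1 : ℝ)) = 1 := by
      rw [← addChar_intCast k]
      unfold addChar
      congr 1
      push_cast
      ring
    rw [h3]
    simp

/-- Abel summation against an antitone weight. -/
theorem norm_sum_mul_le_of_antitone {h : ℕ → ℝ} {a : ℕ → ℂ} {n : ℕ} {B : ℝ}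
    (hanti : ∀ i, i + 1 < n → h (i + 1) ≤ h i) (hnn : ∀ i, i ≤ n → 0 ≤ h i)
    (hB : ∀ m ≤ n, ‖∑ i ∈ Finset.range m, a i‖ ≤ B) :
    ‖∑ i ∈ Finset.range n, (h i : ℂ) * a i‖ ≤ h 0 * B := by
  rcases Nat.eq_zero_or_pos n with rfl | hn
  · have h1 := hB 0 le_rfl
    simp only [Finset.range_zero, Finset.sum_empty, norm_zero] at h1 ⊢
    exact mul_nonneg (hnn 0 le_rfl) h1
  have := Finset.sum_range_by_parts (fun i => (h i : ℂ)) a n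
  simp only [smul_eq_mul] at this
  rw [this]
  have hB0 : 0 ≤ B := (norm_nonneg _).trans (hB 0 (Nat.zero_le _))
  refine (norm_sub_le _ _).trans ?_
  have h1 : ‖(h (n - 1) : ℂ) * ∑ i ∈ Finset.range n, a i‖ ≤ h (n - 1) * B := by
    rw [norm_mul, Complex.norm_real, Real.norm_of_nonneg (hnn _ (by omega))]
    exact mul_le_mul_of_nonneg_left (hB n le_rfl) (hnn _ (by omega))
  have h2 : ‖∑ i ∈ Finset.range (n - 1), ((h (i + 1) : ℂ) - h i) *
      ∑ j ∈ Finset.range (i + 1), a j‖ ≤ ∑ i ∈ Finset.range (n - 1), (h i - h (i + 1)) * B := by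
    refine (norm_sum_le _ _).trans (Finset.sum_le_sum fun i hi => ?_)
    have hi' := Finset.mem_range.1 hi
    rw [norm_mul, ← Complex.ofReal_sub, Complex.norm_real, Real.norm_eq_abs, abs_sub_comm,
      abs_of_nonneg (by linarith [hanti i (by omega)])]
    exact mul_le_mul_of_nonneg_left (hB _ (by omega)) (by linarith [hanti i (by omega)])
  have h3 : ∑ i ∈ Finset.range (n - 1), (h i - h (i + 1)) * B = (h 0 - h (n - 1)) * B := by
    rw [← Finset.sum_mul, Finset.sum_range_sub']
  linarith

/-- Abel summation against a monotone weight. -/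
theorem norm_sum_mul_le_of_monotone {h : ℕ → ℝ} {a : ℕ → ℂ} {n : ℕ} {B : ℝ}
    (hmono : Monotone h) (hnn : ∀ i, 0 ≤ h i)
    (hB : ∀ m ≤ n, ‖∑ i ∈ Finset.range m, a i‖ ≤ B) :
    ‖∑ i ∈ Finset.range n, (h i : ℂ) * a i‖ ≤ 2 * h n * B := by
  have hB0 : 0 ≤ B := (norm_nonneg _).trans (hB 0 (Nat.zero_le _))
  -- The complementary weight `h n - h i` is antitone, which reduces the claim to the previous
  -- lemma.
  have h1 : ∑ i ∈ Finset.range n, (h i : ℂ) * a i = (h n : ℂ) * ∑ i ∈ Finset.range n, a i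
      - ∑ i ∈ Finset.range n, ((h n - h i : ℝ) : ℂ) * a i := by
    rw [Finset.mul_sum, ← Finset.sum_sub_distrib]
    refine Finset.sum_congr rfl fun i _ => ?_
    push_cast
    ring
  have h2 : ‖∑ i ∈ Finset.range n, ((h n - h i : ℝ) : ℂ) * a i‖ ≤ (h n - h 0) * B :=
    norm_sum_mul_le_of_antitone (h := fun i => h n - h i)
      (fun i _ => by have := hmono (Nat.le_succ i); simp only [Nat.succ_eq_add_one] at this; linarith)
      (fun i hi => by have := hmono hi; linarith) hB
  have h3 : ‖(h n : ℂ) * ∑ i ∈ Finset.range n, a i‖ ≤ h n * B := by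
    rw [norm_mul, Complex.norm_real, Real.norm_of_nonneg (hnn _)]
    exact mul_le_mul_of_nonneg_left (hB n le_rfl) (hnn _)
  rw [h1]
  refine (norm_sub_le _ _).trans ?_
  nlinarith [mul_nonneg (hnn 0) hB0]

/-! ### Divisor bounds -/

/-- The local factor of the divisor bound. From `1 + x ≤ exp x` one gets `p^{vε} ≥ 1 + v ε log 2`,
uniformly in `p ≥ 2`. -/
theorem exists_add_one_le_rpow {ε : ℝ} (hε : 0 < ε) :
    ∃ C : ℝ, 1 ≤ C ∧ ∀ p v : ℕ, 2 ≤ p → (v : ℝ) + 1 ≤ C * ((p : ℝ) ^ v) ^ ε := by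
  have hl : 0 < Real.log 2 := Real.log_pos (by norm_num)
  refine ⟨max 1 (1 / (ε * Real.log 2)), le_max_left _ _, fun p v hp => ?_⟩
  have hp' : (2 : ℝ) ≤ p := by exact_mod_cast hp
  have h1 : 1 + v * (ε * Real.log 2) ≤ ((p : ℝ) ^ v) ^ ε := by
    have e : ((p : ℝ) ^ v) ^ ε = Real.exp (v * (ε * Real.log p)) := by
      rw [← Real.rpow_natCast, ← Real.rpow_mul (by positivity), Real.rpow_def_of_pos (by positivity)]
      congr 1
      ring
    rw [e]
    have hlog : Real.log 2 ≤ Real.log p := Real.log_le_log (by norm_num) hp'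
    have := Real.add_one_le_exp (v * (ε * Real.log p))
    have h3 : v * (ε * Real.log 2) ≤ v * (ε * Real.log p) := by gcongr
    linarith
  set c := max 1 (1 / (ε * Real.log 2)) with hc
  have hc1 : 1 ≤ c := le_max_left _ _
  have hc2 : 1 ≤ c * (ε * Real.log 2) := by
    have := le_max_right 1 (1 / (ε * Real.log 2))
    rw [← hc, div_le_iff₀ (by positivity)] at this
    exact this
  calc (v : ℝ) + 1 ≤ v * (c * (ε * Real.log 2)) + c := by
        have : (v : ℝ) * 1 ≤ v * (c * (ε * Real.log 2)) := by gcongr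
        linarith
    _ = c * (1 + v * (ε * Real.log 2)) := by ring
    _ ≤ _ := by gcongr

/-- The divisor bound `d(n) ≪ n ^ ε`. -/
theorem exists_card_divisors_le {ε : ℝ} (hε : 0 < ε) :
    ∃ C : ℝ, 1 ≤ C ∧ ∀ n : ℕ, n ≠ 0 → (n.divisors.card : ℝ) ≤ C * (n : ℝ) ^ ε := by
  obtain ⟨C₀, hC₀, h⟩ := exists_add_one_le_rpow hε
  -- A prime above `2^{1/ε}` has `p^ε ≥ 2`, hence `v + 1 ≤ 2^v ≤ p^{vε}` with constant `1`. Only the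
  -- primes up to `P` cost a factor `C₀`.
  set P := ⌈(2 : ℝ) ^ (1 / ε)⌉₊
  refine ⟨C₀ ^ (P + 1), one_le_pow₀ hC₀, fun n hn => ?_⟩
  have hn' : (n : ℝ) ^ ε = ∏ p ∈ n.primeFactors, ((p : ℝ) ^ (n.factorization p)) ^ ε := by
    rw [Real.finsetProd_rpow _ _ (fun i _ => by positivity)]
    congr 1
    conv_lhs => rw [← Nat.prod_factorization_pow_eq_self hn]
    rw [Finsupp.prod]
    push_cast
    rfl
  have hfac : ∀ p ∈ n.primeFactors, ((n.factorization p + 1 : ℕ) : ℝ) ≤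
      (if p < P + 1 then C₀ else 1) * ((p : ℝ) ^ (n.factorization p)) ^ ε := by
    intro p hp
    have hp2 : 2 ≤ p := (Nat.prime_of_mem_primeFactors hp).two_le
    push_cast
    split_ifs with hpP
    · exact h p _ hp2
    · have hpos : (0 : ℝ) < p := by positivity
      have h2 : (2 : ℝ) ≤ (p : ℝ) ^ ε := by
        have h3 : (2 : ℝ) ^ (1 / ε) ≤ p := (Nat.le_ceil _).trans (by
          have : P ≤ p := by omega
          exact_mod_cast this)
        have h4 := Real.rpow_le_rpow (by positivity) h3 hε.le
        rwa [← Real.rpow_mul (by norm_num), one_div_mul_cancel hε.ne', Real.rpow_one] at h4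
      have h5 : ((p : ℝ) ^ (n.factorization p)) ^ ε = ((p : ℝ) ^ ε) ^ (n.factorization p) := by
        rw [← Real.rpow_natCast, ← Real.rpow_natCast, ← Real.rpow_mul hpos.le,
          ← Real.rpow_mul hpos.le, mul_comm]
      rw [h5, one_mul]
      calc ((n.factorization p : ℝ) + 1) ≤ 2 ^ (n.factorization p) := by
            exact_mod_cast Nat.lt_two_pow_self
        _ ≤ _ := by gcongr
  calc (n.divisors.card : ℝ) = ∏ p ∈ n.primeFactors, ((n.factorization p + 1 : ℕ) : ℝ) := by
        rw [Nat.card_divisors hn]; push_cast; rfl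
    _ ≤ ∏ p ∈ n.primeFactors,
        ((if p < P + 1 then C₀ else 1) * ((p : ℝ) ^ (n.factorization p)) ^ ε) :=
        Finset.prod_le_prod (fun _ _ => by positivity) hfac
    _ = (∏ p ∈ n.primeFactors, if p < P + 1 then C₀ else 1) * (n : ℝ) ^ ε := by
        rw [Finset.prod_mul_distrib, hn']
    _ ≤ _ := by
        gcongr
        rw [← Finset.prod_filter, Finset.prod_const]
        refine pow_le_pow_right₀ hC₀ ?_
        calc _ ≤ (Finset.range (P + 1)).card := Finset.card_le_card fun x hx => by
              simpa using (Finset.mem_filter.1 hx).2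
          _ = P + 1 := Finset.card_range _

/-- The number of divisors of `n` in `[1, R]`. -/
def divCount (R n : ℕ) : ℕ := ((Finset.Icc 1 R).filter (· ∣ n)).card

theorem divCount_le (R n : ℕ) : divCount R n ≤ R :=
  (Finset.card_filter_le _ _).trans (by simp)

/-- Send a divisor `x` of `q m` to `g = gcd(x, q)` and `x / g`. The cofactor divides `(q / g) m` and
is coprime to `q / g`, so it divides `m`. -/
theorem divCount_mul_le (R : ℕ) {q : ℕ} (hq : q ≠ 0) (m : ℕ) :
    divCount R (q * m) ≤ q.divisors.card * divCount R m := by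
  unfold divCount
  rw [← Finset.card_product]
  refine Finset.card_le_card_of_injOn (fun x => (x.gcd q, x / x.gcd q)) ?_ ?_
  · intro x hx
    simp only [Finset.coe_filter, Finset.mem_Icc, Set.mem_ofPred_eq] at hx
    have hg : 0 < x.gcd q := Nat.gcd_pos_of_pos_right _ (Nat.pos_of_ne_zero hq)
    simp only [Finset.coe_product, Set.mem_prod, Finset.mem_coe, Nat.mem_divisors,
      Finset.mem_filter, Finset.mem_Icc]
    refine ⟨⟨Nat.gcd_dvd_right _ _, hq⟩, ⟨?_, (Nat.div_le_self _ _).trans hx.1.2⟩, ?_⟩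
    · exact Nat.div_pos (Nat.le_of_dvd (by omega) (Nat.gcd_dvd_left _ _)) hg
    · have h1 : x / x.gcd q ∣ (q / x.gcd q) * m := by
        have h2 : x / x.gcd q ∣ (q * m) / x.gcd q :=
          Nat.div_dvd_div (Nat.gcd_dvd_left _ _) hx.2
        rwa [Nat.mul_comm, Nat.mul_div_assoc _ (Nat.gcd_dvd_right x q), Nat.mul_comm] at h2
      exact (Nat.coprime_div_gcd_div_gcd hg).dvd_of_dvd_mul_left h1
  · intro x _ y _ hxy
    simp only [Prod.mk.injEq] at hxy
    rw [← Nat.div_mul_cancel (Nat.gcd_dvd_left x q), ← Nat.div_mul_cancel (Nat.gcd_dvd_left y q),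
      hxy.2, hxy.1]

theorem sum_one_div_le (R : ℕ) : ∑ q ∈ Finset.Icc 1 R, (1 : ℝ) / q ≤ 1 + Real.log R := by
  have := harmonic_le_one_add_log R
  rw [harmonic_eq_sum_Icc] at this
  push_cast at this
  simpa [one_div] using this

theorem sum_Icc_filter_dvd (y : ℕ) {q : ℕ} (hq : 0 < q) (g : ℕ → ℝ) :
    ∑ n ∈ (Finset.Icc 1 y).filter (q ∣ ·), g n = ∑ m ∈ Finset.Icc 1 (y / q), g (q * m) := by
  symm
  refine Finset.sum_bij (fun m _ => q * m) ?_ ?_ ?_ ?_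
  · intro m hm
    simp only [Finset.mem_Icc] at hm
    simp only [Finset.mem_filter, Finset.mem_Icc, dvd_mul_right, and_true]
    refine ⟨Nat.mul_pos hq hm.1, ?_⟩
    rw [mul_comm]
    exact (Nat.le_div_iff_mul_le hq).1 hm.2
  · intro a _ b _ h
    exact Nat.eq_of_mul_eq_mul_left hq h
  · intro b hb
    simp only [Finset.mem_filter, Finset.mem_Icc] at hb
    obtain ⟨m, rfl⟩ := hb.2
    refine ⟨m, ?_, rfl⟩
    simp only [Finset.mem_Icc]
    refine ⟨Nat.pos_of_ne_zero ?_, (Nat.le_div_iff_mul_le hq).2 (by rw [mul_comm]; exact hb.1.2)⟩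
    rintro rfl
    simp at hb
  · intro a _
    rfl

/-- Moments of the restricted divisor function. -/
theorem exists_sum_divCount_pow_le (k : ℕ) : ∀ ε : ℝ, 0 < ε → ∃ C : ℝ, 0 ≤ C ∧
    ∀ R y : ℕ, 1 ≤ R →
      ∑ n ∈ Finset.Icc 1 y, (divCount R n : ℝ) ^ k ≤ C * (R : ℝ) ^ ε * y := by
  induction k with
  | zero =>
    intro ε hε
    refine ⟨1, zero_le_one, fun R y hR => ?_⟩
    have h1 : (1 : ℝ) ≤ (R : ℝ) ^ ε := Real.one_le_rpow (by exact_mod_cast hR) hε.le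
    simp only [pow_zero, Finset.sum_const, Nat.card_Icc, Nat.add_sub_cancel, nsmul_eq_mul, mul_one,
      one_mul]
    nlinarith [(Nat.cast_nonneg y : (0 : ℝ) ≤ y)]
  | succ k ih =>
    intro ε hε
    obtain ⟨C, hC, hM⟩ := ih (ε / 2) (by positivity)
    -- The exponent makes the `k`-th power of `d(q)` cost at most `R^{ε/4}`. The induction
    -- hypothesis costs `R^{ε/2}` and the harmonic sum the last `R^{ε/4}`.
    obtain ⟨D, hD, hdiv⟩ := exists_card_divisors_le (ε := ε / (4 * (k + 1))) (by positivity)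
    refine ⟨D ^ k * C * (1 + 4 / ε), by positivity, fun R y hR => ?_⟩
    have hR' : (1 : ℝ) ≤ R := by exact_mod_cast hR
    have hRpos : (0 : ℝ) < R := by positivity
    -- One factor of the power is opened as a sum over the divisors `q ≤ R` of `n`, and the
    -- summations are exchanged.
    have step1 : ∑ n ∈ Finset.Icc 1 y, (divCount R n : ℝ) ^ (k + 1) =
        ∑ q ∈ Finset.Icc 1 R, ∑ n ∈ (Finset.Icc 1 y).filter (q ∣ ·), (divCount R n : ℝ) ^ k := by
      simp_rw [Finset.sum_filter]
      rw [Finset.sum_comm]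
      refine Finset.sum_congr rfl fun n _ => ?_
      rw [← Finset.sum_filter, Finset.sum_const, pow_succ, nsmul_eq_mul, mul_comm]
      rfl
    rw [step1]
    have step2 : ∀ q ∈ Finset.Icc 1 R,
        ∑ n ∈ (Finset.Icc 1 y).filter (q ∣ ·), (divCount R n : ℝ) ^ k ≤
          D ^ k * (R : ℝ) ^ (ε / 4) * (C * (R : ℝ) ^ (ε / 2) * y) * (1 / q) := by
      intro q hq
      obtain ⟨hq1, hqR⟩ := Finset.mem_Icc.1 hq
      have hqpos : (0 : ℝ) < q := by exact_mod_cast hq1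
      rw [sum_Icc_filter_dvd y hq1]
      calc ∑ m ∈ Finset.Icc 1 (y / q), (divCount R (q * m) : ℝ) ^ k
          ≤ ∑ m ∈ Finset.Icc 1 (y / q), (q.divisors.card : ℝ) ^ k * (divCount R m : ℝ) ^ k := by
            refine Finset.sum_le_sum fun m _ => ?_
            rw [← mul_pow]
            gcongr
            exact_mod_cast divCount_mul_le R (by omega) m
        _ = (q.divisors.card : ℝ) ^ k * ∑ m ∈ Finset.Icc 1 (y / q), (divCount R m : ℝ) ^ k := by
            rw [Finset.mul_sum]
        _ ≤ (D ^ k * (R : ℝ) ^ (ε / 4)) * (C * (R : ℝ) ^ (ε / 2) * ((y / q : ℕ) : ℝ)) := by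
            gcongr
            · calc (q.divisors.card : ℝ) ^ k
                  ≤ (D * (q : ℝ) ^ (ε / (4 * (k + 1)))) ^ k := by
                    gcongr; exact hdiv q (by omega)
                _ = D ^ k * (q : ℝ) ^ (ε / (4 * (k + 1)) * k) := by
                    rw [mul_pow, ← Real.rpow_natCast ((q : ℝ) ^ _), ← Real.rpow_mul hqpos.le]
                _ ≤ D ^ k * (R : ℝ) ^ (ε / (4 * (k + 1)) * k) := by
                    gcongr
                _ ≤ D ^ k * (R : ℝ) ^ (ε / 4) := by
                    gcongr
                    · rw [div_mul_eq_mul_div, div_le_div_iff₀ (by positivity) (by positivity)]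
                      nlinarith
            · exact hM R _ hR
        _ ≤ (D ^ k * (R : ℝ) ^ (ε / 4)) * (C * (R : ℝ) ^ (ε / 2) * (y / q)) := by
            gcongr
            exact Nat.cast_div_le
        _ = _ := by ring
    refine (Finset.sum_le_sum step2).trans ?_
    rw [← Finset.mul_sum]
    have hlog : ∑ q ∈ Finset.Icc 1 R, (1 : ℝ) / q ≤ (1 + 4 / ε) * (R : ℝ) ^ (ε / 4) := by
      have h1 := sum_one_div_le R
      have h2 := Real.log_le_rpow_div hRpos.le (show 0 < ε / 4 by positivity)
      have h3 : (1 : ℝ) ≤ (R : ℝ) ^ (ε / 4) := Real.one_le_rpow hR' (by positivity)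
      have h4 : (R : ℝ) ^ (ε / 4) / (ε / 4) = 4 / ε * (R : ℝ) ^ (ε / 4) := by
        field_simp
      linarith
    calc _ ≤ D ^ k * (R : ℝ) ^ (ε / 4) * (C * (R : ℝ) ^ (ε / 2) * y) *
          ((1 + 4 / ε) * (R : ℝ) ^ (ε / 4)) := by gcongr
      _ = D ^ k * C * (1 + 4 / ε) *
          ((R : ℝ) ^ (ε / 4) * (R : ℝ) ^ (ε / 2) * (R : ℝ) ^ (ε / 4)) * y := by ring
      _ = _ := by
          rw [← Real.rpow_add hRpos, ← Real.rpow_add hRpos]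
          ring_nf

/-! ### Exponential sums and duality -/

/-- The trigonometric polynomial `∑ⱼ cⱼ e(kⱼ α)`. -/
noncomputable def expSum {ι : Type*} (s : Finset ι) (c : ι → ℂ) (k : ι → ℤ) (α : ℝ) : ℂ :=
  ∑ j ∈ s, c j * addChar (k j * α)

theorem continuous_expSum {ι : Type*} (s : Finset ι) (c : ι → ℂ) (k : ι → ℤ) :
    Continuous (expSum s c k) := by
  unfold expSum
  refine continuous_finsetSum _ fun j _ => continuous_const.mul ?_
  exact continuous_addChar.comp (by fun_prop)

theorem norm_expSum_le {ι : Type*} (s : Finset ι) (c : ι → ℂ) (k : ι → ℤ) (α : ℝ) :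
    ‖expSum s c k α‖ ≤ ∑ j ∈ s, ‖c j‖ := by
  refine (norm_sum_le _ _).trans (Finset.sum_le_sum fun j _ => ?_)
  rw [norm_mul, norm_addChar, mul_one]

section Duality
variable {ν : Measure ℝ}

theorem integrable_mul_addChar [IsFiniteMeasure ν] {g : ℝ → ℂ} (hg : Measurable g) (hg1 : ∀ α, ‖g α‖ ≤ 1)
    {h : ℝ → ℝ} (hh : Continuous h) : Integrable (fun α => g α * addChar (h α)) ν := by
  refine Integrable.of_bound
    (hg.mul (continuous_addChar.comp hh).measurable).aestronglyMeasurable 1 ?_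
  refine Filter.Eventually.of_forall fun α => ?_
  rw [norm_mul, norm_addChar, mul_one]
  exact hg1 α

theorem integral_conj_mul_addChar (g : ℝ → ℂ) (x : ℝ) :
    ∫ β, (starRingEnd ℂ) (g β) * addChar (-(x * β)) ∂ν =
      (starRingEnd ℂ) (∫ β, g β * addChar (x * β) ∂ν) := by
  rw [← integral_conj]
  congr 1
  ext β
  rw [map_mul, conj_addChar]

theorem integral_mul_conj_addChar_sub (g : ℝ → ℂ) (x α : ℝ) :
    ∫ β, g α * (starRingEnd ℂ) (g β) * addChar (x * (α - β)) ∂ν =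
      g α * addChar (x * α) * (starRingEnd ℂ) (∫ β, g β * addChar (x * β) ∂ν) := by
  rw [← integral_conj_mul_addChar, ← integral_const_mul]
  congr 1
  ext β
  rw [mul_sub, sub_eq_add_neg, addChar_add]
  ring

theorem integral_integral_addChar_sub (g : ℝ → ℂ) (x : ℝ) :
    ∫ α, ∫ β, g α * (starRingEnd ℂ) (g β) * addChar (x * (α - β)) ∂ν ∂ν =
      (‖∫ α, g α * addChar (x * α) ∂ν‖ ^ 2 : ℝ) := by
  simp_rw [integral_mul_conj_addChar_sub]
  rw [integral_mul_const, Complex.mul_conj']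
  push_cast
  rfl

theorem integrable_of_continuous_of_bound [IsFiniteMeasure ν] {B : ℝ → ℝ} (hB : Continuous B) {M : ℝ}
    (hM : ∀ θ, |B θ| ≤ M) (α : ℝ) : Integrable (fun β => B (α - β)) ν :=
  Integrable.of_bound (hB.comp (by fun_prop)).aestronglyMeasurable M
    (Filter.Eventually.of_forall fun β => hM _)

theorem integrable_integral_of_continuous_of_bound [IsFiniteMeasure ν] {B : ℝ → ℝ} (hB : Continuous B) {M : ℝ}
    (hM : ∀ θ, |B θ| ≤ M) : Integrable (fun α => ∫ β, B (α - β) ∂ν) ν := by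
  have h : Integrable (fun z : ℝ × ℝ => B (z.1 - z.2)) (ν.prod ν) :=
    Integrable.of_bound (hB.comp (by fun_prop)).aestronglyMeasurable M
      (Filter.Eventually.of_forall fun β => hM _)
  exact h.integral_prod_left

/-- The `TT*` inequality: the size of a set on which an exponential sum is large is controlled by
the exponential sum of a majorant. -/
theorem level_set_sq_le [IsFiniteMeasure ν] {ι : Type*} (s : Finset ι) {c : ι → ℂ} {ω v : ι → ℝ} (k : ι → ℤ)
    {T l : ℝ} (hl : 0 ≤ l) (hω : ∀ j ∈ s, 0 ≤ ω j) (hv : ∀ j ∈ s, 0 ≤ v j)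
    (hc : ∀ j ∈ s, ‖c j‖ ^ 2 ≤ ω j * v j) (hvT : ∑ j ∈ s, v j ≤ T)
    (hF : ∀ᵐ α ∂ν, l ≤ ‖expSum s c k α‖) {B : ℝ → ℝ} (hB : Continuous B) {M : ℝ}
    (hM : ∀ θ, |B θ| ≤ M) (hK : ∀ θ, ‖expSum s (fun j => (ω j : ℂ)) k θ‖ ≤ B θ) :
    (l * ν.real Set.univ) ^ 2 ≤ T * ∫ α, ∫ β, B (α - β) ∂ν ∂ν := by
  set F := expSum s c k with hFdef
  have hFc : Continuous F := continuous_expSum s c k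
  -- The conjugate phase of `F`, so that `g F = |F|`. At zeros of `F` division by zero gives `g =
  -- 0`, which is harmless.
  set g : ℝ → ℂ := fun α => (starRingEnd ℂ) (F α) / ‖F α‖ with hgdef
  have hgm : Measurable g := by
    refine Measurable.div ?_ ?_
    · exact (Complex.continuous_conj.comp hFc).measurable
    · exact (Complex.continuous_ofReal.comp hFc.norm).measurable
  have hg1 : ∀ α, ‖g α‖ ≤ 1 := by
    intro α
    simp only [hgdef]
    rw [norm_div, RCLike.norm_conj, Complex.norm_real, norm_norm]
    exact div_self_le_one _
  have hgF : ∀ α, g α * F α = (‖F α‖ : ℂ) := by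
    intro α
    simp only [hgdef]
    rw [div_mul_eq_mul_div, Complex.conj_mul']
    rcases eq_or_ne (‖F α‖ : ℂ) 0 with h0 | h0
    · simp [h0]
    · field_simp
  set G : ι → ℂ := fun j => ∫ α, g α * addChar (k j * α) ∂ν with hG
  have hint : ∀ j, Integrable (fun α => g α * addChar (k j * α)) ν := fun j =>
    integrable_mul_addChar hgm hg1 (by fun_prop)
  have hFint : Integrable (fun α => ‖F α‖) ν :=
    Integrable.of_bound hFc.norm.aestronglyMeasurable (∑ j ∈ s, ‖c j‖)
      (Filter.Eventually.of_forall fun α => by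
        rw [norm_norm]; exact norm_expSum_le s c k α)
  have h1 : l * ν.real Set.univ ≤ ∫ α, ‖F α‖ ∂ν := by
    have := integral_mono_ae (integrable_const l) hFint hF
    rw [integral_const, smul_eq_mul] at this
    linarith
  have h2 : ((∫ α, ‖F α‖ ∂ν : ℝ) : ℂ) = ∑ j ∈ s, c j * G j := by
    rw [← integral_complex_ofReal]
    simp_rw [hG, ← integral_const_mul]
    rw [← integral_finsetSum]
    · congr 1
      ext α
      rw [← hgF, hFdef]
      unfold expSum
      rw [Finset.mul_sum]
      exact Finset.sum_congr rfl fun j _ => by ring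
    · exact fun j _ => (hint j).const_mul _
  have h3 : l * ν.real Set.univ ≤ ∑ j ∈ s, ‖c j‖ * ‖G j‖ := by
    refine h1.trans ((le_abs_self _).trans ?_)
    rw [← Real.norm_eq_abs, ← Complex.norm_real, h2]
    refine (norm_sum_le _ _).trans (Finset.sum_le_sum fun j _ => ?_)
    rw [norm_mul]
  -- Cauchy–Schwarz with weights `v` and `ω`; this is where the factorised bound on the coefficients
  -- is used.
  have h4 : (∑ j ∈ s, ‖c j‖ * ‖G j‖) ^ 2 ≤ (∑ j ∈ s, v j) * ∑ j ∈ s, ω j * ‖G j‖ ^ 2 := by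
    refine Finset.sum_sq_le_sum_mul_sum_of_sq_le_mul _ hv
      (fun j hj => mul_nonneg (hω j hj) (sq_nonneg _)) fun j hj => ?_
    rw [mul_pow]
    nlinarith [mul_le_mul_of_nonneg_right (hc j hj) (sq_nonneg ‖G j‖)]
  -- Opening the squares `‖G j‖²` as double integrals and summing over `j` produces the kernel of
  -- `ω` at `α - β`.
  have h5 : ((∑ j ∈ s, ω j * ‖G j‖ ^ 2 : ℝ) : ℂ) =
      ∫ α, ∫ β, g α * (starRingEnd ℂ) (g β) *
        expSum s (fun j => (ω j : ℂ)) k (α - β) ∂ν ∂ν := by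
    have e1 : ∀ α, ∫ β, g α * (starRingEnd ℂ) (g β) *
        expSum s (fun j => (ω j : ℂ)) k (α - β) ∂ν =
        ∑ j ∈ s, (ω j : ℂ) * (g α * addChar (k j * α) * (starRingEnd ℂ) (G j)) := by
      intro α
      simp_rw [hG, ← integral_mul_conj_addChar_sub, ← integral_const_mul]
      rw [← integral_finsetSum]
      · congr 1
        ext β
        unfold expSum
        rw [Finset.mul_sum]
        exact Finset.sum_congr rfl fun j _ => by ring
      · intro j _
        refine Integrable.const_mul ?_ _
        have : Integrable (fun β => (g α * (starRingEnd ℂ) (g β)) *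
            addChar (k j * (α - β))) ν := by
          refine integrable_mul_addChar ?_ ?_ (by fun_prop)
          · exact (Complex.continuous_conj.measurable.comp hgm).const_mul _
          · intro β
            rw [norm_mul, RCLike.norm_conj]
            exact mul_le_one₀ (hg1 α) (norm_nonneg _) (hg1 β)
        exact this
    simp_rw [e1]
    rw [integral_finsetSum]
    · push_cast
      refine Finset.sum_congr rfl fun j _ => ?_
      rw [integral_const_mul, integral_mul_const, Complex.mul_conj']
    · exact fun j _ => ((hint j).mul_const _).const_mul _
  have h6 : ∑ j ∈ s, ω j * ‖G j‖ ^ 2 ≤ ∫ α, ∫ β, B (α - β) ∂ν ∂ν := by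
    refine (le_abs_self _).trans ?_
    rw [← Real.norm_eq_abs, ← Complex.norm_real, h5]
    refine norm_integral_le_of_norm_le (integrable_integral_of_continuous_of_bound hB hM)
      (Filter.Eventually.of_forall fun α => ?_)
    refine norm_integral_le_of_norm_le (integrable_of_continuous_of_bound hB hM α)
      (Filter.Eventually.of_forall fun β => ?_)
    rw [norm_mul, norm_mul, RCLike.norm_conj]
    calc ‖g α‖ * ‖g β‖ * ‖expSum s (fun j => (ω j : ℂ)) k (α - β)‖
        ≤ 1 * ‖expSum s (fun j => (ω j : ℂ)) k (α - β)‖ := by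
          gcongr
          exact mul_le_one₀ (hg1 α) (norm_nonneg _) (hg1 β)
      _ ≤ B (α - β) := by rw [one_mul]; exact hK _
  have h7 : 0 ≤ ∑ j ∈ s, ω j * ‖G j‖ ^ 2 :=
    Finset.sum_nonneg fun j hj => mul_nonneg (hω j hj) (sq_nonneg _)
  calc (l * ν.real Set.univ) ^ 2 ≤ (∑ j ∈ s, ‖c j‖ * ‖G j‖) ^ 2 := by
        have : 0 ≤ l * ν.real Set.univ := by positivity
        gcongr
    _ ≤ _ := h4
    _ ≤ T * ∑ j ∈ s, ω j * ‖G j‖ ^ 2 := by gcongr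
    _ ≤ _ := mul_le_mul_of_nonneg_left h6 ((Finset.sum_nonneg hv).trans hvT)

end Duality

/-! ### Fourier coefficients of a set -/

/-- The Fourier coefficient of the indicator of `E ⊆ (0, 1]`. -/
noncomputable def setCoeff (E : Set ℝ) (n : ℤ) : ℂ := ∫ α in E, addChar (n * α)

theorem norm_setCoeff_le {E : Set ℝ} (hE : volume E ≠ ⊤) (n : ℤ) :
    ‖setCoeff E n‖ ≤ volume.real E := by
  have := norm_setIntegral_le_of_norm_le_const (μ := volume) (s := E) (C := 1)
    (f := fun α => addChar (n * α)) (lt_top_iff_ne_top.2 hE) (fun x _ => (norm_addChar _).le)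
  simpa [setCoeff] using this

/-- Bessel's inequality for the indicator of a set. -/
theorem sum_norm_sq_setCoeff_le {E : Set ℝ} (hE1 : E ⊆ Set.Ioc 0 1)
    (t : Finset ℤ) : ∑ n ∈ t, ‖setCoeff E n‖ ^ 2 ≤ volume.real E := by
  set S := ∑ n ∈ t, ‖setCoeff E n‖ ^ 2 with hS
  -- Up to normalisation of signs, the orthogonal projection of the indicator of `E` to the
  -- frequencies in `t`; both `∫_E P` and `∫ |P|²` equal `S`.
  set P : ℝ → ℂ := expSum t (fun n => (starRingEnd ℂ) (setCoeff E n)) id with hP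
  have hPc : Continuous P := continuous_expSum _ _ _
  have hint : ∀ {f : ℝ → ℂ}, Continuous f → ∀ A ⊆ Set.Ioc (0 : ℝ) 1, IntegrableOn f A := by
    intro f hf A hA
    exact (hf.integrableOn_Icc.mono_set Set.Ioc_subset_Icc_self).mono_set hA
  have h1 : ∫ α in E, P α = (S : ℂ) := by
    simp only [hP, expSum, id]
    rw [integral_finsetSum]
    · rw [hS]
      push_cast
      refine Finset.sum_congr rfl fun n _ => ?_
      rw [integral_const_mul, ← Complex.conj_mul']
      rfl
    · exact fun n _ => hint (continuous_const.mul (continuous_addChar.comp (by fun_prop))) E hE1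
  have h2 : ∫ α in Set.Ioc (0 : ℝ) 1, P α * (starRingEnd ℂ) (P α) = (S : ℂ) := by
    have e1 : ∀ α, P α * (starRingEnd ℂ) (P α) = ∑ n ∈ t, ∑ m ∈ t,
        (starRingEnd ℂ) (setCoeff E n) * setCoeff E m * addChar ((n - m : ℤ) * α) := by
      intro α
      simp only [hP, expSum, id, map_sum, Finset.sum_mul_sum]
      refine Finset.sum_congr rfl fun n _ => Finset.sum_congr rfl fun m _ => ?_
      have : addChar ((n - m : ℤ) * α) = addChar (n * α) * (starRingEnd ℂ) (addChar (m * α)) := by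
        rw [conj_addChar, ← addChar_add]
        push_cast
        ring_nf
      rw [this]
      simp
      ring
    simp_rw [e1]
    rw [← intervalIntegral.integral_of_le zero_le_one,
      intervalIntegral.integral_finsetSum]
    · rw [hS, Complex.ofReal_sum]
      refine Finset.sum_congr rfl fun n hn => ?_
      rw [intervalIntegral.integral_finsetSum]
      · simp_rw [intervalIntegral.integral_const_mul, integral_addChar_int_mul, sub_eq_zero]
        simp [hn, Complex.conj_mul']
      · intro m _
        exact (continuous_const.mul (continuous_addChar.comp
          (by fun_prop))).intervalIntegrable _ _
    · intro n _
      refine Continuous.intervalIntegrable ?_ _ _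
      exact continuous_finsetSum _ fun m _ => continuous_const.mul
        (continuous_addChar.comp (by fun_prop))
  have h3 : ∫ α in E, (P α).re = S := by
    have := congrArg Complex.re h1
    rw [Complex.ofReal_re] at this
    rw [← this]
    exact integral_re (𝕜 := ℂ) (hint hPc E hE1)
  have h4 : ∫ α in Set.Ioc (0 : ℝ) 1, ‖P α‖ ^ 2 = S := by
    have e : ∀ α, P α * (starRingEnd ℂ) (P α) = ((‖P α‖ ^ 2 : ℝ) : ℂ) := by
      intro α
      rw [Complex.mul_conj']
      push_cast
      rfl
    simp_rw [e] at h2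
    have h2' := congrArg Complex.re h2
    rw [integral_complex_ofReal] at h2'
    simpa using h2'
  have h5 : ∫ α in E, ‖P α‖ ^ 2 ≤ S := by
    rw [← h4]
    refine setIntegral_mono_set ?_ (Filter.Eventually.of_forall fun α => by positivity)
      hE1.eventuallyLE
    exact ((hPc.norm.pow 2).integrableOn_Icc).mono_set Set.Ioc_subset_Icc_self
  have hEfin : volume E ≠ ⊤ :=
    ne_top_of_le_ne_top (by simp) (measure_mono hE1)
  -- Pointwise `2 Re P - |P|² ≤ 1`. Integrated over `E` this gives `2S - S ≤ |E|`.
  have h6 : ∫ α in E, (2 * (P α).re - ‖P α‖ ^ 2) ≤ ∫ α in E, (1 : ℝ) := by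
    refine setIntegral_mono ?_ ?_ ?_
    · have : Continuous fun α => 2 * (P α).re - ‖P α‖ ^ 2 := by fun_prop
      exact (this.integrableOn_Icc.mono_set Set.Ioc_subset_Icc_self).mono_set hE1
    · exact integrableOn_const hEfin
    · intro α
      have := Complex.abs_re_le_norm (P α)
      have := le_abs_self (P α).re
      simp only
      nlinarith [sq_nonneg (‖P α‖ - 1)]
  rw [integral_sub, integral_const_mul, h3] at h6
  · simp at h6
    linarith
  · have : Continuous fun α => 2 * (P α).re := by fun_prop
    exact (this.integrableOn_Icc.mono_set Set.Ioc_subset_Icc_self).mono_set hE1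
  · exact (((hPc.norm.pow 2).integrableOn_Icc).mono_set Set.Ioc_subset_Icc_self).mono_set hE1

/-! ### A majorant for the major arcs -/

/-- The length of the Fejér kernel attached to the denominator `q`. -/
def arcLength (N R q : ℕ) : ℕ := q * N / (6 * R) + 1

/-- A nonnegative trigonometric polynomial, bounded below on the major arcs
`|θ - a / q| ≤ R / (q N)`, `q ≤ R`. -/
noncomputable def arcMajorant (N R : ℕ) (θ : ℝ) : ℝ :=
  ∑ q ∈ Finset.Icc 1 R, ∑ a ∈ Finset.range q,
    ((1 : ℝ) / (arcLength N R q) ^ 2) *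
      ‖∑ l ∈ Finset.range (arcLength N R q), addChar (l * (θ - a / q))‖ ^ 2

theorem continuous_arcMajorant (N R : ℕ) : Continuous (arcMajorant N R) := by
  unfold arcMajorant
  refine continuous_finsetSum _ fun q _ => continuous_finsetSum _ fun a _ =>
    continuous_const.mul (Continuous.pow (Continuous.norm ?_) 2)
  exact continuous_finsetSum _ fun l _ => continuous_addChar.comp (by fun_prop)

theorem arcMajorant_nonneg (N R : ℕ) (θ : ℝ) : 0 ≤ arcMajorant N R θ :=
  Finset.sum_nonneg fun _ _ => Finset.sum_nonneg fun _ _ => by positivity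

theorem exists_arcMajorant_le (N R : ℕ) : ∃ M, ∀ θ, |arcMajorant N R θ| ≤ M := by
  refine ⟨∑ q ∈ Finset.Icc 1 R, ∑ a ∈ Finset.range q,
    ((1 : ℝ) / (arcLength N R q) ^ 2) * (arcLength N R q : ℝ) ^ 2, fun θ => ?_⟩
  rw [abs_of_nonneg (arcMajorant_nonneg _ _ _)]
  refine Finset.sum_le_sum fun q _ => Finset.sum_le_sum fun a _ => ?_
  gcongr
  simpa using norm_sum_addChar_le_card (Finset.range (arcLength N R q))
    (fun l : ℕ => (l : ℝ) * (θ - a / q))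

theorem half_le_re_addChar {x : ℝ} (hx : |x| ≤ 1 / 6) : 1 / 2 ≤ (addChar x).re := by
  rw [addChar_eq, Complex.exp_ofReal_mul_I_re, ← Real.cos_abs, ← Real.cos_pi_div_three]
  refine Real.cos_le_cos_of_nonneg_of_le_pi (abs_nonneg _) (by linarith [Real.pi_pos]) ?_
  rw [abs_mul, abs_of_pos Real.two_pi_pos]
  nlinarith [Real.pi_pos]

/-- On the arc every `l` below the kernel length has `|l (θ - a/q)| ≤ 1/6`, so each summand has real
part at least `1/2` and the Fejér sum is at least half its length. The other terms of the majorant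
are nonnegative, and no coprimality of `a` and `q` is needed. -/
theorem one_fourth_le_arcMajorant {N R q : ℕ} (hq : 1 ≤ q) (hqR : q ≤ R) {a : ℤ}
    {θ : ℝ} (h : |θ - a / q| * (q * N) ≤ R) : 1 / 4 ≤ arcMajorant N R θ := by
  have hR : 0 < R := by omega
  set L := arcLength N R q with hL
  have hL0 : (0 : ℝ) < L := by simp [hL, arcLength]; positivity
  have hqz : (q : ℤ) ≠ 0 := by omega
  -- The majorant only contains `0 ≤ a < q`. Replacing `a` by its residue moves each phase by an
  -- integer.
  set r : ℕ := (a % q).toNat with hr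
  have hr0 : (r : ℤ) = a % q := Int.toNat_of_nonneg (Int.emod_nonneg _ hqz)
  have hrq : r < q := by
    have := Int.emod_lt_of_pos a (show (0 : ℤ) < q by omega)
    omega
  have hqpos : (0 : ℝ) < q := by exact_mod_cast hq
  have hadd : (a : ℝ) / q = r / q + ((a / q : ℤ) : ℝ) := by
    have h1 : (a : ℝ) = r + q * ((a / q : ℤ) : ℝ) := by
      have := Int.emod_add_mul_ediv a q
      rw [← hr0] at this
      exact_mod_cast this.symm
    rw [h1]
    field_simp
  have hsum : ∑ l ∈ Finset.range L, addChar (l * (θ - r / q)) =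
      ∑ l ∈ Finset.range L, addChar (l * (θ - a / q)) := by
    refine Finset.sum_congr rfl fun l _ => ?_
    have : (l : ℝ) * (θ - r / q) = l * (θ - a / q) + ((l * (a / q) : ℤ) : ℝ) := by
      rw [hadd]
      push_cast
      ring
    rw [this, addChar_add_intCast]
  have hlow : (L : ℝ) / 2 ≤ ‖∑ l ∈ Finset.range L, addChar (l * (θ - a / q))‖ := by
    refine le_trans ?_ (Complex.re_le_norm _)
    rw [Complex.re_sum]
    have : ∀ l ∈ Finset.range L, (1 / 2 : ℝ) ≤ (addChar (l * (θ - a / q))).re := by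
      intro l hl
      refine half_le_re_addChar ?_
      have hl' : l ≤ q * N / (6 * R) := by
        have := Finset.mem_range.1 hl
        simp only [hL, arcLength] at this
        omega
      have hl2 : l * (6 * R) ≤ q * N := (Nat.le_div_iff_mul_le (by omega)).1 hl'
      have hl3 : (l : ℝ) * (6 * R) ≤ q * N := by exact_mod_cast hl2
      rw [abs_mul, abs_of_nonneg (Nat.cast_nonneg l)]
      have hRpos : (0 : ℝ) < R := by exact_mod_cast hR
      have h4 : (l * |θ - a / q|) * (6 * R) ≤ R := by
        calc (l * |θ - a / q|) * (6 * R) = |θ - a / q| * (l * (6 * R)) := by ring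
          _ ≤ |θ - a / q| * (q * N) := by gcongr
          _ ≤ R := h
      nlinarith
    have := Finset.sum_le_sum this
    simp only [Finset.sum_const, Finset.card_range, nsmul_eq_mul] at this
    linarith
  calc (1 / 4 : ℝ) = (1 / (L : ℝ) ^ 2) * ((L : ℝ) / 2) ^ 2 := by field_simp; norm_num
    _ ≤ (1 / (L : ℝ) ^ 2) * ‖∑ l ∈ Finset.range L, addChar (l * (θ - r / q))‖ ^ 2 := by
        rw [hsum]
        gcongr
    _ ≤ ∑ a ∈ Finset.range q, ((1 : ℝ) / L ^ 2) *
          ‖∑ l ∈ Finset.range L, addChar (l * (θ - a / q))‖ ^ 2 :=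
        Finset.single_le_sum (f := fun a : ℕ => ((1 : ℝ) / L ^ 2) *
          ‖∑ l ∈ Finset.range L, addChar (l * (θ - a / q))‖ ^ 2)
          (fun _ _ => by positivity) (Finset.mem_range.2 hrq)
    _ ≤ _ := Finset.single_le_sum (f := fun q : ℕ => ∑ a ∈ Finset.range q,
          ((1 : ℝ) / (arcLength N R q) ^ 2) *
          ‖∑ l ∈ Finset.range (arcLength N R q), addChar (l * (θ - a / q))‖ ^ 2)
          (fun _ _ => Finset.sum_nonneg fun _ _ => by positivity)
          (Finset.mem_Icc.2 ⟨hq, hqR⟩)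

/-- Orthogonality of additive characters modulo `q`. -/
theorem sum_range_addChar_mul_div {q : ℕ} (hq : 0 < q) (n : ℤ) :
    ∑ a ∈ Finset.range q, addChar (n * (a / q)) = if (q : ℤ) ∣ n then (q : ℂ) else 0 := by
  have hqr : (q : ℝ) ≠ 0 := by positivity
  split_ifs with h
  · obtain ⟨m, rfl⟩ := h
    have : ∀ a : ℕ, addChar (((q * m : ℤ) : ℝ) * (a / q)) = 1 := by
      intro a
      rw [← addChar_intCast (m * a)]
      congr 1
      push_cast
      field_simp
    simp_rw [this]
    simp
  · have h1 : ∀ a : ℕ, addChar (n * (a / q)) = addChar (n / q) ^ a := by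
      intro a
      rw [← addChar_nsmul]
      congr 1
      ring
    simp_rw [h1]
    have h2 : addChar ((n : ℝ) / q) ≠ 1 := by
      intro h3
      have h4 : ‖addChar ((n : ℝ) / q) - 1‖ = 0 := by rw [h3]; simp
      have h5 := four_mul_abs_sub_round_le ((n : ℝ) / q)
      rw [h4] at h5
      have h6 : (n : ℝ) / q - round ((n : ℝ) / q) = 0 := by
        have := abs_nonneg ((n : ℝ) / q - round ((n : ℝ) / q))
        exact abs_eq_zero.1 (by linarith)
      apply h
      refine ⟨round ((n : ℝ) / q), ?_⟩
      have h7 : (n : ℝ) = q * round ((n : ℝ) / q) := by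
        rw [sub_eq_zero, div_eq_iff hqr] at h6
        linarith
      exact_mod_cast h7
    rw [geom_sum_eq h2, ← addChar_nsmul]
    have : (q : ℝ) * (n / q) = n := by field_simp
    rw [this, addChar_intCast]
    simp

theorem norm_sq_sum_range_addChar (L : ℕ) (θ : ℝ) :
    ((‖∑ l ∈ Finset.range L, addChar (l * θ)‖ ^ 2 : ℝ) : ℂ) =
      ∑ l ∈ Finset.range L, ∑ m ∈ Finset.range L, addChar (((l : ℤ) - m : ℤ) * θ) := by
  push_cast
  rw [← Complex.mul_conj', map_sum, Finset.sum_mul_sum]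
  refine Finset.sum_congr rfl fun l _ => Finset.sum_congr rfl fun m _ => ?_
  rw [conj_addChar, ← addChar_add]
  ring_nf

/-- Summing over all residues, not only the reduced ones, leaves exactly the pairs with `q ∣ l - m`.
This is what turns major arcs into divisor counts. -/
theorem sum_fejer_eq {q : ℕ} (hq : 0 < q) (L : ℕ) (θ : ℝ) :
    ((∑ a ∈ Finset.range q, ‖∑ l ∈ Finset.range L, addChar (l * (θ - a / q))‖ ^ 2 : ℝ) : ℂ) =
      q * ∑ l ∈ Finset.range L, ∑ m ∈ Finset.range L,
        if (q : ℤ) ∣ (l : ℤ) - m then addChar (((l : ℤ) - m : ℤ) * θ) else 0 := by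
  rw [Complex.ofReal_sum]
  simp_rw [norm_sq_sum_range_addChar]
  rw [Finset.sum_comm, Finset.mul_sum]
  refine Finset.sum_congr rfl fun l _ => ?_
  rw [Finset.sum_comm, Finset.mul_sum]
  refine Finset.sum_congr rfl fun m _ => ?_
  have h1 : ∀ a : ℕ, addChar ((((l : ℤ) - m : ℤ) : ℝ) * (θ - a / q)) =
      addChar ((((l : ℤ) - m : ℤ) : ℝ) * θ) *
        addChar (((-((l : ℤ) - m) : ℤ) : ℝ) * (a / q)) := by
    intro a
    rw [← addChar_add]
    congr 1
    push_cast
    ring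
  simp_rw [h1]
  rw [← Finset.mul_sum, sum_range_addChar_mul_div hq]
  simp only [dvd_neg]
  split_ifs
  · ring
  · simp

theorem integral_integral_addChar_eq_setCoeff (E : Set ℝ) (n : ℤ) :
    ∫ α in E, ∫ β in E, addChar (n * (α - β)) = (‖setCoeff E n‖ ^ 2 : ℝ) := by
  have := integral_integral_addChar_sub (ν := volume.restrict E) (fun _ => 1) n
  simpa [setCoeff] using this

theorem integral_integral_sum_fejer {E : Set ℝ} (hE : volume E ≠ ⊤) {q : ℕ} (hq : 0 < q)
    (L : ℕ) :
    ∫ α in E, ∫ β in E, ∑ a ∈ Finset.range q,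
        ‖∑ l ∈ Finset.range L, addChar (l * ((α - β) - a / q))‖ ^ 2 =
      q * ∑ l ∈ Finset.range L, ∑ m ∈ Finset.range L,
        if (q : ℤ) ∣ (l : ℤ) - m then ‖setCoeff E (l - m)‖ ^ 2 else 0 := by
  have : IsFiniteMeasure (volume.restrict E) := ⟨by simpa using lt_top_iff_ne_top.2 hE⟩
  apply Complex.ofReal_injective
  rw [← integral_complex_ofReal]
  simp_rw [← integral_complex_ofReal, sum_fejer_eq hq]
  have hint : ∀ (n : ℤ) (α : ℝ),
      Integrable (fun β => addChar (n * (α - β))) (volume.restrict E) := by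
    intro n α
    have := integrable_mul_addChar (ν := volume.restrict E) (g := fun _ => 1)
      (h := fun β => n * (α - β)) measurable_const (by simp) (by fun_prop)
    simpa using this
  have hint2 : ∀ (n : ℤ), Integrable (fun α => ∫ β in E, addChar (n * (α - β)))
      (volume.restrict E) := by
    intro n
    have h : Integrable (fun z : ℝ × ℝ => addChar (n * (z.1 - z.2)))
        ((volume.restrict E).prod (volume.restrict E)) :=
      Integrable.of_bound (continuous_addChar.comp (by fun_prop)).aestronglyMeasurable 1
        (Filter.Eventually.of_forall fun _ => (norm_addChar _).le)
    exact h.integral_prod_left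
  have key : ∀ α, ∫ β in E, (q : ℂ) * ∑ l ∈ Finset.range L, ∑ m ∈ Finset.range L,
      (if (q : ℤ) ∣ (l : ℤ) - m then addChar (((l : ℤ) - m : ℤ) * (α - β)) else 0) =
      (q : ℂ) * ∑ l ∈ Finset.range L, ∑ m ∈ Finset.range L,
      if (q : ℤ) ∣ (l : ℤ) - m then ∫ β in E, addChar (((l : ℤ) - m : ℤ) * (α - β)) else 0 := by
    intro α
    rw [integral_const_mul, integral_finsetSum]
    · congr 1
      refine Finset.sum_congr rfl fun l _ => ?_
      rw [integral_finsetSum]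
      · refine Finset.sum_congr rfl fun m _ => ?_
        split_ifs
        · rfl
        · simp
      · intro m _
        split_ifs
        · exact hint _ _
        · simp
    · intro l _
      refine integrable_finsetSum _ fun m _ => ?_
      split_ifs
      · exact hint _ _
      · simp
  simp_rw [key]
  rw [integral_const_mul, integral_finsetSum]
  · rw [Complex.ofReal_mul, Complex.ofReal_natCast, Complex.ofReal_sum]
    congr 1
    refine Finset.sum_congr rfl fun l _ => ?_
    rw [integral_finsetSum, Complex.ofReal_sum]
    · refine Finset.sum_congr rfl fun m _ => ?_
      split_ifs
      · exact integral_integral_addChar_eq_setCoeff E _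
      · simp
    · intro m _
      split_ifs
      · exact hint2 _
      · simp
  · intro l _
    refine integrable_finsetSum _ fun m _ => ?_
    split_ifs
    · exact hint2 _
    · simp

/-- For fixed `m` the differences `l - m` are distinct, so each integer `n` is taken at most `L`
times. -/
theorem sum_dvd_sub_le {G : ℤ → ℝ} (hG : ∀ n, 0 ≤ G n) (q : ℕ) {L N : ℕ} (hL : L ≤ N + 1) :
    ∑ l ∈ Finset.range L, ∑ m ∈ Finset.range L,
        (if (q : ℤ) ∣ (l : ℤ) - m then G (l - m) else 0) ≤
      L * ∑ n ∈ Finset.Icc (-(N : ℤ)) N, if (q : ℤ) ∣ n then G n else 0 := by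
  rw [Finset.sum_comm]
  have : ∀ m ∈ Finset.range L, ∑ l ∈ Finset.range L,
      (if (q : ℤ) ∣ (l : ℤ) - m then G (l - m) else 0) ≤
      ∑ n ∈ Finset.Icc (-(N : ℤ)) N, if (q : ℤ) ∣ n then G n else 0 := by
    intro m hm
    have hm' := Finset.mem_range.1 hm
    have hinj : Set.InjOn (fun l : ℕ => (l : ℤ) - m) (Finset.range L) := by
      intro a _ b _ h
      simp only at h
      omega
    rw [← Finset.sum_image (s := Finset.range L) (g := fun l : ℕ => (l : ℤ) - m)
      (f := fun n => if (q : ℤ) ∣ n then G n else 0) hinj]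
    refine Finset.sum_le_sum_of_subset_of_nonneg ?_ ?_
    · intro n hn
      obtain ⟨l, hl, rfl⟩ := Finset.mem_image.1 hn
      have hl' := Finset.mem_range.1 hl
      rw [Finset.mem_Icc]
      omega
    · intro n _ _
      split_ifs
      · exact hG _
      · rfl
  refine (Finset.sum_le_sum this).trans ?_
  simp

/-- For a kernel of length `L` the weight is `L⁻² · q · L = q / L`, and the choice of `L` bounds it
by `6R/N` uniformly in `q`. Summation over `q ≤ R` then counts the divisors of each frequency. -/
theorem integral_integral_arcMajorant_le_sum {E : Set ℝ} (hE : volume E ≠ ⊤) {N R : ℕ}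
    (hN : 0 < N) (hR : 0 < R) :
    ∫ α in E, ∫ β in E, arcMajorant N R (α - β) ≤
      6 * R / N * ∑ n ∈ Finset.Icc (-(N : ℤ)) N,
        (divCount R n.natAbs : ℝ) * ‖setCoeff E n‖ ^ 2 := by
  have : IsFiniteMeasure (volume.restrict E) := ⟨by simpa using lt_top_iff_ne_top.2 hE⟩
  have hbd : ∀ q ∈ Finset.Icc 1 R, ∃ M, ∀ θ : ℝ, |∑ a ∈ Finset.range q,
      ((1 : ℝ) / (arcLength N R q) ^ 2) *
      ‖∑ l ∈ Finset.range (arcLength N R q), addChar (l * (θ - a / q))‖ ^ 2| ≤ M := by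
    intro q hq
    obtain ⟨M, hM⟩ := exists_arcMajorant_le N R
    refine ⟨M, fun θ => le_trans ?_ (hM θ)⟩
    rw [abs_of_nonneg (Finset.sum_nonneg fun _ _ => by positivity),
      abs_of_nonneg (arcMajorant_nonneg _ _ _)]
    exact Finset.single_le_sum (f := fun q : ℕ => ∑ a ∈ Finset.range q,
          ((1 : ℝ) / (arcLength N R q) ^ 2) *
          ‖∑ l ∈ Finset.range (arcLength N R q), addChar (l * (θ - a / q))‖ ^ 2)
          (fun _ _ => Finset.sum_nonneg fun _ _ => by positivity) hq
  have hcont : ∀ q, Continuous fun θ : ℝ => ∑ a ∈ Finset.range q,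
      ((1 : ℝ) / (arcLength N R q) ^ 2) *
      ‖∑ l ∈ Finset.range (arcLength N R q), addChar (l * (θ - a / q))‖ ^ 2 := by
    intro q
    refine continuous_finsetSum _ fun a _ =>
      continuous_const.mul (Continuous.pow (Continuous.norm ?_) 2)
    exact continuous_finsetSum _ fun l _ => continuous_addChar.comp (by fun_prop)
  unfold arcMajorant
  have e1 : ∀ α : ℝ, ∫ β in E, ∑ q ∈ Finset.Icc 1 R, ∑ a ∈ Finset.range q,
      ((1 : ℝ) / (arcLength N R q) ^ 2) *
      ‖∑ l ∈ Finset.range (arcLength N R q), addChar (l * (α - β - a / q))‖ ^ 2 =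
      ∑ q ∈ Finset.Icc 1 R, ∫ β in E, ∑ a ∈ Finset.range q,
      ((1 : ℝ) / (arcLength N R q) ^ 2) *
      ‖∑ l ∈ Finset.range (arcLength N R q), addChar (l * (α - β - a / q))‖ ^ 2 := by
    intro α
    rw [integral_finsetSum]
    intro q hq
    obtain ⟨M, hM⟩ := hbd q hq
    exact integrable_of_continuous_of_bound (hcont q) hM α
  simp_rw [e1]
  rw [integral_finsetSum]
  swap
  · intro q hq
    obtain ⟨M, hM⟩ := hbd q hq
    exact integrable_integral_of_continuous_of_bound (hcont q) hM
  have e2 : ∀ q ∈ Finset.Icc 1 R, ∫ α in E, ∫ β in E, ∑ a ∈ Finset.range q,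
      ((1 : ℝ) / (arcLength N R q) ^ 2) *
      ‖∑ l ∈ Finset.range (arcLength N R q), addChar (l * (α - β - a / q))‖ ^ 2 ≤
      6 * R / N * ∑ n ∈ Finset.Icc (-(N : ℤ)) N,
        if (q : ℤ) ∣ n then ‖setCoeff E n‖ ^ 2 else 0 := by
    intro q hq
    obtain ⟨hq1, hqR⟩ := Finset.mem_Icc.1 hq
    simp_rw [← Finset.mul_sum, integral_const_mul]
    rw [integral_integral_sum_fejer hE hq1]
    set L := arcLength N R q with hL
    have hL0 : (0 : ℝ) < L := by simp [hL, arcLength]; positivity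
    have hLN : L ≤ N + 1 := by
      simp only [hL, arcLength]
      have : q * N / (6 * R) ≤ N := by
        apply Nat.div_le_of_le_mul
        nlinarith
      omega
    have hqL : (q : ℝ) / L ≤ 6 * R / N := by
      rw [div_le_div_iff₀ hL0 (by positivity)]
      have h2 : q * N ≤ 6 * R * L := (Nat.lt_mul_div_succ _ (by omega)).le
      exact_mod_cast h2
    set S := ∑ n ∈ Finset.Icc (-(N : ℤ)) N, if (q : ℤ) ∣ n then ‖setCoeff E n‖ ^ 2 else 0
      with hS
    have hS0 : 0 ≤ S := Finset.sum_nonneg fun n _ => by split_ifs <;> positivity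
    calc _ ≤ 1 / (L : ℝ) ^ 2 * (q * (L * S)) := by
          gcongr
          exact sum_dvd_sub_le (G := fun n => ‖setCoeff E n‖ ^ 2) (fun _ => by positivity) q hLN
      _ = q / L * S := by field_simp
      _ ≤ _ := by gcongr
  refine (Finset.sum_le_sum e2).trans (le_of_eq ?_)
  rw [← Finset.mul_sum, Finset.sum_comm]
  congr 1
  refine Finset.sum_congr rfl fun n _ => ?_
  rw [← Finset.sum_filter, Finset.sum_const, nsmul_eq_mul, divCount]
  congr 3
  ext q
  simp [Int.natCast_dvd]

/-- Truncation of the divisor function at `D`, with the excess charged to a high moment. -/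
theorem le_add_pow_div_pow {d D : ℝ} (hd : 0 ≤ d) (hD : 0 < D) (k : ℕ) :
    d ≤ D + d ^ (k + 1) / D ^ k := by
  rcases le_total d D with h | h
  · have : 0 ≤ d ^ (k + 1) / D ^ k := by positivity
    linarith
  · have : d ≤ d ^ (k + 1) / D ^ k := by
      rw [le_div_iff₀ (by positivity), pow_succ, mul_comm]
      gcongr
    linarith

/-- The mass which the major arc majorant gives to a difference set. -/
theorem exists_integral_integral_arcMajorant_le (k : ℕ) : ∃ C : ℝ, 0 ≤ C ∧
    ∀ (N R : ℕ) (D : ℝ) (E : Set ℝ), 0 < N → 0 < R → R ^ k ≤ N → 0 < D →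
      E ⊆ Set.Ioc 0 1 →
      ∫ α in E, ∫ β in E, arcMajorant N R (α - β) ≤
        6 * R / N * (D * volume.real E + C * R * N / D ^ k * volume.real E ^ 2) := by
  obtain ⟨C, hC, hmom⟩ := exists_sum_divCount_pow_le (k + 1) 1 one_pos
  refine ⟨2 * C + 1, by positivity, fun N R D E hN hR hRN hD hE1 => ?_⟩
  have hEfin : volume E ≠ ⊤ := ne_top_of_le_ne_top (by simp) (measure_mono hE1)
  refine (integral_integral_arcMajorant_le_sum hEfin hN hR).trans ?_
  gcongr
  -- The part below `D` will be summed by Bessel's inequality and is linear in `|E|`. In the tail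
  -- the coefficients are bounded trivially by `|E|`, leaving a moment of the divisor function.
  have h1 : ∀ n ∈ Finset.Icc (-(N : ℤ)) N, (divCount R n.natAbs : ℝ) * ‖setCoeff E n‖ ^ 2 ≤
      D * ‖setCoeff E n‖ ^ 2 +
        (divCount R n.natAbs : ℝ) ^ (k + 1) / D ^ k * volume.real E ^ 2 := by
    intro n _
    have e1 := le_add_pow_div_pow (Nat.cast_nonneg (α := ℝ) (divCount R n.natAbs)) hD k
    have e2 := norm_setCoeff_le hEfin n
    calc (divCount R n.natAbs : ℝ) * ‖setCoeff E n‖ ^ 2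
        ≤ (D + (divCount R n.natAbs : ℝ) ^ (k + 1) / D ^ k) * ‖setCoeff E n‖ ^ 2 := by gcongr
      _ = D * ‖setCoeff E n‖ ^ 2 +
          (divCount R n.natAbs : ℝ) ^ (k + 1) / D ^ k * ‖setCoeff E n‖ ^ 2 := by ring
      _ ≤ _ := by gcongr
  refine (Finset.sum_le_sum h1).trans ?_
  rw [Finset.sum_add_distrib, ← Finset.mul_sum, ← Finset.sum_mul, ← Finset.sum_div]
  have h2 : ∑ n ∈ Finset.Icc (-(N : ℤ)) N, (divCount R n.natAbs : ℝ) ^ (k + 1) ≤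
      (2 * C + 1) * R * N := by
    have hsub : Finset.Icc (-(N : ℤ)) N ⊆ insert 0
        ((Finset.Icc 1 N).image (fun n : ℕ => (n : ℤ)) ∪
          (Finset.Icc 1 N).image (fun n : ℕ => -(n : ℤ))) := by
      intro n hn
      rw [Finset.mem_Icc] at hn
      simp only [Finset.mem_insert, Finset.mem_union, Finset.mem_image, Finset.mem_Icc]
      rcases lt_trichotomy n 0 with h | h | h
      · exact Or.inr (Or.inr ⟨n.natAbs, by omega, by omega⟩)
      · exact Or.inl h
      · exact Or.inr (Or.inl ⟨n.natAbs, by omega, by omega⟩)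
    have hm := hmom R N hR
    rw [Real.rpow_one] at hm
    -- Every `q ≤ R` divides `0`, so the zero frequency has weight `R^{k+1}`; the hypothesis `R^k ≤
    -- N` pays for it.
    have hR0 : (divCount R 0 : ℝ) ^ (k + 1) ≤ R * N := by
      calc (divCount R 0 : ℝ) ^ (k + 1) ≤ (R : ℝ) ^ (k + 1) := by
            gcongr
            exact_mod_cast divCount_le R 0
        _ = (R : ℝ) * ((R ^ k : ℕ) : ℝ) := by push_cast; ring
        _ ≤ R * N := by gcongr
    calc ∑ n ∈ Finset.Icc (-(N : ℤ)) N, (divCount R n.natAbs : ℝ) ^ (k + 1)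
        ≤ _ := Finset.sum_le_sum_of_subset_of_nonneg hsub fun _ _ _ => by positivity
      _ ≤ (divCount R 0 : ℝ) ^ (k + 1) + ((∑ n ∈ Finset.Icc 1 N, (divCount R n : ℝ) ^ (k + 1)) +
          ∑ n ∈ Finset.Icc 1 N, (divCount R n : ℝ) ^ (k + 1)) := by
          rw [Finset.sum_insert (by simp)]
          simp only [Int.natAbs_zero]
          gcongr
          refine (Finset.sum_union_inter (f := fun n : ℤ => (divCount R n.natAbs : ℝ) ^ (k + 1))
            ▸ le_add_of_nonneg_right (Finset.sum_nonneg fun _ _ => by positivity)).trans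
            (le_of_eq ?_)
          rw [Finset.sum_image (by intro a _ b _ h; simpa using h),
            Finset.sum_image (by intro a _ b _ h; simpa using h)]
          simp
      _ ≤ R * N + (C * R * N + C * R * N) := by gcongr
      _ = _ := by ring
  have h3 := sum_norm_sq_setCoeff_le hE1 (Finset.Icc (-(N : ℤ)) N)
  gcongr

/-! ### The level set estimate and the removal of `ε` -/

theorem exists_two_pow_le_lt {x : ℝ} (hx : 1 ≤ x) : ∃ i : ℕ, (2 : ℝ) ^ i ≤ x ∧ x < 2 ^ (i + 1) := by
  have hf : ⌊x⌋₊ ≠ 0 := (Nat.floor_pos.2 hx).ne'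
  refine ⟨Nat.log 2 ⌊x⌋₊, ?_, ?_⟩
  · have h1 := Nat.pow_log_le_self 2 hf
    have h2 : ((2 ^ Nat.log 2 ⌊x⌋₊ : ℕ) : ℝ) ≤ x := le_trans (by exact_mod_cast h1)
      (Nat.floor_le (by linarith))
    exact_mod_cast h2
  · have h1 := Nat.lt_pow_succ_log_self (b := 2) (by norm_num) ⌊x⌋₊
    have h2 := (Nat.floor_lt (by linarith)).1 h1
    exact_mod_cast h2

theorem geom_sum_le {r : ℝ} (hr : 1 < r) (n : ℕ) :
    ∑ i ∈ Finset.range (n + 1), r ^ i ≤ r / (r - 1) * r ^ n := by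
  rw [geom_sum_eq hr.ne', div_mul_eq_mul_div, ← pow_succ']
  gcongr
  linarith

set_option maxHeartbeats 1000000 in
/-- If the exponential sum of the majorant is concentrated on major arcs, the majorised
exponential sum is large only on a small set. -/
theorem exists_level_set_le {s C₀ κ : ℝ} (hs : 0 < s) (hs1 : s < 1) (hC₀ : 1 ≤ C₀) (hκ : 0 < κ) :
    ∃ (k : ℕ) (C : ℝ), 0 ≤ C ∧ ∀ (ι : Type) (t : Finset ι) (c : ι → ℂ) (ω v : ι → ℝ) (f : ι → ℤ)
      (N : ℕ) (T δ : ℝ) (E : Set ℝ), 0 < N → 0 < T → 0 < δ → δ ≤ 1 →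
      (∀ j ∈ t, 0 ≤ ω j) → (∀ j ∈ t, 0 ≤ v j) → (∀ j ∈ t, ‖c j‖ ^ 2 ≤ ω j * v j) →
      ∑ j ∈ t, v j ≤ T →
      (∀ θ, ‖expSum t (fun j => (ω j : ℂ)) f θ‖ ≤ T * (δ ^ 2 / 2) ∨ ∃ (q : ℕ) (a : ℤ), 1 ≤ q ∧
        ‖expSum t (fun j => (ω j : ℂ)) f θ‖ ≤ C₀ * T * (q * (1 + N * |θ - a / q|)) ^ (-s)) →
      (2 * (2 * C₀ / δ ^ 2) ^ (1 / s)) ^ k ≤ N →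
      MeasurableSet E → E ⊆ Set.Ioc 0 1 → (∀ α ∈ E, δ * T ≤ ‖expSum t c f α‖) →
      volume.real E ≤ C * δ ^ (-(2 / s) - κ) / N := by
  -- The moment is taken so high that `D^k`, with `D` about `δ^{-κ}`, exceeds `δ^{-6/s-2}`, the size
  -- of `X³ / δ²`.
  obtain ⟨k, hk⟩ := exists_nat_gt ((6 / s + 2) / κ)
  have hk0 : k ≠ 0 := by
    rintro rfl
    have : 0 < (6 / s + 2) / κ := by positivity
    simp at hk
    linarith
  have hkκ : 6 / s + 2 ≤ κ * k := by
    rw [div_lt_iff₀ hκ] at hk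
    linarith
  obtain ⟨C₁, hC₁, hΨ⟩ := exists_integral_integral_arcMajorant_le k
  set r : ℝ := 2 ^ (1 - s) with hr
  have hr1 : 1 < r := Real.one_lt_rpow (by norm_num) (by linarith)
  set A : ℝ := max 1 (384 * C₀ * C₁ * (2 * C₀) ^ (3 / s)) with hA
  have hA1 : 1 ≤ A := le_max_left _ _
  refine ⟨k, 4 * (48 * C₀ * (r / (r - 1)) * (2 * C₀) ^ ((1 - s) / s) * A), ?_, ?_⟩
  · have : 0 ≤ r / (r - 1) := div_nonneg (by linarith) (by linarith)
    positivity
  intro ι t c ω v f N T δ E hN hT hδ hδ1 hω hv hc hvT hK hkN hEm hE1 hF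
  have hrr : 0 ≤ r / (r - 1) := div_nonneg (by linarith) (by linarith)
  -- `X = Y^{1/s}` is the value of `q (1 + N|θ - a/q|)` at which the major arc bound has dropped to
  -- `T δ² / 2`. Arcs beyond `X` therefore belong to the negligible part.
  set Y := 2 * C₀ / δ ^ 2 with hY
  have hY1 : 1 ≤ Y := by
    rw [hY, le_div_iff₀ (by positivity)]
    nlinarith
  set X := Y ^ (1 / s) with hX
  have hX1 : 1 ≤ X := Real.one_le_rpow hY1 (by positivity)
  have hXs : X ^ s = Y := by
    rw [hX, ← Real.rpow_mul (by linarith), one_div_mul_cancel hs.ne', Real.rpow_one]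
  obtain ⟨I, hI1, hI2⟩ := exists_two_pow_le_lt hX1
  set m := volume.real E with hm
  have hm0 : 0 ≤ m := measureReal_nonneg
  have hEfin : volume E ≠ ⊤ := ne_top_of_le_ne_top (by simp) (measure_mono hE1)
  have : IsFiniteMeasure (volume.restrict E) := ⟨by simpa using lt_top_iff_ne_top.2 hEfin⟩
  set D := A * δ ^ (-κ) with hD
  have hD0 : 0 < D := by positivity
  set lam : ℕ → ℝ := fun i => 4 * C₀ * ((2 : ℝ) ^ i) ^ (-s) with hlam
  have hlam0 : ∀ i, 0 ≤ lam i := fun i => by simp only [hlam]; positivity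
  -- The factor `4` in `lam` compensates the lower bound `1/4` for the arc majorant, so the dyadic
  -- scale containing `θ` already dominates the kernel.
  set B : ℝ → ℝ := fun θ => T * (δ ^ 2 / 2 +
    ∑ i ∈ Finset.range (I + 1), lam i * arcMajorant N (2 ^ (i + 1)) θ) with hB
  have hBc : Continuous B := by
    refine continuous_const.mul (continuous_const.add ?_)
    exact continuous_finsetSum _ fun i _ => continuous_const.mul (continuous_arcMajorant _ _)
  choose M hM using fun i : ℕ => exists_arcMajorant_le N (2 ^ (i + 1))
  have hBM : ∀ θ, |B θ| ≤ T * (δ ^ 2 / 2 + ∑ i ∈ Finset.range (I + 1), lam i * M i) := by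
    intro θ
    have hnn : 0 ≤ ∑ i ∈ Finset.range (I + 1), lam i * arcMajorant N (2 ^ (i + 1)) θ :=
      Finset.sum_nonneg fun i _ => mul_nonneg (hlam0 i) (arcMajorant_nonneg _ _ _)
    rw [abs_of_nonneg (by simp only [hB]; positivity)]
    simp only [hB]
    gcongr with i hi
    exact (le_abs_self _).trans (hM i θ)
  have hKB : ∀ θ, ‖expSum t (fun j => (ω j : ℂ)) f θ‖ ≤ B θ := by
    intro θ
    have hnn : 0 ≤ ∑ i ∈ Finset.range (I + 1), lam i * arcMajorant N (2 ^ (i + 1)) θ :=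
      Finset.sum_nonneg fun i _ => mul_nonneg (hlam0 i) (arcMajorant_nonneg _ _ _)
    by_cases hsmall : ‖expSum t (fun j => (ω j : ℂ)) f θ‖ ≤ T * (δ ^ 2 / 2)
    · refine hsmall.trans ?_
      simp only [hB]
      gcongr
      linarith
    rcases hK θ with h | ⟨q, a, hq, h⟩
    · exact absurd h hsmall
    set ρ : ℝ := q * (1 + N * |θ - a / q|) with hρ
    have hq' : (1 : ℝ) ≤ q := by exact_mod_cast hq
    have hβ : 0 ≤ N * |θ - a / q| := by positivity
    have hqρ : (q : ℝ) ≤ ρ := by rw [hρ]; nlinarith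
    have hρ1 : 1 ≤ ρ := hq'.trans hqρ
    have hρ0 : 0 < ρ := by linarith
    have hρX : ρ < X := by
      by_contra hcon
      have h1 : Y ≤ ρ ^ s := by
        rw [← hXs]
        exact Real.rpow_le_rpow (by linarith) (not_lt.1 hcon) hs.le
      apply hsmall
      refine h.trans ?_
      have h2 : ρ ^ (-s) ≤ Y⁻¹ := by
        rw [Real.rpow_neg hρ0.le]
        exact inv_anti₀ (by linarith) h1
      calc C₀ * T * ρ ^ (-s) ≤ C₀ * T * Y⁻¹ := by gcongr
        _ = T * (δ ^ 2 / 2) := by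
            rw [hY]
            field_simp
    -- With `2^i ≤ ρ < 2^{i+1}` both `q ≤ R` and `|θ - a/q| q N ≤ R` hold for `R = 2^{i+1}`.
    obtain ⟨i, hi1, hi2⟩ := exists_two_pow_le_lt hρ1
    have hiI : i < I + 1 := by
      have : (2 : ℝ) ^ i < 2 ^ (I + 1) := by linarith
      exact (pow_lt_pow_iff_right₀ (by norm_num)).1 this
    have hqR : q ≤ 2 ^ (i + 1) := by
      have : (q : ℝ) ≤ ((2 ^ (i + 1) : ℕ) : ℝ) := by push_cast; linarith
      exact_mod_cast this
    have harc := one_fourth_le_arcMajorant (N := N) (θ := θ) (a := a) hq hqR (by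
      push_cast
      rw [hρ] at hi2
      nlinarith [abs_nonneg (θ - a / q)])
    have h3 : ρ ^ (-s) ≤ ((2 : ℝ) ^ i) ^ (-s) :=
      Real.rpow_le_rpow_of_nonpos (by positivity) hi1 (by linarith)
    have h4 : lam i * arcMajorant N (2 ^ (i + 1)) θ ≤
        ∑ i ∈ Finset.range (I + 1), lam i * arcMajorant N (2 ^ (i + 1)) θ :=
      Finset.single_le_sum (f := fun i => lam i * arcMajorant N (2 ^ (i + 1)) θ)
        (fun i _ => mul_nonneg (hlam0 i) (arcMajorant_nonneg _ _ _)) (Finset.mem_range.2 hiI)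
    have h5 : C₀ * ((2 : ℝ) ^ i) ^ (-s) ≤ lam i * arcMajorant N (2 ^ (i + 1)) θ := by
      have := mul_le_mul_of_nonneg_left harc (hlam0 i)
      simp only [hlam] at this ⊢
      linarith
    calc _ ≤ C₀ * T * ρ ^ (-s) := h
      _ ≤ C₀ * T * ((2 : ℝ) ^ i) ^ (-s) := by gcongr
      _ = T * (C₀ * ((2 : ℝ) ^ i) ^ (-s)) := by ring
      _ ≤ B θ := by
        simp only [hB]
        gcongr
        have : 0 ≤ δ ^ 2 / 2 := by positivity
        linarith
  have hdual := level_set_sq_le (ν := volume.restrict E) t f (l := δ * T) (by positivity) hω hv hc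
    hvT ((ae_restrict_iff' hEm).2 (Filter.Eventually.of_forall hF)) hBc hBM hKB
  rw [measureReal_restrict_apply_univ, ← hm] at hdual
  have hBint : ∫ α in E, ∫ β in E, B (α - β) = T * (δ ^ 2 / 2 * m ^ 2 +
      ∑ i ∈ Finset.range (I + 1), lam i *
        ∫ α in E, ∫ β in E, arcMajorant N (2 ^ (i + 1)) (α - β)) := by
    have hint1 : ∀ (i : ℕ) (α : ℝ), Integrable (fun β => lam i *
        arcMajorant N (2 ^ (i + 1)) (α - β)) (volume.restrict E) := fun i α =>
      (integrable_of_continuous_of_bound (continuous_arcMajorant _ _) (hM i) α).const_mul _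
    have hint2 : ∀ (i : ℕ), Integrable (fun α => lam i * ∫ β in E,
        arcMajorant N (2 ^ (i + 1)) (α - β)) (volume.restrict E) := fun i =>
      (integrable_integral_of_continuous_of_bound (continuous_arcMajorant _ _) (hM i)).const_mul _
    have e1 : ∀ α, ∫ β in E, B (α - β) = T * (δ ^ 2 / 2 * m +
        ∑ i ∈ Finset.range (I + 1), lam i * ∫ β in E, arcMajorant N (2 ^ (i + 1)) (α - β)) := by
      intro α
      simp only [hB]
      rw [integral_const_mul, integral_add (integrable_const _)
        (integrable_finsetSum _ fun i _ => hint1 i α), integral_finsetSum _ fun i _ => hint1 i α]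
      simp_rw [integral_const_mul]
      rw [integral_const, measureReal_restrict_apply_univ, ← hm, smul_eq_mul]
      ring
    simp_rw [e1]
    rw [integral_const_mul, integral_add (integrable_const _)
      (integrable_finsetSum _ fun i _ => hint2 i), integral_finsetSum _ fun i _ => hint2 i]
    simp_rw [integral_const_mul]
    rw [integral_const, measureReal_restrict_apply_univ, ← hm, smul_eq_mul]
    ring
  rw [hBint] at hdual
  have hNpos : (0 : ℝ) < N := by exact_mod_cast hN
  -- The first term grows geometrically with ratio `r = 2^{1-s}`. The second is bounded by its value
  -- at the largest scale, to be multiplied by the at most `X` scales.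
  have hterm : ∀ i ∈ Finset.range (I + 1), lam i *
      ∫ α in E, ∫ β in E, arcMajorant N (2 ^ (i + 1)) (α - β) ≤
      48 * C₀ * D * m / N * r ^ i + 96 * C₀ * C₁ * X ^ 2 / D ^ k * m ^ 2 := by
    intro i hi
    have hiI : i ≤ I := by have := Finset.mem_range.1 hi; omega
    have h2i : (2 : ℝ) ^ i ≤ X := le_trans (pow_le_pow_right₀ (by norm_num) hiI) hI1
    have h2i1 : (1 : ℝ) ≤ 2 ^ i := one_le_pow₀ (by norm_num)
    have hRk : (2 ^ (i + 1)) ^ k ≤ N := by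
      have : ((2 : ℝ) ^ (i + 1)) ^ k ≤ N := by
        refine le_trans ?_ hkN
        gcongr
        rw [pow_succ]
        linarith
      exact_mod_cast this
    have h1 := hΨ N (2 ^ (i + 1)) D E hN (by positivity) hRk hD0 hE1
    rw [← hm] at h1
    push_cast at h1
    have hri : ((2 : ℝ) ^ i) ^ (-s) * 2 ^ i = r ^ i := by
      rw [hr, ← Real.rpow_natCast 2 i, ← Real.rpow_mul (by norm_num), ← Real.rpow_add (by norm_num),
        ← Real.rpow_natCast (2 ^ (1 - s)), ← Real.rpow_mul (by norm_num)]
      ring_nf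
    have hs2 : ((2 : ℝ) ^ i) ^ (-s) * (2 ^ i) ^ 2 ≤ X ^ 2 := by
      have : ((2 : ℝ) ^ i) ^ (-s) ≤ 1 := Real.rpow_le_one_of_one_le_of_nonpos h2i1 (by linarith)
      calc ((2 : ℝ) ^ i) ^ (-s) * (2 ^ i) ^ 2 ≤ 1 * X ^ 2 := by gcongr
        _ = X ^ 2 := one_mul _
    calc lam i * _ ≤ lam i * (6 * 2 ^ (i + 1) / N *
          (D * m + C₁ * 2 ^ (i + 1) * N / D ^ k * m ^ 2)) :=
          mul_le_mul_of_nonneg_left h1 (hlam0 i)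
      _ = 48 * C₀ * D * m / N * (((2 : ℝ) ^ i) ^ (-s) * 2 ^ i) +
          96 * C₀ * C₁ * (((2 : ℝ) ^ i) ^ (-s) * (2 ^ i) ^ 2) / D ^ k * m ^ 2 := by
          simp only [hlam]
          field_simp
          ring
      _ ≤ _ := by
          rw [hri]
          gcongr
  have hsum := Finset.sum_le_sum hterm
  rw [Finset.sum_add_distrib, ← Finset.mul_sum] at hsum
  simp only [Finset.sum_const, Finset.card_range, nsmul_eq_mul] at hsum
  have hIX : ((I + 1 : ℕ) : ℝ) ≤ X := by
    refine le_trans ?_ hI1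
    exact_mod_cast Nat.lt_two_pow_self
  have hgeom : ∑ i ∈ Finset.range (I + 1), r ^ i ≤ r / (r - 1) * X ^ (1 - s) := by
    refine (geom_sum_le hr1 I).trans ?_
    gcongr
    calc r ^ I = ((2 : ℝ) ^ I) ^ (1 - s) := by
          rw [hr, ← Real.rpow_natCast, ← Real.rpow_natCast, ← Real.rpow_mul (by norm_num),
            ← Real.rpow_mul (by norm_num), mul_comm]
      _ ≤ X ^ (1 - s) := Real.rpow_le_rpow (by positivity) hI1 (by linarith)
  have hXpow : ∀ b : ℝ, X ^ b = (2 * C₀) ^ (b / s) * δ ^ (-(2 * b / s)) := by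
    intro b
    rw [hX, hY, ← Real.rpow_mul (by positivity), Real.div_rpow (by positivity) (by positivity),
      div_eq_mul_inv, ← Real.rpow_neg (by positivity), ← Real.rpow_natCast δ 2,
      ← Real.rpow_mul hδ.le]
    push_cast
    ring_nf
  -- The constant `384 = 4 · 96` in `A` is chosen so that the divisor tail is at most a quarter of
  -- the left-hand side below.
  have herr : 96 * C₀ * C₁ * X ^ 3 / D ^ k ≤ δ ^ 2 / 4 := by
    rw [div_le_iff₀ (by positivity)]
    have hX3 : X ^ 3 = (2 * C₀) ^ (3 / s) * δ ^ (-(6 / s)) := by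
      rw [← Real.rpow_natCast X 3, hXpow]
      push_cast
      ring_nf
    have hAk : 384 * C₀ * C₁ * (2 * C₀) ^ (3 / s) ≤ A ^ k :=
      (le_max_right _ _).trans (le_self_pow₀ hA1 hk0)
    have hDk : D ^ k = A ^ k * δ ^ (-(κ * k)) := by
      rw [hD, mul_pow, ← Real.rpow_natCast (δ ^ (-κ)), ← Real.rpow_mul hδ.le]
      ring_nf
    have hδk : δ ^ (-(6 / s)) ≤ δ ^ 2 * δ ^ (-(κ * k)) := by
      rw [← Real.rpow_natCast δ 2, ← Real.rpow_add hδ]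
      refine Real.rpow_le_rpow_of_exponent_ge hδ hδ1 ?_
      push_cast
      linarith
    rw [hX3, hDk]
    calc 96 * C₀ * C₁ * ((2 * C₀) ^ (3 / s) * δ ^ (-(6 / s)))
        = (384 * C₀ * C₁ * (2 * C₀) ^ (3 / s)) * δ ^ (-(6 / s)) / 4 := by ring
      _ ≤ A ^ k * (δ ^ 2 * δ ^ (-(κ * k))) / 4 := by gcongr
      _ = _ := by ring
  -- Of `δ² m²` one half is lost to the minor arcs and one quarter to the divisor tail. The
  -- remaining quarter gives a bound linear in `m`.
  have hmain : δ ^ 2 * m ^ 2 ≤ δ ^ 2 / 2 * m ^ 2 +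
      (48 * C₀ * D * m / N * (r / (r - 1) * X ^ (1 - s)) + δ ^ 2 / 4 * m ^ 2) := by
    have h1 : T ^ 2 * (δ ^ 2 * m ^ 2) ≤ T ^ 2 * (δ ^ 2 / 2 * m ^ 2 +
        (48 * C₀ * D * m / N * (r / (r - 1) * X ^ (1 - s)) + δ ^ 2 / 4 * m ^ 2)) := by
      calc T ^ 2 * (δ ^ 2 * m ^ 2) = (δ * T * m) ^ 2 := by ring
        _ ≤ _ := hdual
        _ = T ^ 2 * (δ ^ 2 / 2 * m ^ 2 + ∑ i ∈ Finset.range (I + 1), lam i *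
          ∫ α in E, ∫ β in E, arcMajorant N (2 ^ (i + 1)) (α - β)) := by ring
        _ ≤ T ^ 2 * (δ ^ 2 / 2 * m ^ 2 + (48 * C₀ * D * m / N * (r / (r - 1) * X ^ (1 - s)) +
            X * (96 * C₀ * C₁ * X ^ 2 / D ^ k * m ^ 2))) := by
            gcongr
            refine hsum.trans ?_
            gcongr
        _ = T ^ 2 * (δ ^ 2 / 2 * m ^ 2 + (48 * C₀ * D * m / N * (r / (r - 1) * X ^ (1 - s)) +
            (96 * C₀ * C₁ * X ^ 3 / D ^ k) * m ^ 2)) := by ring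
        _ ≤ _ := by gcongr
    exact le_of_mul_le_mul_left h1 (by positivity)
  rcases hm0.eq_or_lt with h0 | hmpos
  · rw [← h0]
    positivity
  have hfin : δ ^ 2 * m ≤ 4 * (48 * C₀ * D / N * (r / (r - 1) * X ^ (1 - s))) := by
    have h1 : m * (δ ^ 2 * m) ≤ m * (4 * (48 * C₀ * D / N * (r / (r - 1) * X ^ (1 - s)))) := by
      have e : 48 * C₀ * D * m / N * (r / (r - 1) * X ^ (1 - s)) =
        m * (48 * C₀ * D / N * (r / (r - 1) * X ^ (1 - s))) := by ring
      rw [e] at hmain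
      nlinarith
    exact le_of_mul_le_mul_left h1 hmpos
  have hδpow : δ ^ 2 * δ ^ (-(2 / s) - κ) = δ ^ (-κ) * δ ^ (-(2 * (1 - s) / s)) := by
    rw [← Real.rpow_natCast δ 2, ← Real.rpow_add hδ, ← Real.rpow_add hδ]
    congr 1
    push_cast
    field_simp
    ring
  have : δ ^ 2 * m ≤ δ ^ 2 *
      (4 * (48 * C₀ * (r / (r - 1)) * (2 * C₀) ^ ((1 - s) / s) * A) * δ ^ (-(2 / s) - κ) / N) := by
    refine hfin.trans (le_of_eq ?_)
    rw [hXpow, hD]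
    calc _ = 4 * (48 * C₀ * (r / (r - 1)) * (2 * C₀) ^ ((1 - s) / s) * A) / N *
          (δ ^ (-κ) * δ ^ (-(2 * (1 - s) / s))) := by ring
      _ = _ := by rw [← hδpow]; ring
  exact le_of_mul_le_mul_left this (by positivity)

end MixedRestriction

namespace MixedRestriction
open MeasureTheory Complex Filter

theorem exists_forall_le_rpow {a : ℝ} (ha : 0 < a) (b : ℝ) :
    ∃ N₀ : ℕ, 1 ≤ N₀ ∧ ∀ N : ℕ, N₀ ≤ N → b ≤ (N : ℝ) ^ a := by
  have h := ((tendsto_rpow_atTop ha).comp tendsto_natCast_atTop_atTop).eventually_ge_atTop b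
  obtain ⟨n, hn⟩ := eventually_atTop.1 h
  exact ⟨max n 1, le_max_right _ _, fun N hN => hn N ((le_max_left _ _).trans hN)⟩

theorem norm_expSum_le_of_majorant {ι : Type*} {t : Finset ι} {c : ι → ℂ} {ω v : ι → ℝ}
    (f : ι → ℤ) {T : ℝ} (hω : ∀ j ∈ t, 0 ≤ ω j) (hv : ∀ j ∈ t, 0 ≤ v j)
    (hc : ∀ j ∈ t, ‖c j‖ ^ 2 ≤ ω j * v j) (hωT : ∑ j ∈ t, ω j ≤ T) (hvT : ∑ j ∈ t, v j ≤ T)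
    (α : ℝ) : ‖expSum t c f α‖ ≤ T := by
  have hT : 0 ≤ T := (Finset.sum_nonneg hω).trans hωT
  refine (norm_expSum_le _ _ _ _).trans ?_
  refine abs_le_of_sq_le_sq' ?_ hT |>.2
  refine (Finset.sum_sq_le_sum_mul_sum_of_sq_le_mul _ hω hv hc).trans ?_
  rw [sq]
  exact mul_le_mul hωT hvT (Finset.sum_nonneg hv) hT

/-- A dyadic layer decomposition. Values below `1/Z` are compared with the `p₀`-th power; any larger
value lies between `2^{-(i+1)}` and `2^{-i}` for some level with `2^i ≤ Z`. -/
theorem rpow_le_add_sum_indicator {p p₀ Z x : ℝ} (hp₀ : 0 < p₀) (hp : p₀ < p) (hZ : 1 ≤ Z)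
    (hx0 : 0 ≤ x) (hx1 : x ≤ 1) {I : ℕ} (hI : Z < 2 ^ (I + 1)) :
    x ^ p ≤ Z ^ (-(p - p₀)) * x ^ p₀ +
      ∑ i ∈ Finset.range (I + 1), if (2 : ℝ) ^ i ≤ Z ∧ (2 ^ (i + 1))⁻¹ ≤ x then
        ((2 : ℝ) ^ i) ^ (-p) else 0 := by
  have hsum0 : 0 ≤ ∑ i ∈ Finset.range (I + 1), if (2 : ℝ) ^ i ≤ Z ∧ (2 ^ (i + 1))⁻¹ ≤ x then
        ((2 : ℝ) ^ i) ^ (-p) else 0 := Finset.sum_nonneg fun i _ => by split_ifs <;> positivity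
  rcases hx0.eq_or_lt with rfl | hxpos
  · rw [Real.zero_rpow (by linarith), Real.zero_rpow hp₀.ne']
    linarith
  by_cases hxZ : x ≤ Z⁻¹
  · have h1 : x ^ (p - p₀) ≤ Z ^ (-(p - p₀)) := by
      rw [Real.rpow_neg (by linarith), ← Real.inv_rpow (by linarith)]
      exact Real.rpow_le_rpow hx0 hxZ (by linarith)
    have h2 : x ^ p = x ^ (p - p₀) * x ^ p₀ := by
      rw [← Real.rpow_add hxpos]
      ring_nf
    rw [h2]
    have : x ^ (p - p₀) * x ^ p₀ ≤ Z ^ (-(p - p₀)) * x ^ p₀ := by gcongr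
    linarith
  · have hx1' : 1 ≤ x⁻¹ := (one_le_inv₀ hxpos).2 hx1
    obtain ⟨i, hi1, hi2⟩ := exists_two_pow_le_lt hx1'
    have hxZ' : x⁻¹ < Z := by
      rw [inv_lt_comm₀ hxpos (by linarith)]
      exact not_le.1 hxZ
    have hiI : i < I + 1 := by
      have : (2 : ℝ) ^ i < 2 ^ (I + 1) := by linarith
      exact (pow_lt_pow_iff_right₀ (by norm_num)).1 this
    have h3 := Finset.single_le_sum (f := fun i : ℕ => if (2 : ℝ) ^ i ≤ Z ∧ (2 ^ (i + 1))⁻¹ ≤ x then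
        ((2 : ℝ) ^ i) ^ (-p) else 0) (fun i _ => by split_ifs <;> positivity)
        (Finset.mem_range.2 hiI)
    have h4 : (2 ^ (i + 1))⁻¹ ≤ x := by
      rw [inv_le_comm₀ (by positivity) hxpos]
      exact hi2.le
    simp only [if_pos (And.intro (hi1.trans hxZ'.le) h4)] at h3
    have h5 : x ^ p ≤ ((2 : ℝ) ^ i) ^ (-p) := by
      rw [Real.rpow_neg (by positivity), ← Real.inv_rpow (by positivity)]
      refine Real.rpow_le_rpow hx0 ?_ (by linarith)
      rwa [le_inv_comm₀ hxpos (by positivity)]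
    have h6 : 0 ≤ Z ^ (-(p - p₀)) * x ^ p₀ := by positivity
    linarith

/-- Removal of `ε`: an exponential sum whose majorant is concentrated on major arcs, and which
satisfies a restriction estimate with a loss of `N ^ ε`, satisfies a sharp restriction estimate for
larger exponents. -/
theorem exists_integral_norm_rpow_le {s p p₀ η C₀ : ℝ} (hs : 0 < s) (hs1 : s < 1) (hsp : 2 / s < p)
    (hp₀ : 0 < p₀) (hp : p₀ < p) (hη : 0 < η) (hC₀ : 1 ≤ C₀) :
    ∃ ε C : ℝ, 0 < ε ∧ 0 ≤ C ∧ ∀ (ι : Type) (t : Finset ι) (c : ι → ℂ) (ω v : ι → ℝ) (f : ι → ℤ)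
      (N : ℕ) (T : ℝ), 0 < N → 0 < T →
      (∀ j ∈ t, 0 ≤ ω j) → (∀ j ∈ t, 0 ≤ v j) → (∀ j ∈ t, ‖c j‖ ^ 2 ≤ ω j * v j) →
      ∑ j ∈ t, ω j ≤ T → ∑ j ∈ t, v j ≤ T →
      (∀ θ, ‖expSum t (fun j => (ω j : ℂ)) f θ‖ ≤ T * (N : ℝ) ^ (-η) ∨
        ∃ (q : ℕ) (a : ℤ), 1 ≤ q ∧
        ‖expSum t (fun j => (ω j : ℂ)) f θ‖ ≤ C₀ * T * (q * (1 + N * |θ - a / q|)) ^ (-s)) →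
      ∫ α in (0 : ℝ)..1, ‖expSum t c f α‖ ^ p₀ ≤ T ^ p₀ * (N : ℝ) ^ (-1 + ε) →
      ∫ α in (0 : ℝ)..1, ‖expSum t c f α‖ ^ p ≤ C * T ^ p / N := by
  -- Half of the gap, so that the level set exponent is `2/s + κ = p - κ` and the dyadic series
  -- converges like `∑ 2^{-κ i}`.
  set κ := (p - 2 / s) / 2 with hκ
  have hκ0 : 0 < κ := by rw [hκ]; linarith
  obtain ⟨k, C₁, hC₁, hlev⟩ := exists_level_set_le hs hs1 hC₀ hκ0
  -- Levels down to about `N^{-e}` are treated by the level set estimate. The first bound on `e`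
  -- keeps the minor arc error `N^{-η}` below `δ²/2`; the second secures the requirement that a
  -- `k`-th power be at most `N`.
  set e := min (η / 4) (s / (4 * (k + 1))) with he
  have he0 : 0 < e := lt_min (by positivity) (by positivity)
  obtain ⟨N₁, hN₁, hN₁'⟩ := exists_forall_le_rpow (show 0 < η / 2 by positivity) 8
  obtain ⟨N₂, hN₂, hN₂'⟩ := exists_forall_le_rpow (show (0 : ℝ) < 1 / 2 by norm_num)
    ((2 * (8 * C₀) ^ (1 / s)) ^ k)
  set C₂ := C₁ * 2 ^ (p - κ) * (1 - 2 ^ (-κ))⁻¹ with hC₂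
  have h2κ : (2 : ℝ) ^ (-κ) < 1 := Real.rpow_lt_one_of_one_lt_of_neg (by norm_num) (by linarith)
  have hC₂0 : 0 ≤ C₂ := by
    have : 0 ≤ (1 - (2 : ℝ) ^ (-κ))⁻¹ := inv_nonneg.2 (by linarith)
    positivity
  -- This `ε` is exactly what the factor `Z^{-(p-p₀)}` with `Z = N^e` cancels in the lossy moment.
  refine ⟨e * (p - p₀), 1 + C₂ + (N₁ + N₂), mul_pos he0 (by linarith), by positivity, ?_⟩
  intro ι t c ω v f N T hN hT hω hv hc hωT hvT hK hL
  have hNpos : (0 : ℝ) < N := by exact_mod_cast hN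
  have hN1 : (1 : ℝ) ≤ N := by exact_mod_cast hN
  set F := expSum t c f with hFdef
  have hFc : Continuous F := continuous_expSum _ _ _
  have hFT : ∀ α, ‖F α‖ ≤ T := norm_expSum_le_of_majorant f hω hv hc hωT hvT
  have hp0 : 0 < p := hp₀.trans hp
  have hcont : ∀ b : ℝ, 0 < b → Continuous fun α => ‖F α‖ ^ b := fun b hb =>
    hFc.norm.rpow_const fun _ => Or.inr hb.le
  -- For bounded `N` the trivial bound `|F| ≤ T` suffices, and the threshold is absorbed into the
  -- constant.
  by_cases hlarge : N < max N₁ N₂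
  · have h1 : ∫ α in (0 : ℝ)..1, ‖F α‖ ^ p ≤ ∫ α in (0 : ℝ)..1, T ^ p := by
      refine intervalIntegral.integral_mono_on zero_le_one ((hcont p hp0).intervalIntegrable _ _)
        (by simp) fun α _ => ?_
      exact Real.rpow_le_rpow (norm_nonneg _) (hFT α) hp0.le
    simp only [intervalIntegral.integral_const, sub_zero, one_smul] at h1
    refine h1.trans ?_
    rw [le_div_iff₀ hNpos, mul_comm]
    gcongr
    have h2 : (N : ℝ) ≤ N₁ + N₂ := by
      have : N ≤ N₁ + N₂ := hlarge.le.trans (max_le (by omega) (by omega))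
      exact_mod_cast this
    linarith
  have hNN : max N₁ N₂ ≤ N := not_lt.1 hlarge
  have hA := hN₁' N ((le_max_left _ _).trans hNN)
  have hB := hN₂' N ((le_max_right _ _).trans hNN)
  set Z : ℝ := (N : ℝ) ^ e with hZ
  have hZ1 : 1 ≤ Z := Real.one_le_rpow hN1 he0.le
  obtain ⟨I, hI1, hI2⟩ := exists_two_pow_le_lt hZ1
  set E : ℕ → Set ℝ := fun i => Set.Ioc 0 1 ∩ {α | (2 ^ (i + 1))⁻¹ ≤ ‖F α‖ / T} with hE
  have hEm : ∀ i, MeasurableSet (E i) := fun i => measurableSet_Ioc.inter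
    (measurableSet_le measurable_const (hFc.norm.div_const T).measurable)
  have hEvol : ∀ i, (2 : ℝ) ^ i ≤ Z →
      volume.real (E i) ≤ C₁ * ((2 : ℝ) ^ (i + 1)) ^ (p - κ) / N := by
    intro i hiZ
    set δ : ℝ := (2 ^ (i + 1))⁻¹ with hδ
    have hδ0 : 0 < δ := by positivity
    have hδinv : (δ ^ 2)⁻¹ ≤ 4 * (N : ℝ) ^ (2 * e) := by
      have e1 : (δ ^ 2)⁻¹ = 4 * ((2 : ℝ) ^ i) ^ 2 := by
        rw [hδ]
        field_simp
        ring
      have e2 : (N : ℝ) ^ (2 * e) = Z ^ 2 := by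
        rw [hZ, ← Real.rpow_natCast, ← Real.rpow_mul hNpos.le]
        push_cast
        ring_nf
      rw [e1, e2]
      gcongr
    have hNη : (N : ℝ) ^ (-η) ≤ δ ^ 2 / 2 := by
      have e1 : (N : ℝ) ^ (2 * e) ≤ (N : ℝ) ^ (η / 2) := by
        refine Real.rpow_le_rpow_of_exponent_le hN1 ?_
        have := min_le_left (η / 4) (s / (4 * (k + 1)))
        rw [← he] at this
        linarith
      have e3 : (N : ℝ) ^ η = (N : ℝ) ^ (η / 2) * (N : ℝ) ^ (η / 2) := by
        rw [← Real.rpow_add hNpos]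
        ring_nf
      have e2 : (δ ^ 2 / 2)⁻¹ ≤ (N : ℝ) ^ η := by
        calc (δ ^ 2 / 2)⁻¹ = 2 * (δ ^ 2)⁻¹ := by field_simp
          _ ≤ 2 * (4 * (N : ℝ) ^ (η / 2)) := by gcongr; exact hδinv.trans (by gcongr)
          _ = 8 * (N : ℝ) ^ (η / 2) := by ring
          _ ≤ _ := by rw [e3]; gcongr
      rw [Real.rpow_neg hNpos.le, inv_le_comm₀ (by positivity) (by positivity)]
      exact e2
    have hk : (2 * (2 * C₀ / δ ^ 2) ^ (1 / s)) ^ k ≤ N := by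
      have e1 : 2 * C₀ / δ ^ 2 ≤ 8 * C₀ * (N : ℝ) ^ (2 * e) := by
        rw [div_eq_mul_inv]
        calc 2 * C₀ * (δ ^ 2)⁻¹ ≤ 2 * C₀ * (4 * (N : ℝ) ^ (2 * e)) := by gcongr
          _ = _ := by ring
      calc (2 * (2 * C₀ / δ ^ 2) ^ (1 / s)) ^ k
          ≤ (2 * (8 * C₀ * (N : ℝ) ^ (2 * e)) ^ (1 / s)) ^ k := by gcongr
        _ = (2 * (8 * C₀) ^ (1 / s)) ^ k * (N : ℝ) ^ (2 * e * (1 / s) * k) := by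
            rw [Real.mul_rpow (by positivity) (by positivity), ← mul_assoc, mul_pow,
              ← Real.rpow_mul hNpos.le, ← Real.rpow_natCast ((N : ℝ) ^ _), ← Real.rpow_mul hNpos.le]
        _ ≤ (N : ℝ) ^ (1 / 2 : ℝ) * (N : ℝ) ^ (1 / 2 : ℝ) := by
            gcongr
            have h1 := min_le_right (η / 4) (s / (4 * (k + 1)))
            rw [← he, le_div_iff₀ (by positivity)] at h1
            have h2 : e * k ≤ s / 4 := by nlinarith
            have h3 : 2 * e * (1 / s) * k = 2 * (e * k) / s := by field_simp
            rw [h3, div_le_iff₀ hs]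
            linarith
        _ = N := by rw [← Real.rpow_add hNpos]; norm_num
    have := hlev ι t c ω v f N T δ (E i) hN hT hδ0 (inv_le_one_of_one_le₀
      (one_le_pow₀ (by norm_num))) hω hv hc hvT (fun θ => (hK θ).imp_left fun h => h.trans (by gcongr))
      hk (hEm i) Set.inter_subset_left (fun α hα => by
        have := hα.2
        simp only [Set.mem_ofPred_eq, le_div_iff₀ hT] at this
        exact this)
    refine this.trans (le_of_eq ?_)
    rw [hδ, Real.inv_rpow (by positivity), ← Real.rpow_neg (by positivity)]
    congr 3
    rw [hκ]
    ring
  have hind : ∀ i, Integrable ((E i).indicator fun _ => ((2 : ℝ) ^ i) ^ (-p))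
      (volume.restrict (Set.Ioc 0 1)) := fun i =>
    (integrable_const _).indicator (hEm i)
  have hpt : ∀ α ∈ Set.Ioc (0 : ℝ) 1, (‖F α‖ / T) ^ p ≤ Z ^ (-(p - p₀)) * (‖F α‖ / T) ^ p₀ +
      ∑ i ∈ (Finset.range (I + 1)).filter (fun i => (2 : ℝ) ^ i ≤ Z),
        (E i).indicator (fun _ => ((2 : ℝ) ^ i) ^ (-p)) α := by
    intro α hα
    have hx1 : ‖F α‖ / T ≤ 1 := by rw [div_le_one hT]; exact hFT α
    refine (rpow_le_add_sum_indicator hp₀ hp hZ1 (by positivity) hx1 hI2).trans (le_of_eq ?_)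
    congr 1
    rw [Finset.sum_filter]
    refine Finset.sum_congr rfl fun i _ => ?_
    by_cases h1 : (2 : ℝ) ^ i ≤ Z
    · by_cases h2 : (2 ^ (i + 1))⁻¹ ≤ ‖F α‖ / T
      · rw [if_pos ⟨h1, h2⟩, if_pos h1, Set.indicator_of_mem]
        exact ⟨hα, h2⟩
      · rw [if_neg (fun h => h2 h.2), if_pos h1, Set.indicator_of_notMem]
        exact fun h => h2 h.2
    · rw [if_neg (fun h => h1 h.1), if_neg h1]
  have hi1 : ∀ b : ℝ, 0 < b → Integrable (fun α => (‖F α‖ / T) ^ b)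
      (volume.restrict (Set.Ioc 0 1)) := by
    intro b hb
    have : Continuous fun α => (‖F α‖ / T) ^ b :=
      (hFc.norm.div_const T).rpow_const fun _ => Or.inr hb.le
    exact this.integrableOn_Icc.mono_set Set.Ioc_subset_Icc_self
  have hmono := setIntegral_mono_on (hi1 p hp0) (((hi1 p₀ hp₀).const_mul _).add
    (integrable_finsetSum _ fun i _ => hind i)) measurableSet_Ioc hpt
  simp only [Pi.add_apply] at hmono
  rw [integral_add ((hi1 p₀ hp₀).const_mul _) (integrable_finsetSum _ fun i _ => hind i),
    integral_const_mul, integral_finsetSum _ fun i _ => hind i] at hmono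
  have hscale : ∀ b : ℝ, 0 < b → ∫ α in Set.Ioc (0 : ℝ) 1, (‖F α‖ / T) ^ b =
      (∫ α in (0 : ℝ)..1, ‖F α‖ ^ b) / T ^ b := by
    intro b hb
    rw [intervalIntegral.integral_of_le zero_le_one, ← integral_div]
    congr 1
    ext α
    rw [Real.div_rpow (norm_nonneg _) hT.le]
  rw [hscale p hp0, hscale p₀ hp₀] at hmono
  have hfirst : Z ^ (-(p - p₀)) * ((∫ α in (0 : ℝ)..1, ‖F α‖ ^ p₀) / T ^ p₀) ≤ 1 / N := by
    calc _ ≤ Z ^ (-(p - p₀)) * (T ^ p₀ * (N : ℝ) ^ (-1 + e * (p - p₀)) / T ^ p₀) := by gcongr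
      _ = Z ^ (-(p - p₀)) * (N : ℝ) ^ (-1 + e * (p - p₀)) := by
          have : T ^ p₀ ≠ 0 := by positivity
          field_simp
      _ = 1 / N := by
          rw [hZ, ← Real.rpow_mul hNpos.le, ← Real.rpow_add hNpos, one_div, ← Real.rpow_neg_one]
          congr 1
          ring
  have hsecond : ∑ i ∈ (Finset.range (I + 1)).filter (fun i => (2 : ℝ) ^ i ≤ Z),
      ∫ α in Set.Ioc (0 : ℝ) 1, (E i).indicator (fun _ => ((2 : ℝ) ^ i) ^ (-p)) α ≤ C₂ / N := by
    have hterm : ∀ i ∈ (Finset.range (I + 1)).filter (fun i => (2 : ℝ) ^ i ≤ Z),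
        ∫ α in Set.Ioc (0 : ℝ) 1, (E i).indicator (fun _ => ((2 : ℝ) ^ i) ^ (-p)) α ≤
        C₁ * 2 ^ (p - κ) / N * ((2 : ℝ) ^ (-κ)) ^ i := by
      intro i hi
      rw [integral_indicator_const _ (hEm i), measureReal_restrict_apply (hEm i), smul_eq_mul,
        Set.inter_eq_left.2 Set.inter_subset_left]
      calc volume.real (E i) * ((2 : ℝ) ^ i) ^ (-p)
          ≤ C₁ * ((2 : ℝ) ^ (i + 1)) ^ (p - κ) / N * ((2 : ℝ) ^ i) ^ (-p) := by
            gcongr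
            exact hEvol i (Finset.mem_filter.1 hi).2
        _ = C₁ * 2 ^ (p - κ) / N * ((2 : ℝ) ^ (-κ)) ^ i := by
            rw [pow_succ, Real.mul_rpow (by positivity) (by positivity)]
            have : ((2 : ℝ) ^ i) ^ (p - κ) * ((2 : ℝ) ^ i) ^ (-p) = ((2 : ℝ) ^ (-κ)) ^ i := by
              rw [← Real.rpow_add (by positivity), ← Real.rpow_natCast, ← Real.rpow_natCast,
                ← Real.rpow_mul (by norm_num), ← Real.rpow_mul (by norm_num)]
              ring_nf
            rw [← this]
            ring
    refine (Finset.sum_le_sum hterm).trans ?_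
    refine (Finset.sum_le_sum_of_subset_of_nonneg (Finset.filter_subset _ _)
      fun _ _ _ => by positivity).trans ?_
    rw [← Finset.mul_sum]
    have hg : ∑ i ∈ Finset.range (I + 1), ((2 : ℝ) ^ (-κ)) ^ i ≤ (1 - 2 ^ (-κ))⁻¹ := by
      rw [← tsum_geometric_of_lt_one (by positivity) h2κ]
      exact (summable_geometric_of_lt_one (by positivity) h2κ).sum_le_tsum _
        fun _ _ => by positivity
    calc _ ≤ C₁ * 2 ^ (p - κ) / N * (1 - 2 ^ (-κ))⁻¹ := by gcongr
      _ = C₂ / N := by rw [hC₂]; ring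
  have hTp : 0 < T ^ p := by positivity
  have hfin : (∫ α in (0 : ℝ)..1, ‖F α‖ ^ p) / T ^ p ≤ (1 + C₂) / N := by
    rw [add_div]
    linarith
  rw [div_le_iff₀ hTp] at hfin
  refine hfin.trans ?_
  rw [div_mul_eq_mul_div]
  refine div_le_div_of_nonneg_right (mul_le_mul_of_nonneg_right ?_ hTp.le) hNpos.le
  have : (0 : ℝ) ≤ (N₁ : ℝ) + N₂ := by positivity
  linarith

/-! ### Weyl's inequality for quadratic polynomials -/

/-- For `0 < |d| ≤ q/2` the fraction `d r` is not an integer, hence is at least `1/q` away from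
every integer. Replacing `r` by `α` moves it by at most `1/(2q)`. -/
theorem one_div_le_abs_mul_sub {α : ℝ} {r : ℚ} (hr : |α - r| ≤ 1 / (r.den : ℝ) ^ 2) {d m : ℤ}
    (hd0 : d ≠ 0) (hd : 2 * |d| ≤ r.den) : 1 / (2 * (r.den : ℝ)) ≤ |d * α - m| := by
  set q := r.den with hq
  have hq0 : (0 : ℝ) < q := by exact_mod_cast r.den_pos
  have hne : d * r.num - m * q ≠ 0 := by
    intro h
    have h1 : (q : ℤ) ∣ d * r.num := ⟨m, by linarith⟩
    have h2 : IsCoprime (q : ℤ) r.num := by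
      rw [Int.isCoprime_iff_gcd_eq_one, Int.gcd_comm]
      exact r.reduced
    have h3 := h2.dvd_of_dvd_mul_right h1
    have h4 := Int.le_of_dvd (abs_pos.2 hd0) ((dvd_abs _ _).2 h3)
    have := abs_pos.2 hd0
    omega
  have h1 : (1 : ℝ) ≤ |(d : ℝ) * r.num - m * q| := by
    exact_mod_cast Int.one_le_abs hne
  have hrq : (r : ℝ) = r.num / q := by rw [hq]; exact_mod_cast (Rat.num_div_den r).symm
  have h2 : 1 / (q : ℝ) ≤ |d * (r : ℝ) - m| := by
    rw [div_le_iff₀ hq0, hrq]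
    have : (d : ℝ) * (r.num / q) - m = (d * r.num - m * q) / q := by field_simp
    rw [this, abs_div, abs_of_pos hq0, div_mul_cancel₀ _ hq0.ne']
    exact h1
  have h3 : |(d : ℝ) * (α - r)| ≤ 1 / (2 * q) := by
    rw [abs_mul]
    have hd' : 2 * |(d : ℝ)| ≤ q := by exact_mod_cast hd
    calc |(d : ℝ)| * |α - r| ≤ (q / 2) * (1 / (q : ℝ) ^ 2) := by
          gcongr
          linarith
      _ = 1 / (2 * q) := by field_simp
  have h4 : d * (r : ℝ) - m = (d * α - m) - d * (α - r) := by ring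
  have h5 := abs_sub (d * α - m) (d * (α - r))
  rw [← h4] at h5
  have h6 : 1 / (q : ℝ) = 1 / (2 * q) + 1 / (2 * q) := by field_simp; norm_num
  linarith

/-- Cut the range into blocks of length `q/2 + 1`. Within a block the multiples `h α` are
`1/(2q)`-separated modulo one, so the integers `⌊2q (hα - round (hα))⌋` are distinct and lie in an
interval with at most `4tq + 2` members. -/
theorem card_filter_abs_sub_round_le {α t : ℝ} {r : ℚ} (hr : |α - r| ≤ 1 / (r.den : ℝ) ^ 2)
    (ht : 0 ≤ t) (H : ℕ) :
    (((Finset.range H).filter fun h : ℕ => |h * α - round (h * α)| ≤ t).card : ℝ) ≤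
      (4 * t * r.den + 2) * (2 * H / r.den + 1) := by
  set q := r.den with hq
  have hqpos : 0 < q := r.den_pos
  have hq0 : (0 : ℝ) < q := by exact_mod_cast hqpos
  set S := (Finset.range H).filter fun h : ℕ => |h * α - round (h * α)| ≤ t with hS
  set B := q / 2 + 1 with hB
  set n := (Finset.Icc ⌊-(2 * q * t)⌋ ⌊2 * q * t⌋).card with hn
  have hblock : ∀ j ∈ Finset.range (H / B + 1), (S.filter fun h => h / B = j).card ≤ n := by
    intro j _
    refine Finset.card_le_card_of_injOn (fun h : ℕ => ⌊2 * q * (h * α - round (h * α))⌋) ?_ ?_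
    · intro h hh
      simp only [Finset.coe_filter, Set.mem_ofPred_eq, hS, Finset.mem_filter] at hh
      have hab := abs_le.1 hh.1.2
      simp only [Finset.coe_Icc, Set.mem_Icc]
      refine ⟨Int.floor_le_floor ?_, Int.floor_le_floor ?_⟩
      · nlinarith
      · nlinarith
    · intro h hh h' hh' heq
      simp only [Finset.coe_filter, Set.mem_ofPred_eq] at hh hh'
      by_contra hne
      have hd0 : ((h : ℤ) - h') ≠ 0 := by omega
      have hd : 2 * |(h : ℤ) - h'| ≤ q := by
        have e1 := Nat.div_add_mod h B
        have e2 := Nat.div_add_mod h' B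
        rw [hh.2] at e1
        rw [hh'.2] at e2
        have l1 := Nat.mod_lt h (show 0 < B by omega)
        have l2 := Nat.mod_lt h' (show 0 < B by omega)
        have : |(h : ℤ) - h'| ≤ (q / 2 : ℕ) := by
          rw [abs_le]
          constructor <;> omega
        omega
      have h1 := one_div_le_abs_mul_sub hr (m := round (h * α) - round (h' * α)) hd0 hd
      have h2 := Int.abs_sub_lt_one_of_floor_eq_floor heq
      have h3 : 2 * q * (h * α - round (h * α)) - 2 * q * (h' * α - round (h' * α)) =
          2 * q * ((((h : ℤ) - h' : ℤ) : ℝ) * α - ((round (h * α) - round (h' * α) : ℤ) : ℝ)) := by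
        push_cast
        ring
      rw [h3, abs_mul, abs_of_pos (by positivity)] at h2
      rw [div_le_iff₀ (by positivity)] at h1
      rw [← hq] at h1
      nlinarith
  have h1 := Finset.card_le_mul_card_image_of_maps_to (s := S) (t := Finset.range (H / B + 1))
    (f := fun h => h / B) (fun h hh => by
      have := Finset.mem_range.1 (Finset.mem_filter.1 hh).1
      exact Finset.mem_range.2 (Nat.lt_succ_of_le (Nat.div_le_div_right this.le))) n hblock
  rw [Finset.card_range] at h1
  have h2 : (n : ℝ) ≤ 4 * t * q + 2 := by
    rw [hn, Int.card_Icc]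
    have hle : ⌊-(2 * q * t)⌋ ≤ ⌊2 * q * t⌋ := Int.floor_le_floor (by
      have : 0 ≤ 2 * q * t := by positivity
      linarith)
    have h3 : (((⌊2 * q * t⌋ + 1 - ⌊-(2 * q * t)⌋).toNat : ℤ) : ℝ) =
        ((⌊2 * q * t⌋ + 1 - ⌊-(2 * q * t)⌋ : ℤ) : ℝ) := by
      rw [Int.toNat_of_nonneg (by omega)]
    have h4 := Int.floor_le (2 * q * t)
    have h5 := Int.lt_floor_add_one (-(2 * q * t))
    rw [Int.cast_natCast] at h3
    rw [h3]
    push_cast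
    linarith
  have h3 : ((H / B + 1 : ℕ) : ℝ) ≤ 2 * H / q + 1 := by
    push_cast
    gcongr
    refine Nat.cast_div_le.trans ?_
    rw [div_le_div_iff₀ (by positivity) hq0]
    have : q ≤ 2 * B := by omega
    have h5 : (q : ℝ) ≤ 2 * B := by exact_mod_cast this
    nlinarith [(Nat.cast_nonneg H : (0 : ℝ) ≤ H)]
  calc (S.card : ℝ) ≤ ((n * (H / B + 1) : ℕ) : ℝ) := by exact_mod_cast h1
    _ = (n : ℝ) * ((H / B + 1 : ℕ) : ℝ) := by push_cast; ring
    _ ≤ _ := by gcongr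

theorem sum_range_sum_range_lt {M : Type*} [AddCommMonoid M] (L : ℕ) (G : ℕ → ℕ → M) :
    ∑ y ∈ Finset.range L, ∑ x ∈ Finset.range y, G x y =
      ∑ h ∈ Finset.range L, ∑ x ∈ Finset.range (L - 1 - h), G x (x + (h + 1)) := by
  rw [Finset.sum_sigma', Finset.sum_sigma']
  refine Finset.sum_bij' (fun z _ => ⟨z.1 - 1 - z.2, z.2⟩) (fun z _ => ⟨z.2 + (z.1 + 1), z.2⟩)
    ?_ ?_ ?_ ?_ ?_
  · rintro ⟨y, x⟩ h
    simp only [Finset.mem_sigma, Finset.mem_range] at h ⊢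
    omega
  · rintro ⟨y, x⟩ h
    simp only [Finset.mem_sigma, Finset.mem_range] at h ⊢
    omega
  · rintro ⟨y, x⟩ h
    simp only [Finset.mem_sigma, Finset.mem_range] at h ⊢
    have : x + (y - 1 - x + 1) = y := by omega
    rw [this]
  · rintro ⟨y, x⟩ h
    simp only [Finset.mem_sigma, Finset.mem_range] at h ⊢
    have : x + (y + 1) - 1 - x = y := by omega
    rw [this]
  · rintro ⟨y, x⟩ h
    simp only [Finset.mem_sigma, Finset.mem_range] at h ⊢
    have : x + (y - 1 - x + 1) = y := by omega
    rw [this]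

/-- Weyl differencing: off-diagonal terms come in conjugate pairs and are grouped by the difference
`h + 1` of the two indices. -/
theorem norm_sq_sum_range_le (z : ℕ → ℂ) (L : ℕ) :
    ‖∑ x ∈ Finset.range L, z x‖ ^ 2 ≤ ∑ x ∈ Finset.range L, ‖z x‖ ^ 2 +
      2 * ∑ h ∈ Finset.range L,
        ‖∑ x ∈ Finset.range (L - 1 - h), z (x + (h + 1)) * (starRingEnd ℂ) (z x)‖ := by
  have h1 : ‖∑ x ∈ Finset.range L, z x‖ ^ 2 = ∑ x ∈ Finset.range L, ‖z x‖ ^ 2 +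
      2 * (∑ y ∈ Finset.range L, ∑ x ∈ Finset.range y, z y * (starRingEnd ℂ) (z x)).re := by
    induction L with
    | zero => simp
    | succ L ih =>
      rw [Finset.sum_range_succ, Finset.sum_range_succ, Finset.sum_range_succ,
        Complex.sq_norm, Complex.normSq_add, ← Complex.sq_norm, ← Complex.sq_norm, ih,
        Complex.add_re, ← Finset.mul_sum, ← map_sum]
      have : ((∑ x ∈ Finset.range L, z x) * (starRingEnd ℂ) (z L)).re =
          (z L * (starRingEnd ℂ) (∑ x ∈ Finset.range L, z x)).re := by
        simp only [Complex.mul_re, Complex.conj_re, Complex.conj_im]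
        ring
      rw [this]
      ring
  rw [h1, sum_range_sum_range_lt L (fun x y => z y * (starRingEnd ℂ) (z x))]
  gcongr
  exact (Complex.re_le_norm _).trans (norm_sum_le _ _)

/-- Each differenced sum is geometric with frequency `(h + 1) · 2α`. It is bounded by `X` when this
is within `t` of an integer, and by `1/(2t)` otherwise. -/
theorem norm_sq_weyl_sum_le {t : ℝ} (ht : 0 < t) (α β γ : ℝ) {L X : ℕ} (hLX : L ≤ X) :
    ‖∑ x ∈ Finset.range L, addChar (α * (x : ℝ) ^ 2 + β * x + γ)‖ ^ 2 ≤
      X + 2 * X * ((Finset.range (X + 1)).filter fun h : ℕ =>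
        |h * (2 * α) - round (h * (2 * α))| ≤ t).card + X / t := by
  refine (norm_sq_sum_range_le _ L).trans ?_
  simp only [norm_addChar, one_pow, Finset.sum_const, Finset.card_range, nsmul_eq_mul, mul_one]
  have hLX' : (L : ℝ) ≤ X := by exact_mod_cast hLX
  have hinner : ∀ h ∈ Finset.range L, ‖∑ x ∈ Finset.range (L - 1 - h),
      addChar (α * ((x + (h + 1) : ℕ) : ℝ) ^ 2 + β * ((x + (h + 1) : ℕ) : ℝ) + γ) *
        (starRingEnd ℂ) (addChar (α * (x : ℝ) ^ 2 + β * x + γ))‖ ≤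
      (if |((h + 1 : ℕ) : ℝ) * (2 * α) - round (((h + 1 : ℕ) : ℝ) * (2 * α))| ≤ t then (X : ℝ)
        else 0) + 1 / (2 * t) := by
    intro h _
    have e : ∀ x : ℕ, addChar (α * ((x + (h + 1) : ℕ) : ℝ) ^ 2 + β * ((x + (h + 1) : ℕ) : ℝ) + γ) *
        (starRingEnd ℂ) (addChar (α * (x : ℝ) ^ 2 + β * x + γ)) =
        addChar (α * ((h + 1 : ℕ) : ℝ) ^ 2 + β * ((h + 1 : ℕ) : ℝ)) *
          addChar (x * (((h + 1 : ℕ) : ℝ) * (2 * α))) := by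
      intro x
      rw [conj_addChar, ← addChar_add, ← addChar_add]
      congr 1
      push_cast
      ring
    simp_rw [e]
    rw [← Finset.mul_sum, norm_mul, norm_addChar, one_mul]
    split_ifs with hcase
    · have := norm_sum_addChar_le_card (Finset.range (L - 1 - h))
        (fun x : ℕ => (x : ℝ) * (((h + 1 : ℕ) : ℝ) * (2 * α)))
      rw [Finset.card_range] at this
      have h2 : ((L - 1 - h : ℕ) : ℝ) ≤ X := by
        have : L - 1 - h ≤ X := by omega
        exact_mod_cast this
      have h3 : 0 ≤ 1 / (2 * t) := by positivity
      linarith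
    · have h1 := norm_geom_sum_addChar_mul_le (L - 1 - h) (((h + 1 : ℕ) : ℝ) * (2 * α))
      rw [zero_add, le_div_iff₀ (by positivity)]
      refine le_trans ?_ h1
      gcongr
      exact (not_le.1 hcase).le
  have hsum := Finset.sum_le_sum hinner
  rw [Finset.sum_add_distrib] at hsum
  have hcount : ∑ h ∈ Finset.range L,
      (if |((h + 1 : ℕ) : ℝ) * (2 * α) - round (((h + 1 : ℕ) : ℝ) * (2 * α))| ≤ t then (X : ℝ)
        else 0) ≤ X * ((Finset.range (X + 1)).filter fun h : ℕ =>
        |h * (2 * α) - round (h * (2 * α))| ≤ t).card := by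
    rw [← Finset.sum_filter, Finset.sum_const, nsmul_eq_mul, mul_comm]
    refine mul_le_mul_of_nonneg_left (Nat.cast_le.2 ?_) (Nat.cast_nonneg X)
    refine Finset.card_le_card_of_injOn (fun h => h + 1) ?_ ?_
    · intro h hh
      simp only [Finset.coe_filter, Set.mem_ofPred_eq, Finset.mem_range] at hh ⊢
      exact ⟨by omega, hh.2⟩
    · intro a _ b _ hab
      simpa using hab
  simp only [Finset.sum_const, Finset.card_range, nsmul_eq_mul] at hsum
  have h4 : (L : ℝ) * (1 / (2 * t)) ≤ X * (1 / (2 * t)) := by gcongr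
  have h5 : (X : ℝ) / t = 2 * (X * (1 / (2 * t))) := by field_simp
  rw [h5]
  linarith

/-- Weyl's inequality: a quadratic exponential sum is small unless its leading coefficient has a
good rational approximation with small denominator. -/
theorem weyl_dichotomy {X : ℕ} (hX : 1 ≤ X) (α : ℝ) :
    (∀ L ≤ X, ∀ β γ : ℝ,
      ‖∑ x ∈ Finset.range L, addChar (α * (x : ℝ) ^ 2 + β * x + γ)‖ ≤ 9 * (X : ℝ) ^ (19 / 20 : ℝ)) ∨
    ∃ r : ℚ, (r.den : ℝ) ≤ (X : ℝ) ^ (1 / 10 : ℝ) ∧ |2 * α - r| ≤ (X : ℝ) ^ (-(17 / 10) : ℝ) := by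
  have hXpos : (0 : ℝ) < X := by exact_mod_cast hX
  have hX1 : (1 : ℝ) ≤ X := by exact_mod_cast hX
  -- Dirichlet's theorem with denominators up to `X^{17/10}`: a denominator at most `X^{1/10}` gives
  -- the second alternative, a larger one gives cancellation.
  set n := ⌊(X : ℝ) ^ (17 / 10 : ℝ)⌋₊ with hn
  have hX17 : (1 : ℝ) ≤ (X : ℝ) ^ (17 / 10 : ℝ) := Real.one_le_rpow hX1 (by norm_num)
  have hn0 : 0 < n := Nat.floor_pos.2 hX17
  obtain ⟨r, hr, hrn⟩ := Real.exists_rat_abs_sub_le_and_den_le (2 * α) hn0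
  have hq0 : (0 : ℝ) < r.den := by exact_mod_cast r.den_pos
  have hq1 : (1 : ℝ) ≤ r.den := by exact_mod_cast r.den_pos
  have hrn' : (r.den : ℝ) ≤ n := by exact_mod_cast hrn
  have hnX : (n : ℝ) ≤ (X : ℝ) ^ (17 / 10 : ℝ) := Nat.floor_le (by positivity)
  by_cases hsmall : (r.den : ℝ) ≤ (X : ℝ) ^ (1 / 10 : ℝ)
  · refine Or.inr ⟨r, hsmall, hr.trans ?_⟩
    rw [Real.rpow_neg hXpos.le, one_div]
    refine inv_anti₀ (by positivity) ?_
    have := Nat.lt_floor_add_one ((X : ℝ) ^ (17 / 10 : ℝ))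
    nlinarith
  · left
    intro L hL β γ
    have hr2 : |2 * α - r| ≤ 1 / (r.den : ℝ) ^ 2 := by
      refine hr.trans (one_div_le_one_div_of_le (by positivity) ?_)
      nlinarith
    -- For `X^{1/10} < q ≤ X^{17/10}` this `t` makes the number of bad `h` at most of order
    -- `X^{9/10}` and `X / t = X^{19/10}`, so every term of the differenced bound is `O(X^{19/10})`.
    set t := (X : ℝ) ^ (-(9 / 10) : ℝ) with ht
    have ht0 : 0 < t := by positivity
    have h1 := norm_sq_weyl_sum_le ht0 α β γ hL
    have h2 := card_filter_abs_sub_round_le hr2 ht0.le (X + 1)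
    have e0 : ∀ b : ℝ, (0 : ℝ) < (X : ℝ) ^ b := fun b => by positivity
    have tX : t * X = (X : ℝ) ^ (1 / 10 : ℝ) := by
      rw [ht, ← Real.rpow_add_one hXpos.ne']
      norm_num
    have tq : t * r.den ≤ (X : ℝ) ^ (8 / 10 : ℝ) := by
      calc t * r.den ≤ t * (X : ℝ) ^ (17 / 10 : ℝ) := by gcongr; linarith
        _ = _ := by rw [ht, ← Real.rpow_add hXpos]; norm_num
    have Xq : (X : ℝ) / r.den ≤ (X : ℝ) ^ (9 / 10 : ℝ) := by
      rw [div_le_iff₀ hq0]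
      calc (X : ℝ) = (X : ℝ) ^ (9 / 10 : ℝ) * (X : ℝ) ^ (1 / 10 : ℝ) := by
            rw [← Real.rpow_add hXpos]; norm_num
        _ ≤ _ := by gcongr; exact (not_le.1 hsmall).le
    have m1 : (X : ℝ) ^ (1 / 10 : ℝ) ≤ (X : ℝ) ^ (9 / 10 : ℝ) :=
      Real.rpow_le_rpow_of_exponent_le hX1 (by norm_num)
    have m2 : (X : ℝ) ^ (8 / 10 : ℝ) ≤ (X : ℝ) ^ (9 / 10 : ℝ) :=
      Real.rpow_le_rpow_of_exponent_le hX1 (by norm_num)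
    have m3 : (1 : ℝ) ≤ (X : ℝ) ^ (9 / 10 : ℝ) := Real.one_le_rpow hX1 (by norm_num)
    have hcount : (4 * t * r.den + 2) * (2 * ((X + 1 : ℕ) : ℝ) / r.den + 1) ≤
        38 * (X : ℝ) ^ (9 / 10 : ℝ) := by
      push_cast
      have h3 : (2 * ((X : ℝ) + 1) / r.den + 1) ≤ 4 * (X / r.den) + 1 := by
        have : 2 * ((X : ℝ) + 1) / r.den ≤ 4 * X / r.den :=
          div_le_div_of_nonneg_right (by linarith) hq0.le
        rw [mul_div_assoc 4] at this
        linarith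
      have h4 : t * r.den * (X / r.den) = (X : ℝ) ^ (1 / 10 : ℝ) := by
        rw [← tX]
        field_simp
      calc (4 * t * r.den + 2) * (2 * ((X : ℝ) + 1) / r.den + 1)
          ≤ (4 * t * r.den + 2) * (4 * (X / r.den) + 1) := by gcongr
        _ = 16 * (t * r.den * (X / r.den)) + 4 * (t * r.den) + 8 * (X / r.den) + 2 := by ring
        _ ≤ _ := by rw [h4]; linarith
    have hXt : (X : ℝ) / t = (X : ℝ) ^ (19 / 10 : ℝ) := by
      rw [ht, Real.rpow_neg hXpos.le, div_inv_eq_mul, ← Real.rpow_one_add' hXpos.le (by norm_num)]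
      norm_num
    have hX19 : (X : ℝ) * (X : ℝ) ^ (9 / 10 : ℝ) = (X : ℝ) ^ (19 / 10 : ℝ) := by
      rw [← Real.rpow_one_add' hXpos.le (by norm_num)]
      norm_num
    have hX1' : (X : ℝ) ≤ (X : ℝ) ^ (19 / 10 : ℝ) := by
      rw [← hX19]
      nlinarith
    have hsq : ‖∑ x ∈ Finset.range L, addChar (α * (x : ℝ) ^ 2 + β * x + γ)‖ ^ 2 ≤
        (9 * (X : ℝ) ^ (19 / 20 : ℝ)) ^ 2 := by
      have e1 : (9 * (X : ℝ) ^ (19 / 20 : ℝ)) ^ 2 = 81 * (X : ℝ) ^ (19 / 10 : ℝ) := by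
        rw [mul_pow, ← Real.rpow_natCast ((X : ℝ) ^ _), ← Real.rpow_mul hXpos.le]
        norm_num
      rw [e1]
      refine h1.trans ?_
      have h5 : 2 * (X : ℝ) * ((Finset.range (X + 1)).filter fun h : ℕ =>
          |h * (2 * α) - round (h * (2 * α))| ≤ t).card ≤ 76 * (X : ℝ) ^ (19 / 10 : ℝ) := by
        rw [← hX19]
        have := mul_le_mul_of_nonneg_left (h2.trans hcount) (show 0 ≤ 2 * (X : ℝ) by positivity)
        linarith
      rw [hXt]
      linarith
    exact abs_le_of_sq_le_sq' hsq (by positivity) |>.2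

/-! ### Quadratic exponential sums on major arcs -/

/-- The polynomial `U x² + ξ x`. -/
def quadPoly (U ξ x : ℕ) : ℕ := U * x ^ 2 + ξ * x

/-- The exponential sum `∑_{x < X} g(x) e(φ (U x² + ξ x))`. -/
noncomputable def quadSum (U ξ : ℕ) (g : ℕ → ℝ) (X : ℕ) (φ : ℝ) : ℂ :=
  ∑ x ∈ Finset.range X, (g x : ℂ) * addChar (φ * (quadPoly U ξ x : ℝ))

/-- The complete exponential sum modulo `q`. -/
noncomputable def quadGauss (U ξ q : ℕ) (a : ℤ) : ℂ :=
  ∑ x ∈ Finset.range q, addChar ((a : ℝ) / q * (quadPoly U ξ x : ℝ))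

theorem quadPoly_add (U ξ x y : ℕ) :
    quadPoly U ξ (x + y) = quadPoly U ξ x + (2 * U * x * y + quadPoly U ξ y) := by
  simp only [quadPoly]; ring

theorem addChar_div_mul_quadPoly_add (U ξ : ℕ) {q : ℕ} (hq : 0 < q) (a : ℤ) (x : ℕ) :
    addChar ((a : ℝ) / q * (quadPoly U ξ (x + q) : ℝ)) =
      addChar ((a : ℝ) / q * (quadPoly U ξ x : ℝ)) := by
  have hq' : (q : ℝ) ≠ 0 := by positivity
  have : (a : ℝ) / q * (quadPoly U ξ (x + q) : ℝ) = (a : ℝ) / q * (quadPoly U ξ x : ℝ) +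
      ((a * (2 * U * x + U * q + ξ) : ℤ) : ℝ) := by
    rw [quadPoly_add]
    simp only [quadPoly]
    push_cast
    field_simp
    ring
  rw [this, addChar_add_intCast]

theorem sum_range_add_of_periodic {u : ℕ → ℂ} {q : ℕ} (hu : ∀ x, u (x + q) = u x) (y : ℕ) :
    ∑ x ∈ Finset.range q, u (y + x) = ∑ x ∈ Finset.range q, u x := by
  induction y with
  | zero => simp
  | succ y ih =>
    rw [← ih]
    have h1 := Finset.sum_range_succ (fun x => u (y + x)) q
    have h2 := Finset.sum_range_succ' (fun x => u (y + x)) q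
    rw [h1, hu, add_zero] at h2
    have h3 := add_right_cancel h2
    rw [h3]
    exact Finset.sum_congr rfl fun x _ => by congr 1; ring

theorem sum_range_mul_add_of_periodic {u : ℕ → ℂ} {q : ℕ} (hu : ∀ x, u (x + q) = u x) (k r : ℕ) :
    ∑ x ∈ Finset.range (q * k + r), u x =
      k * ∑ x ∈ Finset.range q, u x + ∑ x ∈ Finset.range r, u x := by
  induction k with
  | zero => simp
  | succ k ih =>
    have e : q * (k + 1) + r = q + (q * k + r) := by ring
    rw [e, Finset.sum_range_add]
    have : ∀ x, u (q + x) = u x := fun x => by rw [add_comm, hu]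
    simp_rw [this]
    rw [ih]
    push_cast
    ring

/-- Complete periods cancel against the mean, so only the incomplete last period contributes. -/
theorem norm_sum_sub_mean_le {u : ℕ → ℂ} {q : ℕ} (hq : 0 < q) (hu : ∀ x, u (x + q) = u x)
    (hu1 : ∀ x, ‖u x‖ ≤ 1) (m : ℕ) :
    ‖∑ x ∈ Finset.range m, (u x - (∑ y ∈ Finset.range q, u y) / q)‖ ≤ 2 * q := by
  set G := ∑ y ∈ Finset.range q, u y with hG
  have hq' : (q : ℂ) ≠ 0 := by exact_mod_cast hq.ne'
  have hqr : (0 : ℝ) < q := by exact_mod_cast hq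
  have hm := Nat.div_add_mod m q
  have hmr : (m % q : ℕ) < q := Nat.mod_lt _ hq
  have hcard : ∀ n : ℕ, ‖∑ y ∈ Finset.range n, u y‖ ≤ n := fun n =>
    (norm_sum_le _ _).trans ((Finset.sum_le_sum fun y _ => hu1 y).trans (by simp))
  have e : ∑ x ∈ Finset.range m, (u x - G / q) =
      ∑ x ∈ Finset.range (m % q), u x - (m % q : ℕ) * (G / q) := by
    rw [Finset.sum_sub_distrib]
    conv_lhs => rw [← hm]
    rw [sum_range_mul_add_of_periodic hu, ← hG]
    simp only [Finset.sum_const, Finset.card_range, nsmul_eq_mul]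
    push_cast
    field_simp
    ring
  rw [e]
  refine (norm_sub_le _ _).trans ?_
  have h1 := hcard (m % q)
  have h2 : ‖((m % q : ℕ) : ℂ) * (G / q)‖ ≤ q := by
    rw [norm_mul, norm_div, Complex.norm_natCast, Complex.norm_natCast]
    have h3 : ‖G‖ / q ≤ 1 := by rw [div_le_one hqr]; exact hcard q
    have h4 : ((m % q : ℕ) : ℝ) ≤ q := by exact_mod_cast hmr.le
    calc ((m % q : ℕ) : ℝ) * (‖G‖ / q) ≤ q * 1 := by gcongr
      _ = q := mul_one _
  have h4 : ((m % q : ℕ) : ℝ) ≤ q := by exact_mod_cast hmr.le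
  linarith

/-- Abel summation against a weight of bounded variation. -/
theorem norm_sum_mul_le_of_variation {H b : ℕ → ℂ} {n : ℕ} {B V : ℝ}
    (hB : ∀ m, ‖∑ i ∈ Finset.range m, b i‖ ≤ B)
    (hV : ‖H (n - 1)‖ + ∑ i ∈ Finset.range (n - 1), ‖H (i + 1) - H i‖ ≤ V) :
    ‖∑ i ∈ Finset.range n, H i * b i‖ ≤ V * B := by
  have hB0 : 0 ≤ B := (norm_nonneg _).trans (hB 0)
  have := Finset.sum_range_by_parts H b n
  simp only [smul_eq_mul] at this
  rw [this]
  refine (norm_sub_le _ _).trans ?_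
  calc _ ≤ ‖H (n - 1)‖ * B + ∑ i ∈ Finset.range (n - 1), ‖H (i + 1) - H i‖ * B := by
        gcongr
        · rw [norm_mul]
          gcongr
          exact hB n
        · refine (norm_sum_le _ _).trans (Finset.sum_le_sum fun i _ => ?_)
          rw [norm_mul]
          gcongr
          exact hB _
    _ = (‖H (n - 1)‖ + ∑ i ∈ Finset.range (n - 1), ‖H (i + 1) - H i‖) * B := by
        rw [add_mul, Finset.sum_mul]
    _ ≤ _ := by gcongr

theorem quadPoly_mono (U ξ : ℕ) : Monotone (quadPoly U ξ) := by
  intro x y h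
  simp only [quadPoly]
  gcongr

/-- The major arc approximation of a quadratic exponential sum. -/
theorem norm_quadSum_sub_le (U ξ : ℕ) {g : ℕ → ℝ} (hg : Monotone g) (hg0 : ∀ x, 0 ≤ g x) (X : ℕ)
    {q : ℕ} (hq : 0 < q) (a : ℤ) (β : ℝ) :
    ‖quadSum U ξ g X (a / q + β) - quadGauss U ξ q a / q * quadSum U ξ g X β‖ ≤
      g X * (2 + 2 * Real.pi * |β| * quadPoly U ξ X) * (2 * q) := by
  set u : ℕ → ℂ := fun x => addChar ((a : ℝ) / q * (quadPoly U ξ x : ℝ)) with hu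
  -- The phase splits into the periodic factor `u` and the slowly varying factor `H`. Replacing `u`
  -- by its mean costs the total variation of `H` times `2q`.
  set H : ℕ → ℂ := fun x => (g x : ℂ) * addChar (β * (quadPoly U ξ x : ℝ)) with hH
  have e : quadSum U ξ g X (a / q + β) - quadGauss U ξ q a / q * quadSum U ξ g X β =
      ∑ x ∈ Finset.range X, H x * (u x - (∑ y ∈ Finset.range q, u y) / q) := by
    simp only [quadSum, quadGauss, hu, hH, mul_sub, Finset.sum_sub_distrib]
    congr 1
    · refine Finset.sum_congr rfl fun x _ => ?_
      rw [add_mul, addChar_add]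
      ring
    · rw [Finset.mul_sum]
      exact Finset.sum_congr rfl fun x _ => by ring
  rw [e]
  refine norm_sum_mul_le_of_variation
    (fun m => norm_sum_sub_mean_le hq (addChar_div_mul_quadPoly_add U ξ hq a)
      (fun x => (norm_addChar _).le) m) ?_
  have hgX0 := hg0 X
  have hvar : ∀ i ∈ Finset.range (X - 1), ‖H (i + 1) - H i‖ ≤ (g (i + 1) - g i) +
      g X * (2 * Real.pi * |β|) * ((quadPoly U ξ (i + 1) : ℝ) - quadPoly U ξ i) := by
    intro i hi
    have hi' := Finset.mem_range.1 hi
    have hgi : g i ≤ g X := hg (by omega)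
    have e1 : H (i + 1) - H i = ((g (i + 1) - g i : ℝ) : ℂ) *
        addChar (β * (quadPoly U ξ (i + 1) : ℝ)) + (g i : ℂ) *
        (addChar (β * (quadPoly U ξ (i + 1) : ℝ)) - addChar (β * (quadPoly U ξ i : ℝ))) := by
      simp only [hH]
      push_cast
      ring
    have hP : (quadPoly U ξ i : ℝ) ≤ quadPoly U ξ (i + 1) := by
      exact_mod_cast quadPoly_mono U ξ (Nat.le_succ i)
    rw [e1]
    refine (norm_add_le _ _).trans ?_
    gcongr
    · rw [norm_mul, norm_addChar, mul_one, Complex.norm_real, Real.norm_of_nonneg]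
      have := hg (Nat.le_succ i)
      simp only [Nat.succ_eq_add_one] at this
      linarith
    · rw [norm_mul, Complex.norm_real, Real.norm_of_nonneg (hg0 i), mul_assoc]
      refine mul_le_mul hgi ?_ (norm_nonneg _) hgX0
      refine (norm_addChar_sub_addChar_le _ _).trans (le_of_eq ?_)
      rw [← mul_sub, abs_mul, abs_of_nonneg (by linarith : (0 : ℝ) ≤
        (quadPoly U ξ (i + 1) : ℝ) - quadPoly U ξ i)]
      ring
  have h1 : ‖H (X - 1)‖ ≤ g X := by
    simp only [hH]
    rw [norm_mul, norm_addChar, mul_one, Complex.norm_real, Real.norm_of_nonneg (hg0 _)]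
    exact hg (Nat.sub_le _ _)
  have h2 := Finset.sum_le_sum hvar
  rw [Finset.sum_add_distrib, ← Finset.mul_sum, Finset.sum_range_sub (fun i => g i),
    Finset.sum_range_sub (fun i => (quadPoly U ξ i : ℝ))] at h2
  have h3 : g (X - 1) ≤ g X := hg (Nat.sub_le _ _)
  have h4 : (quadPoly U ξ (X - 1) : ℝ) ≤ quadPoly U ξ X := by
    exact_mod_cast quadPoly_mono U ξ (Nat.sub_le X 1)
  have h5 : g X * (2 * Real.pi * |β|) * ((quadPoly U ξ (X - 1) : ℝ) - quadPoly U ξ 0) ≤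
      g X * (2 * Real.pi * |β|) * quadPoly U ξ X := by
    have : (0 : ℝ) ≤ quadPoly U ξ 0 := Nat.cast_nonneg _
    have h6 : 0 ≤ g X * (2 * Real.pi * |β|) := by have := Real.pi_pos; positivity
    exact mul_le_mul_of_nonneg_left (by linarith) h6
  have := hg0 0
  linarith

/-- A quadratic exponential sum with monotone weights is either small, or has a major arc
approximation. -/
theorem quadSum_dichotomy {U ξ X : ℕ} (hU : 1 ≤ U) (hξ : ξ ≤ 2 * U) (hX : 1 ≤ X)
    (hUX : (2 * U : ℝ) ≤ (X : ℝ) ^ (1 / 10 : ℝ)) {g : ℕ → ℝ} (hg : Monotone g)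
    (hg0 : ∀ x, 0 ≤ g x) (φ : ℝ) :
    ‖quadSum U ξ g X φ‖ ≤ 100 * g X * (X : ℝ) ^ (19 / 20 : ℝ) ∨
    ∃ (q : ℕ) (a : ℤ), 1 ≤ q ∧ IsCoprime a q ∧ (q : ℝ) ≤ (X : ℝ) ^ (1 / 5 : ℝ) ∧
      |φ - a / q| ≤ (X : ℝ) ^ (-(17 / 10) : ℝ) ∧
      ‖quadSum U ξ g X φ‖ ≤ 100 * g X * (X : ℝ) ^ (19 / 20 : ℝ) +
        ‖quadGauss U ξ q a‖ / q * ‖quadSum U ξ g X (φ - a / q)‖ := by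
  have hXpos : (0 : ℝ) < X := by exact_mod_cast hX
  have hX1 : (1 : ℝ) ≤ X := by exact_mod_cast hX
  have hU0 : (0 : ℝ) < U := by exact_mod_cast hU
  have hgX := hg0 X
  rcases weyl_dichotomy hX (φ * U) with h | ⟨r, hr1, hr2⟩
  · left
    have hpart : ∀ m ≤ X, ‖∑ x ∈ Finset.range m, addChar (φ * (quadPoly U ξ x : ℝ))‖ ≤
        9 * (X : ℝ) ^ (19 / 20 : ℝ) := by
      intro m hm
      have := h m hm (φ * ξ) 0
      convert this using 4
      simp only [quadPoly]
      push_cast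
      ring
    refine (norm_sum_mul_le_of_monotone hg hg0 hpart).trans ?_
    have : 0 ≤ g X * (X : ℝ) ^ (19 / 20 : ℝ) := by positivity
    linarith
  · right
    -- Weyl's inequality approximates `2Uφ`. Dividing by `2U` enlarges the denominator by at most
    -- `2U ≤ X^{1/10}`, whence the bound `X^{1/5}`.
    set r' : ℚ := r / (2 * U : ℕ) with hr'
    have hrr' : (r' : ℝ) = r / (2 * U) := by rw [hr']; push_cast; rfl
    have hden : r'.den ≤ 2 * U * r.den := by
      have h1 : r' = Rat.divInt r.num ((2 * U * r.den : ℕ) : ℤ) := by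
        rw [hr', Rat.divInt_eq_div]
        conv_lhs => rw [← Rat.num_div_den r]
        push_cast
        rw [div_div]
        ring
      have h2 : (r'.den : ℤ) ∣ ((2 * U * r.den : ℕ) : ℤ) := by
        rw [h1]; exact Rat.den_dvd _ _
      exact Nat.le_of_dvd (by have := r.den_pos; positivity) (Int.natCast_dvd_natCast.1 h2)
    set q := r'.den with hq
    set a := r'.num with ha
    have haq : (a : ℝ) / q = r' := by rw [hq, ha]; exact_mod_cast Rat.num_div_den r'
    have hq0 : 0 < q := r'.den_pos
    have hqX : (q : ℝ) ≤ (X : ℝ) ^ (1 / 5 : ℝ) := by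
      calc (q : ℝ) ≤ 2 * U * r.den := by exact_mod_cast hden
        _ ≤ (X : ℝ) ^ (1 / 10 : ℝ) * (X : ℝ) ^ (1 / 10 : ℝ) := by gcongr
        _ = _ := by rw [← Real.rpow_add hXpos]; norm_num
    have hβ : |φ - a / q| ≤ (X : ℝ) ^ (-(17 / 10) : ℝ) := by
      rw [haq, hrr']
      have e : φ - r / (2 * U) = (2 * (φ * U) - r) / (2 * U) := by field_simp
      rw [e, abs_div, abs_of_pos (show (0 : ℝ) < 2 * U by positivity),
        div_le_iff₀ (by positivity)]
      have : (1 : ℝ) ≤ 2 * U := by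
        have : (1 : ℝ) ≤ U := by exact_mod_cast hU
        linarith
      have h0 : 0 ≤ (X : ℝ) ^ (-(17 / 10) : ℝ) := by positivity
      nlinarith
    refine ⟨q, a, hq0, ?_, hqX, hβ, ?_⟩
    · rw [Int.isCoprime_iff_gcd_eq_one]
      exact r'.reduced
    have happ := norm_quadSum_sub_le U ξ hg hg0 X hq0 a (φ - a / q)
    rw [add_sub_cancel] at happ
    set β := φ - a / q with hβdef
    have hP : (quadPoly U ξ X : ℝ) ≤ 2 * (X : ℝ) ^ (21 / 10 : ℝ) := by
      have h1 : quadPoly U ξ X ≤ 2 * (2 * U) * X ^ 2 := by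
        simp only [quadPoly]
        nlinarith [Nat.mul_le_mul hξ hX, Nat.mul_le_mul_right X hξ,
          Nat.mul_le_mul_left (2 * U) (Nat.le_self_pow (two_ne_zero) X)]
      calc (quadPoly U ξ X : ℝ) ≤ 2 * (2 * U) * (X : ℝ) ^ 2 := by exact_mod_cast h1
        _ ≤ 2 * (X : ℝ) ^ (1 / 10 : ℝ) * (X : ℝ) ^ 2 := by gcongr
        _ = _ := by
            rw [← Real.rpow_natCast (X : ℝ) 2, mul_assoc, ← Real.rpow_add hXpos]
            norm_num
    have herr : g X * (2 + 2 * Real.pi * |β| * quadPoly U ξ X) * (2 * q) ≤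
        100 * g X * (X : ℝ) ^ (19 / 20 : ℝ) := by
      have h1 : |β| * quadPoly U ξ X ≤ 2 * (X : ℝ) ^ (4 / 10 : ℝ) := by
        calc |β| * quadPoly U ξ X
            ≤ (X : ℝ) ^ (-(17 / 10) : ℝ) * (2 * (X : ℝ) ^ (21 / 10 : ℝ)) := by gcongr
          _ = 2 * ((X : ℝ) ^ (-(17 / 10) : ℝ) * (X : ℝ) ^ (21 / 10 : ℝ)) := by ring
          _ = _ := by rw [← Real.rpow_add hXpos]; norm_num
      have h2 : (1 : ℝ) ≤ (X : ℝ) ^ (4 / 10 : ℝ) := Real.one_le_rpow hX1 (by norm_num)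
      have h3 : 2 + 2 * Real.pi * |β| * quadPoly U ξ X ≤ 18 * (X : ℝ) ^ (4 / 10 : ℝ) := by
        have h5 : 2 * Real.pi * |β| * quadPoly U ξ X = 2 * Real.pi * (|β| * quadPoly U ξ X) := by
          ring
        rw [h5]
        have h6 : 2 * Real.pi * (|β| * quadPoly U ξ X) ≤ 2 * 4 * (2 * (X : ℝ) ^ (4 / 10 : ℝ)) := by
          have := Real.pi_le_four
          gcongr
        linarith
      have h4 : (X : ℝ) ^ (4 / 10 : ℝ) * (X : ℝ) ^ (1 / 5 : ℝ) ≤ (X : ℝ) ^ (19 / 20 : ℝ) := by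
        rw [← Real.rpow_add hXpos]
        exact Real.rpow_le_rpow_of_exponent_le hX1 (by norm_num)
      calc g X * (2 + 2 * Real.pi * |β| * quadPoly U ξ X) * (2 * q)
          ≤ g X * (18 * (X : ℝ) ^ (4 / 10 : ℝ)) * (2 * (X : ℝ) ^ (1 / 5 : ℝ)) := by gcongr
        _ = 36 * g X * ((X : ℝ) ^ (4 / 10 : ℝ) * (X : ℝ) ^ (1 / 5 : ℝ)) := by ring
        _ ≤ 36 * g X * (X : ℝ) ^ (19 / 20 : ℝ) := by gcongr
        _ ≤ _ := by
            have : 0 ≤ g X * (X : ℝ) ^ (19 / 20 : ℝ) := by positivity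
            linarith
    have htri := norm_sub_norm_le (quadSum U ξ g X φ) (quadGauss U ξ q a / q * quadSum U ξ g X β)
    rw [norm_mul, norm_div, Complex.norm_natCast] at htri
    linarith

/-! ### Complete sums -/

/-- The solutions are multiples of `q / gcd(q, m)`. -/
theorem card_filter_dvd_mul_le {q m : ℕ} (hq : 0 < q) :
    ((Finset.range q).filter fun h => q ∣ m * h).card ≤ q.gcd m := by
  set d := q.gcd m with hd
  have hd0 : 0 < d := Nat.gcd_pos_of_pos_left _ hq
  obtain ⟨q', hq'⟩ := Nat.gcd_dvd_left q m
  rw [← hd] at hq'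
  have hq'0 : 0 < q' := Nat.pos_of_mul_pos_left (hq' ▸ hq)
  rw [← Finset.card_range d]
  refine Finset.card_le_card_of_injOn (fun h => h / q') ?_ ?_
  · intro h hh
    simp only [Finset.coe_filter, Set.mem_ofPred_eq, Finset.mem_range] at hh
    simp only [Finset.coe_range, Set.mem_Iio]
    rw [Nat.div_lt_iff_lt_mul hq'0, ← hq']
    exact hh.1
  · have hdvd : ∀ h, q ∣ m * h → q' ∣ h := by
      intro h hh
      have h1 : q / d ∣ m / d * h := by
        have := Nat.div_dvd_div (hd ▸ Nat.gcd_dvd_left q m) hh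
        rwa [Nat.mul_comm, Nat.mul_div_assoc _ (hd ▸ Nat.gcd_dvd_right q m), Nat.mul_comm] at this
      have h2 := (Nat.coprime_div_gcd_div_gcd (m := q) (n := m) hd0).dvd_of_dvd_mul_left h1
      have : q / d = q' := by rw [hq']; exact Nat.mul_div_cancel_left _ hd0
      rwa [← hd, this] at h2
    intro x hx y hy hxy
    simp only [Finset.coe_filter, Set.mem_ofPred_eq] at hx hy
    have h1 := Nat.div_mul_cancel (hdvd x hx.2)
    have h2 := Nat.div_mul_cancel (hdvd y hy.2)
    simp only at hxy
    rw [← h1, ← h2, hxy]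

/-- After squaring and shifting by `h`, the sum over `x` is a complete linear sum. It vanishes
unless `q ∣ 2Uh`, because `a` is invertible modulo `q`. -/
theorem norm_quadGauss_sq_le (U ξ : ℕ) {q : ℕ} (hq : 0 < q) {a : ℤ} (ha : IsCoprime a q) :
    ‖quadGauss U ξ q a‖ ^ 2 ≤ q * q.gcd (2 * U) := by
  set u : ℕ → ℂ := fun x => addChar ((a : ℝ) / q * (quadPoly U ξ x : ℝ)) with hu
  have hper : ∀ x, u (x + q) = u x := addChar_div_mul_quadPoly_add U ξ hq a
  have e : ((‖quadGauss U ξ q a‖ ^ 2 : ℝ) : ℂ) = ∑ h ∈ Finset.range q, u h *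
      ∑ x ∈ Finset.range q, addChar (((a * (2 * U * h) : ℤ) : ℝ) * (x / q)) := by
    push_cast
    rw [← Complex.conj_mul']
    have h1 : (starRingEnd ℂ) (quadGauss U ξ q a) * quadGauss U ξ q a =
        ∑ x ∈ Finset.range q, (starRingEnd ℂ) (u x) * ∑ h ∈ Finset.range q, u (x + h) := by
      simp_rw [sum_range_add_of_periodic hper]
      rw [← Finset.sum_mul, ← map_sum]
      rfl
    rw [h1]
    simp_rw [Finset.mul_sum]
    rw [Finset.sum_comm]
    refine Finset.sum_congr rfl fun h _ => Finset.sum_congr rfl fun x _ => ?_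
    simp only [hu]
    rw [conj_addChar, ← addChar_add, ← addChar_add, quadPoly_add]
    congr 1
    push_cast
    ring
  have h2 : ‖quadGauss U ξ q a‖ ^ 2 ≤ ∑ h ∈ Finset.range q, if q ∣ 2 * U * h then (q : ℝ) else 0 := by
    rw [← abs_of_nonneg (sq_nonneg ‖quadGauss U ξ q a‖), ← Real.norm_eq_abs, ← Complex.norm_real, e]
    refine (norm_sum_le _ _).trans (Finset.sum_le_sum fun h _ => ?_)
    rw [norm_mul, sum_range_addChar_mul_div hq]
    simp only [hu]
    rw [norm_addChar, one_mul]
    split_ifs with h3 h4 h4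
    · simp
    · exfalso
      apply h4
      have := ha.symm.dvd_of_dvd_mul_left h3
      exact_mod_cast this
    · simp
    · simp
  refine h2.trans ?_
  rw [← Finset.sum_filter, Finset.sum_const, nsmul_eq_mul, mul_comm]
  gcongr
  exact card_filter_dvd_mul_le hq

/-- Shifting `x` by `s = q / l` changes the phase by `a (2Ux + Us + ξ) / l`, which is `aξ/l` modulo
one since `l` divides both `2U` and `Us`. The sum is thus invariant under multiplication by
`e(aξ/l)`, and this is not `1` because `l` divides neither `a` nor `ξ`. -/
theorem quadGauss_eq_zero {U ξ q l : ℕ} (hq : 0 < q) {a : ℤ} (ha : IsCoprime a q)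
    (hξ : Nat.Coprime ξ (2 * U)) (hl : l.Prime) (hlq : l ∣ q) (hlU : l ∣ 2 * U)
    (h : l ∣ U ∨ l * l ∣ q) : quadGauss U ξ q a = 0 := by
  set u : ℕ → ℂ := fun x => addChar ((a : ℝ) / q * (quadPoly U ξ x : ℝ)) with hu
  have hper : ∀ x, u (x + q) = u x := addChar_div_mul_quadPoly_add U ξ hq a
  obtain ⟨s, hs⟩ := hlq
  obtain ⟨k, hk⟩ := hlU
  have hl0 : (l : ℝ) ≠ 0 := by exact_mod_cast hl.ne_zero
  have hs0 : s ≠ 0 := by rintro rfl; simp at hs; omega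
  have hs0' : (s : ℝ) ≠ 0 := by exact_mod_cast hs0
  have hUs : l ∣ U * s := by
    rcases h with h | h
    · exact h.mul_right _
    · rw [hs] at h
      exact (Nat.dvd_of_mul_dvd_mul_left hl.pos h).mul_left _
  obtain ⟨m, hm⟩ := hUs
  have hshift : ∀ x, u (s + x) = addChar ((a * ξ : ℤ) / l) * u x := by
    intro x
    simp only [hu]
    rw [← addChar_add, ← addChar_add_intCast _ (-(a * (k * x + m)))]
    congr 1
    have hk' : (2 * U : ℝ) = l * k := by exact_mod_cast hk
    have hm' : (U * s : ℝ) = l * m := by exact_mod_cast hm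
    have hs' : (q : ℝ) = l * s := by exact_mod_cast hs
    rw [add_comm s x, quadPoly_add]
    have hP : (quadPoly U ξ s : ℝ) = s * (l * m) + ξ * s := by
      simp only [quadPoly]
      push_cast
      rw [← hm']
      ring
    push_cast
    rw [hP, hs', hk']
    field_simp
    ring
  have hG : quadGauss U ξ q a = addChar ((a * ξ : ℤ) / l) * quadGauss U ξ q a := by
    have h1 := sum_range_add_of_periodic hper s
    simp_rw [hshift] at h1
    rw [← Finset.mul_sum] at h1
    exact h1.symm
  have hne : addChar ((a * ξ : ℤ) / l) ≠ 1 := by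
    intro h1
    have h2 := four_mul_abs_sub_round_le (((a * ξ : ℤ) : ℝ) / l)
    rw [h1, sub_self, norm_zero] at h2
    have h3 : ((a * ξ : ℤ) : ℝ) / l - round (((a * ξ : ℤ) : ℝ) / l) = 0 := by
      have := abs_nonneg (((a * ξ : ℤ) : ℝ) / l - round (((a * ξ : ℤ) : ℝ) / l))
      exact abs_eq_zero.1 (by linarith)
    rw [sub_eq_zero, div_eq_iff hl0] at h3
    obtain ⟨R, hR⟩ : ∃ R : ℤ, ((a * ξ : ℤ) : ℝ) = R * l := ⟨_, h3⟩
    have h4 : (l : ℤ) ∣ a * ξ := ⟨R, by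
      have : ((a * ξ : ℤ) : ℝ) = ((l * R : ℤ) : ℝ) := by rw [hR]; push_cast; ring
      exact_mod_cast this⟩
    have hlp : Prime (l : ℤ) := Nat.prime_iff_prime_int.1 hl
    rcases hlp.dvd_or_dvd h4 with h5 | h5
    · have h6 : (l : ℤ) ∣ (q : ℤ) := by rw [hs]; push_cast; exact dvd_mul_right _ _
      exact hlp.not_isUnit (ha.isUnit_of_dvd' h5 h6)
    · have h5' : l ∣ ξ := by exact_mod_cast h5
      have h6 : l ∣ 2 * U := ⟨k, hk⟩
      have := Nat.dvd_gcd h5' h6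
      rw [hξ] at this
      exact hl.one_lt.ne' (Nat.dvd_one.1 this)
  have h1 : (1 - addChar ((a * ξ : ℤ) / l)) * quadGauss U ξ q a = 0 := by
    rw [sub_mul, one_mul, ← hG, sub_self]
  rcases mul_eq_zero.1 h1 with h2 | h2
  · exact absurd (sub_eq_zero.1 h2).symm hne
  · exact h2

theorem le_two_of_prime_dvd {m : ℕ} (hm : m ≠ 0) (h : ∀ l, l.Prime → l ∣ m → l = 2)
    (h4 : ¬4 ∣ m) : m ≤ 2 := by
  have h1 := Nat.eq_prime_pow_of_unique_prime_dvd hm (fun {d} => h d)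
  set n := m.primeFactorsList.length
  by_contra hcon
  apply h4
  have hn : 2 ≤ n := by
    by_contra hn
    have : n = 0 ∨ n = 1 := by omega
    rcases this with h0 | h0 <;> rw [h0] at h1 <;> omega
  rw [h1]
  exact pow_dvd_pow 2 hn

/-- A nonvanishing complete sum has a modulus almost coprime to `2U`. -/
theorem gcd_le_two_of_quadGauss_ne_zero {U ξ q V : ℕ} (hq : 0 < q) {a : ℤ} (ha : IsCoprime a q)
    (hξ : Nat.Coprime ξ (2 * U)) (hV : ∀ l, l.Prime → l ∣ V → l ∣ 2 * U)
    (hG : quadGauss U ξ q a ≠ 0) : q.gcd V ≤ 2 := by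
  -- By the vanishing lemma a common prime of `q` and `2U` divides `U` never and `q` only once, so
  -- it is `2`.
  have key : ∀ l, l.Prime → l ∣ q → l ∣ 2 * U → l = 2 ∧ ¬4 ∣ q := by
    intro l hl hlq hlU
    have h1 : ¬l ∣ U := fun h => hG (quadGauss_eq_zero hq ha hξ hl hlq hlU (Or.inl h))
    have h2 : ¬l * l ∣ q := fun h => hG (quadGauss_eq_zero hq ha hξ hl hlq hlU (Or.inr h))
    have h3 : l = 2 := by
      rcases (hl.dvd_mul).1 hlU with h | h
      · exact (Nat.prime_dvd_prime_iff_eq hl Nat.prime_two).1 h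
      · exact absurd h h1
    subst h3
    exact ⟨rfl, h2⟩
  refine le_two_of_prime_dvd (Nat.gcd_pos_of_pos_left _ hq).ne' ?_ ?_
  · intro l hl hlg
    exact (key l hl (hlg.trans (Nat.gcd_dvd_left _ _)) (hV l hl (hlg.trans
      (Nat.gcd_dvd_right _ _)))).1
  · intro h4
    have h2 : 2 ∣ q.gcd V := Dvd.dvd.trans (by norm_num) h4
    exact (key 2 Nat.prime_two (h2.trans (Nat.gcd_dvd_left _ _)) (hV 2 Nat.prime_two (h2.trans
      (Nat.gcd_dvd_right _ _)))).2 (h4.trans (Nat.gcd_dvd_left _ _))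

/-! ### Sums near zero frequency -/

/-- Telescoping bound for a sum weighted by the derivative of the phase. -/
theorem abs_mul_norm_sum_deriv_le {U ξ X : ℕ} (hX : 1 ≤ X) (hU : 1 ≤ U) (hξ : ξ ≤ 2 * U) {β : ℝ}
    (hβ : X * (2 * Real.pi * |β| * (5 * U * X)) ^ 2 ≤ 1 / 2) {y n : ℕ} (hyn : y + n ≤ X) :
    ‖∑ x ∈ Finset.range n, ((2 * U * (y + x : ℕ) + ξ : ℝ) : ℂ) *
      addChar (β * (quadPoly U ξ (y + x) : ℝ))‖ * |β| ≤ 1 := by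
  set b := 2 * Real.pi * |β| with hb
  have hb0 : 0 ≤ b := by have := Real.pi_pos; positivity
  have hX1 : (1 : ℝ) ≤ X := by exact_mod_cast hX
  have hU1 : (1 : ℝ) ≤ U := by exact_mod_cast hU
  have hξ' : (ξ : ℝ) ≤ 2 * U := by exact_mod_cast hξ
  set τ := b * (5 * U * X) with hτ
  have hτ0 : 0 ≤ τ := by positivity
  have hτ1 : τ ≤ 1 := by nlinarith
  set D : ℕ → ℂ := fun x => addChar (β * (quadPoly U ξ (y + x) : ℝ)) with hD
  have hbU : X * (b * U) ≤ 1 / 5 := by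
    have : τ = 5 * (X * (b * U)) := by rw [hτ]; ring
    linarith
  -- The derivative of the phase times `D x` is close to the increment of `D`. The linear error is
  -- `b U`, the Taylor error `τ²`; over at most `X` terms they sum to at most `1/5 + 1/2`.
  have hterm : ∀ x ∈ Finset.range n,
      ‖(2 * Real.pi * β * Complex.I) * (((2 * U * (y + x : ℕ) + ξ : ℝ) : ℂ) * D x) -
        (D (x + 1) - D x)‖ ≤ b * U + τ ^ 2 := by
    intro x hx
    have hx' := Finset.mem_range.1 hx
    -- The exact increment of the polynomial. It exceeds its derivative `2U(y + x) + ξ` by `U`.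
    set Δ : ℝ := 2 * U * (y + x : ℕ) + ξ + U with hΔ
    have hyx : ((y + x : ℕ) : ℝ) ≤ X := by
      have : y + x ≤ X := by omega
      exact_mod_cast this
    have hΔ0 : 0 ≤ Δ := by positivity
    have hΔX : Δ ≤ 5 * U * X := by
      rw [hΔ]
      nlinarith
    have hβΔ : 2 * Real.pi * |β * Δ| ≤ τ := by
      rw [abs_mul, abs_of_nonneg hΔ0, ← mul_assoc, hτ]
      gcongr
    have hstep : D (x + 1) = D x * addChar (β * Δ) := by
      simp only [hD]
      rw [← addChar_add, ← add_assoc, quadPoly_add]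
      congr 1
      simp only [quadPoly, hΔ]
      push_cast
      ring
    have e : (2 * Real.pi * β * Complex.I) * (((2 * U * (y + x : ℕ) + ξ : ℝ) : ℂ) * D x) -
        (D (x + 1) - D x) = -(D x * (2 * Real.pi * β * U * Complex.I)) -
        D x * (addChar (β * Δ) - 1 - 2 * Real.pi * ((β * Δ : ℝ) : ℂ) * Complex.I) := by
      rw [hstep, hΔ]
      push_cast
      ring
    rw [e]
    refine (norm_sub_le _ _).trans ?_
    have hDn : ‖D x‖ = 1 := norm_addChar _
    have h1 := norm_addChar_sub_one_sub_le (hβΔ.trans hτ1)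
    rw [norm_neg, norm_mul (D x), norm_mul (D x), hDn, one_mul, one_mul]
    gcongr
    · rw [norm_mul, norm_mul, norm_mul, norm_mul, Complex.norm_I, Complex.norm_real,
        Complex.norm_real, Complex.norm_natCast, Real.norm_eq_abs, Real.norm_eq_abs,
        abs_of_pos Real.pi_pos, hb]
      simp
    · exact h1.trans (by gcongr)
  have htel : ∑ x ∈ Finset.range n, (D (x + 1) - D x) = D n - D 0 := Finset.sum_range_sub _ _
  have hDn : ∀ x, ‖D x‖ = 1 := fun x => norm_addChar _
  have h1 : ‖(2 * Real.pi * β * Complex.I) * (∑ x ∈ Finset.range n,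
      ((2 * U * (y + x : ℕ) + ξ : ℝ) : ℂ) * D x) - (D n - D 0)‖ ≤ n * (b * U + τ ^ 2) := by
    rw [← htel, Finset.mul_sum, ← Finset.sum_sub_distrib]
    refine (norm_sum_le _ _).trans ((Finset.sum_le_sum hterm).trans ?_)
    rw [Finset.sum_const, Finset.card_range, nsmul_eq_mul]
  have hn : (n : ℝ) ≤ X := by
    have : n ≤ X := by omega
    exact_mod_cast this
  have h2 : (n : ℝ) * (b * U + τ ^ 2) ≤ 1 := by
    calc (n : ℝ) * (b * U + τ ^ 2) ≤ X * (b * U + τ ^ 2) := by gcongr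
      _ = X * (b * U) + X * τ ^ 2 := by ring
      _ ≤ 1 := by linarith
  have h3 : ‖D n - D 0‖ ≤ 2 := (norm_sub_le _ _).trans (by rw [hDn, hDn]; norm_num)
  have h4 := norm_sub_norm_le ((2 * Real.pi * β * Complex.I) * (∑ x ∈ Finset.range n,
      ((2 * U * (y + x : ℕ) + ξ : ℝ) : ℂ) * D x)) (D n - D 0)
  have h5 : ‖(2 * Real.pi * β * Complex.I : ℂ)‖ = b := by
    rw [norm_mul, norm_mul, norm_mul, Complex.norm_I, Complex.norm_real, Complex.norm_real,
      Real.norm_eq_abs, Real.norm_eq_abs, abs_of_pos Real.pi_pos, hb]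
    simp
  rw [norm_mul, h5] at h4
  have h6 : b * ‖∑ x ∈ Finset.range n, ((2 * U * (y + x : ℕ) + ξ : ℝ) : ℂ) * D x‖ ≤ 3 := by
    linarith
  rw [hb] at h6
  have hpi := Real.pi_gt_three
  have h7 : 0 ≤ |β| * ‖∑ x ∈ Finset.range n, ((2 * U * (y + x : ℕ) + ξ : ℝ) : ℂ) * D x‖ := by
    positivity
  rw [mul_comm]
  nlinarith

/-! ### The majorant for squares -/

/-- The largest `x` with `U x² + ξ x ≤ N`. -/
def lastRoot (U ξ N : ℕ) : ℕ := Nat.findGreatest (fun x => quadPoly U ξ x ≤ N) N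

/-- The weight `2 U x + ξ`, removed at the origin. -/
noncomputable def derivWeight (U ξ : ℕ) (x : ℕ) : ℝ := if x = 0 then 0 else 2 * U * x + ξ

theorem quadPoly_lastRoot_le (U ξ N : ℕ) : quadPoly U ξ (lastRoot U ξ N) ≤ N :=
  Nat.findGreatest_spec (P := fun x => quadPoly U ξ x ≤ N) (Nat.zero_le N) (by simp [quadPoly])

theorem le_quadPoly {U : ℕ} (hU : 1 ≤ U) (ξ x : ℕ) : x ≤ quadPoly U ξ x := by
  simp only [quadPoly]
  nlinarith [Nat.le_self_pow (two_ne_zero) x, Nat.mul_le_mul_right (x ^ 2) hU]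

theorem le_lastRoot_iff {U : ℕ} (hU : 1 ≤ U) (ξ N x : ℕ) :
    x ≤ lastRoot U ξ N ↔ quadPoly U ξ x ≤ N := by
  constructor
  · intro h
    exact (quadPoly_mono U ξ h).trans (quadPoly_lastRoot_le U ξ N)
  · intro h
    exact Nat.le_findGreatest ((le_quadPoly hU ξ x).trans h) h

theorem quadPoly_strictMono {U : ℕ} (hU : 1 ≤ U) (ξ : ℕ) : StrictMono (quadPoly U ξ) := by
  intro x y h
  simp only [quadPoly]
  have h1 : x ^ 2 < y ^ 2 := Nat.pow_lt_pow_left h two_ne_zero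
  have h2 : ξ * x ≤ ξ * y := Nat.mul_le_mul_left ξ h.le
  have h3 : U * x ^ 2 < U * y ^ 2 := Nat.mul_lt_mul_of_pos_left h1 hU
  omega

/-- With `W = 2U` the number `((Wx + ξ)² - ξ²) / (2W)` is `U x² + ξ x`. -/
theorem squareMajorant_quadPoly {U ξ N x : ℕ} (hx : 1 ≤ quadPoly U ξ x)
    (hN : quadPoly U ξ x ≤ N) :
    squareMajorant N (2 * U) ξ (quadPoly U ξ x) = 2 * U * x + ξ := by
  have := squareMajorant_eq (N := N) (W := 2 * U) (ξ := ξ) (n := (quadPoly U ξ x : ℤ))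
    (x := (x : ℤ)) ⟨by exact_mod_cast hx, by exact_mod_cast hN⟩ (by positivity) (by
      simp only [quadPoly]
      push_cast
      ring)
  rw [this]
  push_cast
  ring

theorem squareMajorant_eq_zero {U ξ N : ℕ} (hU : 1 ≤ U) (hξ : ξ ≤ 2 * U) {n : ℤ} (hn : 1 ≤ n)
    (h : ∀ x : ℕ, (quadPoly U ξ x : ℤ) ≠ n) : squareMajorant N (2 * U) ξ n = 0 := by
  unfold squareMajorant
  rw [dif_neg]
  rintro ⟨_, x, hx0, hx⟩
  have hU' : (0 : ℤ) < U := by exact_mod_cast hU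
  have hξ' : (ξ : ℤ) ≤ 2 * U := by exact_mod_cast hξ
  push_cast at hx0 hx
  have hn' : n = U * x ^ 2 + ξ * x := by
    have h1 : 4 * (U : ℤ) * n = 4 * U * (U * x ^ 2 + ξ * x) := by linarith
    exact mul_left_cancel₀ (by positivity) h1
  rcases le_or_gt 0 x with hx1 | hx1
  · apply h x.toNat
    rw [hn']
    simp only [quadPoly]
    push_cast
    rw [Int.toNat_of_nonneg hx1]
  -- If `x < 0` and `2Ux + ξ ≥ 0`, then `Ux + ξ > 0`, so `n = x (Ux + ξ)` is negative.
  · nlinarith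

theorem squareMajorant_nonneg {U ξ N : ℕ} (hU : 1 ≤ U) (hξ : ξ ≤ 2 * U) (n : ℤ) :
    0 ≤ squareMajorant N (2 * U) ξ n := by
  by_cases hn : n ∈ initialInterval N
  · by_cases h : ∀ x : ℕ, (quadPoly U ξ x : ℤ) ≠ n
    · exact (squareMajorant_eq_zero hU hξ hn.1 h).ge
    · push Not at h
      obtain ⟨x, rfl⟩ := h
      rw [squareMajorant_quadPoly (by exact_mod_cast hn.1) (by exact_mod_cast hn.2)]
      positivity
  · unfold squareMajorant
    rw [dif_neg (fun h => hn h.1)]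

/-- Reparametrisation by `x`. The point `x = 0` gives `n = 0`, outside `[N]`, which is why
`derivWeight` vanishes there. -/
theorem sum_squareMajorant_mul {U ξ : ℕ} (hU : 1 ≤ U) (hξ : ξ ≤ 2 * U) (N : ℕ) (h : ℤ → ℂ) :
    ∑ n ∈ Finset.Icc (1 : ℤ) N, (squareMajorant N (2 * U) ξ n : ℂ) * h n =
      ∑ x ∈ Finset.range (lastRoot U ξ N + 1), (derivWeight U ξ x : ℂ) * h (quadPoly U ξ x) := by
  have h0 : ∑ x ∈ Finset.range (lastRoot U ξ N + 1),
      (derivWeight U ξ x : ℂ) * h (quadPoly U ξ x) =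
      ∑ x ∈ Finset.Icc 1 (lastRoot U ξ N), (derivWeight U ξ x : ℂ) * h (quadPoly U ξ x) := by
    symm
    refine Finset.sum_subset ?_ ?_
    · intro x hx
      rw [Finset.mem_Icc] at hx
      exact Finset.mem_range.2 (by omega)
    · intro x hx hx'
      rw [Finset.mem_range] at hx
      rw [Finset.mem_Icc] at hx'
      have : x = 0 := by omega
      simp [this, derivWeight]
  rw [h0]
  have hinj : Set.InjOn (fun x : ℕ => (quadPoly U ξ x : ℤ)) (Finset.Icc 1 (lastRoot U ξ N)) := by
    intro x _ y _ hxy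
    simp only at hxy
    exact (quadPoly_strictMono hU ξ).injective (by exact_mod_cast hxy)
  have hmem : ∀ x ∈ Finset.Icc 1 (lastRoot U ξ N), 1 ≤ quadPoly U ξ x ∧ quadPoly U ξ x ≤ N := by
    intro x hx
    rw [Finset.mem_Icc] at hx
    exact ⟨hx.1.trans (le_quadPoly hU ξ x), (le_lastRoot_iff hU ξ N x).1 hx.2⟩
  have h1 : ∑ x ∈ Finset.Icc 1 (lastRoot U ξ N), (derivWeight U ξ x : ℂ) * h (quadPoly U ξ x) =
      ∑ n ∈ (Finset.Icc 1 (lastRoot U ξ N)).image (fun x : ℕ => (quadPoly U ξ x : ℤ)),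
        (squareMajorant N (2 * U) ξ n : ℂ) * h n := by
    rw [Finset.sum_image hinj]
    refine Finset.sum_congr rfl fun x hx => ?_
    rw [squareMajorant_quadPoly (hmem x hx).1 (hmem x hx).2, derivWeight, if_neg]
    have := (Finset.mem_Icc.1 hx).1
    omega
  rw [h1]
  symm
  refine Finset.sum_subset ?_ ?_
  · intro n hn
    obtain ⟨x, hx, rfl⟩ := Finset.mem_image.1 hn
    have := hmem x hx
    rw [Finset.mem_Icc]
    omega
  · intro n hn hn'
    rw [Finset.mem_Icc] at hn
    rw [squareMajorant_eq_zero hU hξ hn.1, Complex.ofReal_zero, zero_mul]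
    rintro x rfl
    apply hn'
    refine Finset.mem_image.2 ⟨x, ?_, rfl⟩
    rw [Finset.mem_Icc, le_lastRoot_iff hU]
    refine ⟨?_, by exact_mod_cast hn.2⟩
    rcases Nat.eq_zero_or_pos x with rfl | h
    · simp [quadPoly] at hn
    · exact h

theorem derivWeight_nonneg (U ξ x : ℕ) : 0 ≤ derivWeight U ξ x := by
  unfold derivWeight
  split_ifs <;> positivity

theorem derivWeight_mono (U ξ : ℕ) : Monotone (derivWeight U ξ) := by
  intro x y h
  unfold derivWeight
  split_ifs with h1 h2
  · rfl
  · positivity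
  · omega
  · gcongr

/-- Sizes of the parameters of the majorant. -/
theorem lastRoot_bounds {U ξ N : ℕ} (hU : 1 ≤ U) (hξ : ξ ≤ 2 * U) (hN : (500 * U) ^ 25 ≤ N) :
    (500 * U : ℝ) ≤ (N : ℝ) ^ (1 / 25 : ℝ) ∧
    (N : ℝ) ^ (2 / 5 : ℝ) ≤ (lastRoot U ξ N + 1 : ℕ) ∧
    ((lastRoot U ξ N + 1 : ℕ) : ℝ) ≤ 2 * (N : ℝ) ^ (1 / 2 : ℝ) ∧
    derivWeight U ξ (lastRoot U ξ N + 1) * (lastRoot U ξ N + 1 : ℕ) ≤ 16 * N := by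
  have hU1 : (1 : ℝ) ≤ U := by exact_mod_cast hU
  have hξ' : (ξ : ℝ) ≤ 2 * U := by exact_mod_cast hξ
  have hNr : ((500 * U : ℝ)) ^ 25 ≤ N := by exact_mod_cast hN
  have hN1 : (1 : ℝ) ≤ N := le_trans (one_le_pow₀ (by linarith)) hNr
  have hNpos : (0 : ℝ) < N := by linarith
  have h1 : (500 * U : ℝ) ≤ (N : ℝ) ^ (1 / 25 : ℝ) := by
    have := Real.rpow_le_rpow (by positivity) hNr (show (0 : ℝ) ≤ 1 / 25 by norm_num)
    rwa [← Real.rpow_natCast, ← Real.rpow_mul (by positivity), show ((25 : ℕ) : ℝ) * (1 / 25) = 1 by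
      norm_num, Real.rpow_one] at this
  set Y := lastRoot U ξ N with hY
  have hYN : quadPoly U ξ Y ≤ N := quadPoly_lastRoot_le U ξ N
  have hYN' : N < quadPoly U ξ (Y + 1) := by
    by_contra hcon
    have := (le_lastRoot_iff hU ξ N (Y + 1)).2 (not_lt.1 hcon)
    omega
  have hYN2 : U * (Y : ℝ) ^ 2 ≤ N := by
    have : U * Y ^ 2 ≤ N := le_trans (Nat.le_add_right _ _) hYN
    exact_mod_cast this
  have hN3 : (N : ℝ) ≤ 3 * U * ((Y + 1 : ℕ) : ℝ) ^ 2 := by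
    have : (N : ℝ) ≤ U * ((Y + 1 : ℕ) : ℝ) ^ 2 + ξ * ((Y + 1 : ℕ) : ℝ) := by
      exact_mod_cast hYN'.le
    have h2 : (1 : ℝ) ≤ ((Y + 1 : ℕ) : ℝ) := by push_cast; linarith [(Nat.cast_nonneg Y : (0:ℝ) ≤ Y)]
    have h3 : (ξ : ℝ) * ((Y + 1 : ℕ) : ℝ) ≤ 2 * U * ((Y + 1 : ℕ) : ℝ) ^ 2 := by
      rw [sq, ← mul_assoc]
      have : (ξ : ℝ) ≤ 2 * U * ((Y + 1 : ℕ) : ℝ) := by nlinarith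
      gcongr
    linarith
  have h2 : (N : ℝ) ^ (2 / 5 : ℝ) ≤ ((Y + 1 : ℕ) : ℝ) := by
    refine abs_le_of_sq_le_sq' ?_ (Nat.cast_nonneg _) |>.2
    have e1 : ((N : ℝ) ^ (2 / 5 : ℝ)) ^ 2 = (N : ℝ) ^ (4 / 5 : ℝ) := by
      rw [← Real.rpow_natCast, ← Real.rpow_mul hNpos.le]
      norm_num
    have e2 : (N : ℝ) ^ (4 / 5 : ℝ) * (N : ℝ) ^ (1 / 5 : ℝ) = N := by
      rw [← Real.rpow_add hNpos]
      norm_num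
    have e3 : (N : ℝ) ^ (1 / 25 : ℝ) ≤ (N : ℝ) ^ (1 / 5 : ℝ) :=
      Real.rpow_le_rpow_of_exponent_le hN1 (by norm_num)
    rw [e1]
    have e4 : 3 * (U : ℝ) ≤ (N : ℝ) ^ (1 / 5 : ℝ) := by linarith
    have e5 : (N : ℝ) ^ (4 / 5 : ℝ) * (3 * U) ≤ ((Y + 1 : ℕ) : ℝ) ^ 2 * (3 * U) := by
      calc (N : ℝ) ^ (4 / 5 : ℝ) * (3 * U) ≤ (N : ℝ) ^ (4 / 5 : ℝ) * (N : ℝ) ^ (1 / 5 : ℝ) := by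
            gcongr
        _ ≤ _ := by rw [e2]; linarith
    exact le_of_mul_le_mul_right e5 (by positivity)
  have hY1 : 1 ≤ Y := by
    by_contra hcon
    have hY0 : Y = 0 := by omega
    rw [hY0] at h2
    have : (N : ℝ) ^ (1 / 25 : ℝ) ≤ (N : ℝ) ^ (2 / 5 : ℝ) :=
      Real.rpow_le_rpow_of_exponent_le hN1 (by norm_num)
    norm_num at h2
    linarith
  have hY1' : (1 : ℝ) ≤ Y := by exact_mod_cast hY1
  have hY2 : ((Y + 1 : ℕ) : ℝ) ≤ 2 * Y := by push_cast; linarith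
  refine ⟨h1, h2, hY2.trans ?_, ?_⟩
  · have : (Y : ℝ) ≤ (N : ℝ) ^ (1 / 2 : ℝ) := by
      rw [← Real.sqrt_eq_rpow]
      refine Real.le_sqrt_of_sq_le ?_
      nlinarith
    linarith
  · rw [derivWeight, if_neg (by omega)]
    have h3 : 2 * U * ((Y + 1 : ℕ) : ℝ) + ξ ≤ 8 * U * Y := by nlinarith
    calc (2 * U * ((Y + 1 : ℕ) : ℝ) + ξ) * ((Y + 1 : ℕ) : ℝ) ≤ (8 * U * Y) * (2 * Y) := by gcongr
      _ = 16 * (U * (Y : ℝ) ^ 2) := by ring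
      _ ≤ _ := by gcongr

/-- The smallness of the frequency which the telescoping bound requires. -/
theorem mul_sq_le_half {U X : ℕ} (hX : 1 ≤ X) (hUX : (2 * U : ℝ) ≤ (X : ℝ) ^ (1 / 10 : ℝ))
    (hX2 : (500 : ℝ) ≤ (X : ℝ) ^ (1 / 5 : ℝ)) {β : ℝ}
    (hβ : |β| ≤ (X : ℝ) ^ (-(17 / 10) : ℝ)) :
    X * (2 * Real.pi * |β| * (5 * U * X)) ^ 2 ≤ 1 / 2 := by
  have hXpos : (0 : ℝ) < X := by exact_mod_cast hX
  have h1 : 2 * Real.pi * |β| * (5 * U * X) ≤ 5 * Real.pi * (X : ℝ) ^ (-(6 / 10) : ℝ) := by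
    calc 2 * Real.pi * |β| * (5 * U * X) = 5 * Real.pi * (|β| * (2 * U) * X) := by ring
      _ ≤ 5 * Real.pi * ((X : ℝ) ^ (-(17 / 10) : ℝ) * (X : ℝ) ^ (1 / 10 : ℝ) * X) := by
          have := Real.pi_pos
          gcongr
      _ = _ := by
          rw [← Real.rpow_add hXpos, ← Real.rpow_add_one hXpos.ne']
          norm_num
  have h0 : 0 ≤ 2 * Real.pi * |β| * (5 * U * X) := by have := Real.pi_pos; positivity
  have h2 : (X : ℝ) * ((X : ℝ) ^ (-(6 / 10) : ℝ)) ^ 2 = ((X : ℝ) ^ (1 / 5 : ℝ))⁻¹ := by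
    rw [← Real.rpow_natCast, ← Real.rpow_mul hXpos.le, ← Real.rpow_one_add' hXpos.le (by norm_num),
      ← Real.rpow_neg hXpos.le]
    norm_num
  have h3 : ((X : ℝ) ^ (1 / 5 : ℝ))⁻¹ ≤ 1 / 500 := by
    rw [one_div (500 : ℝ)]
    exact inv_anti₀ (by norm_num) hX2
  have hpi : Real.pi ^ 2 ≤ 10 := by nlinarith [Real.pi_lt_d2, Real.pi_pos]
  calc (X : ℝ) * (2 * Real.pi * |β| * (5 * U * X)) ^ 2
      ≤ X * (5 * Real.pi * (X : ℝ) ^ (-(6 / 10) : ℝ)) ^ 2 := by gcongr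
    _ = 25 * Real.pi ^ 2 * (X * ((X : ℝ) ^ (-(6 / 10) : ℝ)) ^ 2) := by ring
    _ ≤ 25 * 10 * (1 / 500) := by rw [h2]; gcongr
    _ = 1 / 2 := by norm_num

theorem norm_quadGauss_div_le {U ξ q : ℕ} (hq : 1 ≤ q) {a : ℤ} (ha : IsCoprime a q)
    (hg : q.gcd (2 * U) ≤ 2) :
    ‖quadGauss U ξ q a‖ / q ≤ 2 * (q : ℝ) ^ (-(1 / 2) : ℝ) := by
  have hq0 : (0 : ℝ) < q := by exact_mod_cast hq
  have h1 := norm_quadGauss_sq_le U ξ hq ha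
  have h2 : ((q.gcd (2 * U) : ℕ) : ℝ) ≤ 2 := by exact_mod_cast hg
  have h3 : ‖quadGauss U ξ q a‖ ≤ 2 * (q : ℝ) ^ (1 / 2 : ℝ) := by
    refine abs_le_of_sq_le_sq' ?_ (by positivity) |>.2
    have : (2 * (q : ℝ) ^ (1 / 2 : ℝ)) ^ 2 = 4 * q := by
      rw [mul_pow, ← Real.rpow_natCast ((q : ℝ) ^ _), ← Real.rpow_mul hq0.le]
      norm_num
    rw [this]
    nlinarith
  rw [div_le_iff₀ hq0]
  refine h3.trans (le_of_eq ?_)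
  rw [mul_assoc, ← Real.rpow_add_one hq0.ne']
  norm_num

theorem min_le_mul_inv_one_add {S N b : ℝ} (hN : 0 < N) (hb : 0 ≤ b) (h1 : S ≤ 16 * N)
    (h2 : S * b ≤ 1) : S ≤ 17 * N * (1 + N * b)⁻¹ := by
  rw [← div_eq_mul_inv, le_div_iff₀ (by positivity)]
  nlinarith

/-- The exponential sum of the majorant is concentrated on major arcs whose denominators are
almost coprime to `W = 2U`. -/
theorem norm_quadSum_derivWeight_dichotomy {U ξ N : ℕ} (hU : 1 ≤ U) (hξ : ξ ≤ 2 * U)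
    (hco : Nat.Coprime ξ (2 * U)) (hN : (500 * U) ^ 25 ≤ N) (φ : ℝ) :
    ‖quadSum U ξ (derivWeight U ξ) (lastRoot U ξ N + 1) φ‖ ≤ 3200 * (N : ℝ) ^ (49 / 50 : ℝ) ∨
    ∃ (q : ℕ) (a : ℤ), 1 ≤ q ∧ IsCoprime a q ∧ (q : ℝ) ≤ 2 * (N : ℝ) ^ (1 / 10 : ℝ) ∧
      |φ - a / q| ≤ (N : ℝ) ^ (-(17 / 25) : ℝ) ∧
      (∀ V : ℕ, (∀ l, l.Prime → l ∣ V → l ∣ 2 * U) → q.gcd V ≤ 2) ∧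
      ‖quadSum U ξ (derivWeight U ξ) (lastRoot U ξ N + 1) φ‖ ≤
        68 * N * ((q : ℝ) ^ (-(1 / 2) : ℝ) * (1 + N * |φ - a / q|)⁻¹) := by
  obtain ⟨b1, b2, b3, b4⟩ := lastRoot_bounds hU hξ hN
  set X := lastRoot U ξ N + 1 with hXdef
  have hX : 1 ≤ X := by omega
  have hX1 : (1 : ℝ) ≤ X := by exact_mod_cast hX
  have hXpos : (0 : ℝ) < X := by linarith
  have hU1 : (1 : ℝ) ≤ U := by exact_mod_cast hU
  have hNr : ((500 * U : ℝ)) ^ 25 ≤ N := by exact_mod_cast hN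
  have hN1 : (1 : ℝ) ≤ N := le_trans (one_le_pow₀ (by linarith)) hNr
  have hNpos : (0 : ℝ) < N := by linarith
  have hXpow : ∀ c : ℝ, 0 ≤ c → (N : ℝ) ^ (2 / 5 * c) ≤ (X : ℝ) ^ c := by
    intro c hc
    rw [Real.rpow_mul hNpos.le]
    exact Real.rpow_le_rpow (by positivity) b2 hc
  have hUX : (2 * U : ℝ) ≤ (X : ℝ) ^ (1 / 10 : ℝ) := by
    have := hXpow (1 / 10) (by norm_num)
    norm_num at this b1 ⊢
    linarith
  have hX500 : (500 : ℝ) ≤ (X : ℝ) ^ (1 / 5 : ℝ) := by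
    have h1 := hXpow (1 / 5) (by norm_num)
    have h2 : (N : ℝ) ^ (1 / 25 : ℝ) ≤ (N : ℝ) ^ (2 / 5 * (1 / 5) : ℝ) :=
      Real.rpow_le_rpow_of_exponent_le hN1 (by norm_num)
    linarith
  have hXneg : ∀ c : ℝ, 0 ≤ c → (X : ℝ) ^ (-c) ≤ (N : ℝ) ^ (-(2 / 5 * c)) := by
    intro c hc
    rw [Real.rpow_neg hXpos.le, Real.rpow_neg hNpos.le]
    exact inv_anti₀ (by positivity) (hXpow c hc)
  -- The last weight times `X` is `O(N)`, and `X ≥ N^{2/5}` turns the saving `X^{1/20}` into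
  -- `N^{1/50}`.
  have hminor : 100 * derivWeight U ξ X * (X : ℝ) ^ (19 / 20 : ℝ) ≤
      1600 * (N : ℝ) ^ (49 / 50 : ℝ) := by
    have e1 : (X : ℝ) ^ (19 / 20 : ℝ) = X * (X : ℝ) ^ (-(1 / 20) : ℝ) := by
      rw [← Real.rpow_one_add' hXpos.le (by norm_num)]
      norm_num
    have e2 := hXneg (1 / 20) (by norm_num)
    have e3 : (N : ℝ) ^ (49 / 50 : ℝ) = N * (N : ℝ) ^ (-(2 / 5 * (1 / 20)) : ℝ) := by
      rw [← Real.rpow_one_add' hNpos.le (by norm_num)]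
      norm_num
    rw [e1, e3]
    calc 100 * derivWeight U ξ X * (X * (X : ℝ) ^ (-(1 / 20) : ℝ))
        = 100 * (derivWeight U ξ X * X) * (X : ℝ) ^ (-(1 / 20) : ℝ) := by ring
      _ ≤ 100 * (16 * N) * (N : ℝ) ^ (-(2 / 5 * (1 / 20)) : ℝ) := by
          have := derivWeight_nonneg U ξ X
          gcongr
      _ = _ := by ring
  have hN49 : 0 ≤ (N : ℝ) ^ (49 / 50 : ℝ) := by positivity
  rcases quadSum_dichotomy hU hξ hX hUX (derivWeight_mono U ξ) (derivWeight_nonneg U ξ) φ with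
    h | ⟨q, a, hq, hcop, hqX, hβ, h⟩
  · left
    linarith
  set β := φ - a / q with hβdef
  -- A main term below the error bound is counted as a minor arc. Otherwise it dominates, so the
  -- error is absorbed at the cost of a factor `2`, and the Gauss sum cannot vanish.
  by_cases hcase : ‖quadGauss U ξ q a‖ / q * ‖quadSum U ξ (derivWeight U ξ) X β‖ ≤
      1600 * (N : ℝ) ^ (49 / 50 : ℝ)
  · left
    linarith
  right
  have hG : quadGauss U ξ q a ≠ 0 := by
    intro h0
    apply hcase
    rw [h0, norm_zero, zero_div, zero_mul]
    positivity
  refine ⟨q, a, hq, hcop, ?_, ?_, fun V hV =>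
    gcd_le_two_of_quadGauss_ne_zero hq hcop hco hV hG, ?_⟩
  · refine hqX.trans ?_
    calc (X : ℝ) ^ (1 / 5 : ℝ) ≤ (2 * (N : ℝ) ^ (1 / 2 : ℝ)) ^ (1 / 5 : ℝ) := by gcongr
      _ = 2 ^ (1 / 5 : ℝ) * (N : ℝ) ^ (1 / 10 : ℝ) := by
          rw [Real.mul_rpow (by norm_num) (by positivity), ← Real.rpow_mul hNpos.le]
          norm_num
      _ ≤ 2 * (N : ℝ) ^ (1 / 10 : ℝ) := by
          gcongr
          calc (2 : ℝ) ^ (1 / 5 : ℝ) ≤ 2 ^ (1 : ℝ) :=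
                Real.rpow_le_rpow_of_exponent_le (by norm_num) (by norm_num)
            _ = 2 := Real.rpow_one _
  · refine hβ.trans ((hXneg (17 / 10) (by norm_num)).trans (le_of_eq ?_))
    norm_num
  · have hg2 := gcd_le_two_of_quadGauss_ne_zero (V := 2 * U) hq hcop hco (fun _ _ h => h) hG
    have hgauss := norm_quadGauss_div_le (ξ := ξ) hq hcop hg2
    have hS1 : ‖quadSum U ξ (derivWeight U ξ) X β‖ ≤ 16 * N := by
      refine le_trans ?_ b4
      refine (norm_sum_le _ _).trans ?_
      calc _ ≤ ∑ x ∈ Finset.range X, derivWeight U ξ X := by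
            refine Finset.sum_le_sum fun x hx => ?_
            rw [norm_mul, norm_addChar, mul_one, Complex.norm_real,
              Real.norm_of_nonneg (derivWeight_nonneg _ _ _)]
            exact derivWeight_mono U ξ (Finset.mem_range.1 hx).le
        _ = derivWeight U ξ X * X := by
            rw [Finset.sum_const, Finset.card_range, nsmul_eq_mul, mul_comm]
    -- The weight is the derivative of the polynomial, so the telescoping bound applies directly. It
    -- starts at `y = 1` because the weight is zero at the origin.
    have hS2 : ‖quadSum U ξ (derivWeight U ξ) X β‖ * |β| ≤ 1 := by
      have := abs_mul_norm_sum_deriv_le hX hU hξ (mul_sq_le_half hX hUX hX500 hβ)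
        (y := 1) (n := X - 1) (by omega)
      convert this using 3
      unfold quadSum
      rw [hXdef, Finset.sum_range_succ']
      simp only [derivWeight, if_true, Complex.ofReal_zero, zero_mul, add_zero,
        Nat.add_sub_cancel, Nat.succ_ne_zero, if_false]
      refine Finset.sum_congr rfl fun x _ => ?_
      rw [add_comm x 1]
    have hS3 := min_le_mul_inv_one_add hNpos (abs_nonneg β) hS1 hS2
    have hbig : ‖quadSum U ξ (derivWeight U ξ) X φ‖ ≤
        2 * (‖quadGauss U ξ q a‖ / q * ‖quadSum U ξ (derivWeight U ξ) X β‖) := by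
      linarith [not_le.1 hcase]
    refine hbig.trans ?_
    calc _ ≤ 2 * (2 * (q : ℝ) ^ (-(1 / 2) : ℝ) * (17 * N * (1 + N * |β|)⁻¹)) := by gcongr
      _ = _ := by ring

/-! ### Squares with power weights -/

theorem powWeight_nonneg {τ M : ℝ} (hM : 0 < M) (x : ℕ) : 0 ≤ ((x : ℝ) / M) ^ τ := by positivity

theorem powWeight_mono {τ M : ℝ} (hτ : 0 < τ) (hM : 0 < M) :
    Monotone fun x : ℕ => ((x : ℝ) / M) ^ τ := by
  intro x y h
  simp only
  gcongr

theorem powWeight_le_two {τ M : ℝ} (hτ : 0 < τ) (hτ1 : τ < 1) (hM : 1 ≤ M) :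
    (((⌊M⌋₊ + 1 : ℕ) : ℝ) / M) ^ τ ≤ 2 := by
  have h1 : ((⌊M⌋₊ + 1 : ℕ) : ℝ) / M ≤ 2 := by
    rw [div_le_iff₀ (by linarith)]
    have := Nat.floor_le (show 0 ≤ M by linarith)
    push_cast
    linarith
  calc (((⌊M⌋₊ + 1 : ℕ) : ℝ) / M) ^ τ ≤ 2 ^ τ := by gcongr
    _ ≤ 2 ^ (1 : ℝ) := Real.rpow_le_rpow_of_exponent_le (by norm_num) hτ1.le
    _ = 2 := Real.rpow_one _

/-- The contribution of `x` below `B = |β|^{-1/2}` is what limits the unweighted sum to the exponent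
`1/2`; the weight shrinks it by `(B/M)^τ`. Beyond `B`, Abel summation against the telescoping bound
gives a contribution of the same size. -/
theorem norm_quadSum_powWeight_le {τ M : ℝ} (hτ : 0 < τ) (hτ1 : τ < 1) (hM : 1 ≤ M) {β : ℝ}
    (hβ : ((⌊M⌋₊ + 1 : ℕ) : ℝ) *
      (2 * Real.pi * |β| * (5 * (1 : ℕ) * (⌊M⌋₊ + 1 : ℕ))) ^ 2 ≤ 1 / 2) :
    ‖quadSum 1 0 (fun x => ((x : ℝ) / M) ^ τ) (⌊M⌋₊ + 1) β‖ ≤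
      8 * M * (1 + M ^ 2 * |β|) ^ (-((1 + τ) / 2)) := by
  set X := ⌊M⌋₊ + 1 with hX
  have hM0 : 0 < M := by linarith
  have hXM : (X : ℝ) ≤ 2 * M := by
    have := Nat.floor_le hM0.le
    rw [hX]; push_cast; linarith
  have hX1 : (1 : ℝ) ≤ X := by rw [hX]; push_cast; linarith [(Nat.cast_nonneg ⌊M⌋₊ : (0 : ℝ) ≤ _)]
  set s := (1 + τ) / 2 with hs
  have hgX := powWeight_le_two hτ hτ1 hM
  rw [← hX] at hgX
  by_cases hsmall : M ^ 2 * |β| ≤ 1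
  · have h1 : ‖quadSum 1 0 (fun x => ((x : ℝ) / M) ^ τ) X β‖ ≤ X * 2 := by
      refine (norm_sum_le _ _).trans ?_
      have : ∀ x ∈ Finset.range X, ‖((((x : ℝ) / M) ^ τ : ℝ) : ℂ) *
          addChar (β * (quadPoly 1 0 x : ℝ))‖ ≤ 2 := by
        intro x hx
        rw [norm_mul, norm_addChar, mul_one, Complex.norm_real,
          Real.norm_of_nonneg (powWeight_nonneg hM0 x)]
        exact (powWeight_mono hτ hM0 (Finset.mem_range.1 hx).le).trans hgX
      refine (Finset.sum_le_sum this).trans ?_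
      simp
    have h2 : (1 / 2 : ℝ) ≤ (1 + M ^ 2 * |β|) ^ (-s) := by
      calc (1 / 2 : ℝ) = 2 ^ (-1 : ℝ) := by norm_num [Real.rpow_neg_one]
        _ ≤ 2 ^ (-s) := Real.rpow_le_rpow_of_exponent_le (by norm_num) (by rw [hs]; linarith)
        _ ≤ _ := Real.rpow_le_rpow_of_nonpos (by positivity) (by linarith)
            (by rw [hs]; linarith)
    nlinarith
  have hsmall' : 1 < M ^ 2 * |β| := not_le.1 hsmall
  have hβ0 : 0 < |β| := by
    by_contra h
    have : |β| = 0 := le_antisymm (not_lt.1 h) (abs_nonneg β)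
    rw [this] at hsmall'
    norm_num at hsmall'
  -- The smallness hypothesis forces `|β| ≤ 1`, so `B ≥ 1` and rounding up gives `Y ≤ 2B`.
  have hβ1 : |β| ≤ 1 := by
    by_contra hcon
    have h1 : (1 : ℝ) ≤ 2 * Real.pi * |β| * (5 * (1 : ℕ) * X) := by
      have := Real.pi_gt_three
      push_cast
      have e1 : (1 : ℝ) ≤ 2 * Real.pi * |β| := by nlinarith [not_le.1 hcon]
      nlinarith
    have h2 := one_le_pow₀ h1 (n := 2)
    have h3 := mul_le_mul hX1 h2 zero_le_one (by linarith)
    exact absurd (h3.trans hβ) (by norm_num)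
  set B := |β| ^ (-(1 / 2) : ℝ) with hB
  have hB0 : 0 < B := by positivity
  have hB1 : 1 ≤ B := Real.one_le_rpow_of_pos_of_le_one_of_nonpos hβ0 hβ1 (by norm_num)
  have hB2 : B ^ 2 * |β| = 1 := by
    rw [hB, ← Real.rpow_natCast, ← Real.rpow_mul hβ0.le, ← Real.rpow_add_one hβ0.ne']
    norm_num
  have hBM : B < M := by
    have : B ^ 2 < M ^ 2 := by
      have : B ^ 2 * |β| < M ^ 2 * |β| := by rw [hB2]; exact hsmall'
      exact lt_of_mul_lt_mul_right this hβ0.le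
    exact lt_of_pow_lt_pow_left₀ 2 hM0.le this
  set Y := ⌈B⌉₊ with hY
  have hYB : B ≤ Y := Nat.le_ceil B
  have hYB2 : (Y : ℝ) < B + 1 := Nat.ceil_lt_add_one hB0.le
  have hYX : Y ≤ X := by
    have : (Y : ℝ) < X + 1 := by
      have := Nat.lt_floor_add_one M
      rw [hX]; push_cast; linarith
    have : Y < X + 1 := by exact_mod_cast this
    omega
  have hY0 : (0 : ℝ) < Y := by linarith
  have hsplit : quadSum 1 0 (fun x => ((x : ℝ) / M) ^ τ) X β =
      quadSum 1 0 (fun x => ((x : ℝ) / M) ^ τ) Y β +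
      ∑ i ∈ Finset.range (X - Y), (((((Y + i : ℕ) : ℝ) / M) ^ τ : ℝ) : ℂ) *
        addChar (β * (quadPoly 1 0 (Y + i) : ℝ)) := by
    unfold quadSum
    conv_lhs => rw [← Nat.add_sub_cancel' hYX]
    rw [Finset.sum_range_add]
  have hpart1 : ‖quadSum 1 0 (fun x => ((x : ℝ) / M) ^ τ) Y β‖ ≤ 2 * B * (B / M) ^ τ := by
    refine (norm_sum_le _ _).trans ?_
    have : ∀ x ∈ Finset.range Y, ‖((((x : ℝ) / M) ^ τ : ℝ) : ℂ) *
        addChar (β * (quadPoly 1 0 x : ℝ))‖ ≤ (B / M) ^ τ := by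
      intro x hx
      rw [norm_mul, norm_addChar, mul_one, Complex.norm_real,
        Real.norm_of_nonneg (powWeight_nonneg hM0 x)]
      have : (x : ℝ) < B := Nat.lt_ceil.1 (Finset.mem_range.1 hx)
      gcongr
    refine (Finset.sum_le_sum this).trans ?_
    rw [Finset.sum_const, Finset.card_range, nsmul_eq_mul]
    gcongr
    linarith
  -- The power weight divided by the derivative `2x` of `x²`. It is antitone because `τ < 1`.
  set h : ℕ → ℝ := fun i => ((Y + i : ℕ) : ℝ) ^ (τ - 1) * M ^ (-τ) / 2 with hh
  have hpart2 : ‖∑ i ∈ Finset.range (X - Y), (((((Y + i : ℕ) : ℝ) / M) ^ τ : ℝ) : ℂ) *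
        addChar (β * (quadPoly 1 0 (Y + i) : ℝ))‖ ≤ h 0 * (1 / |β|) := by
    have e : ∀ i : ℕ, (((((Y + i : ℕ) : ℝ) / M) ^ τ : ℝ) : ℂ) *
        addChar (β * (quadPoly 1 0 (Y + i) : ℝ)) =
        (h i : ℂ) * (((2 * (1 : ℕ) * (Y + i : ℕ) + (0 : ℕ) : ℝ) : ℂ) *
          addChar (β * (quadPoly 1 0 (Y + i) : ℝ))) := by
      intro i
      rw [← mul_assoc]
      congr 1
      have hpos : (0 : ℝ) < ((Y + i : ℕ) : ℝ) := by
        push_cast; linarith [(Nat.cast_nonneg i : (0 : ℝ) ≤ i)]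
      have e1 : (((Y + i : ℕ) : ℝ) / M) ^ τ = h i * (2 * (1 : ℕ) * (Y + i : ℕ) + (0 : ℕ) : ℝ) := by
        simp only [hh]
        rw [Real.div_rpow hpos.le hM0.le, Real.rpow_neg hM0.le, Real.rpow_sub_one hpos.ne']
        have : ((Y : ℝ) + i) ≠ 0 := by exact_mod_cast hpos.ne'
        push_cast
        field_simp
        ring
      rw [← Complex.ofReal_mul, ← e1]
    simp_rw [e]
    refine norm_sum_mul_le_of_antitone ?_ ?_ ?_
    · intro i _
      simp only [hh]
      have hpos : (0 : ℝ) < ((Y + i : ℕ) : ℝ) := by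
        push_cast; linarith [(Nat.cast_nonneg i : (0 : ℝ) ≤ i)]
      have := Real.rpow_le_rpow_of_nonpos hpos (show ((Y + i : ℕ) : ℝ) ≤ ((Y + (i + 1) : ℕ) : ℝ) by
        push_cast; linarith) (show τ - 1 ≤ 0 by linarith)
      gcongr
    · intro i _
      simp only [hh]
      positivity
    · intro m hm
      rw [le_div_iff₀ hβ0]
      exact abs_mul_norm_sum_deriv_le (by omega) le_rfl (by norm_num) hβ (by omega)
  have hh0 : h 0 * (1 / |β|) ≤ B * (B / M) ^ τ / 2 := by
    have e1 : 1 / |β| = B ^ 2 := by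
      rw [div_eq_iff hβ0.ne']
      exact hB2.symm
    have e2 : h 0 ≤ B ^ (τ - 1) * M ^ (-τ) / 2 := by
      simp only [hh, add_zero]
      have := Real.rpow_le_rpow_of_nonpos hB0 hYB (show τ - 1 ≤ 0 by linarith)
      gcongr
    rw [e1]
    calc h 0 * B ^ 2 ≤ (B ^ (τ - 1) * M ^ (-τ) / 2) * B ^ 2 := by gcongr
      _ = _ := by
          rw [Real.div_rpow hB0.le hM0.le, Real.rpow_neg hM0.le, Real.rpow_sub_one hB0.ne']
          field_simp
  have hfin : B * (B / M) ^ τ ≤ M * (2 * (1 + M ^ 2 * |β|) ^ (-s)) := by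
    have e1 : B * (B / M) ^ τ = M * (B / M) ^ (1 + τ) := by
      rw [Real.rpow_one_add' (by positivity) (by linarith)]
      field_simp
    have e2 : (B / M) ^ (1 + τ) = (M ^ 2 * |β|) ^ (-s) := by
      have e3 : M ^ 2 * |β| = (B / M) ^ (-2 : ℝ) := by
        rw [Real.rpow_neg (by positivity)]
        rw [show (2 : ℝ) = ((2 : ℕ) : ℝ) by norm_num, Real.rpow_natCast]
        field_simp
        rw [mul_comm]
        exact hB2
      rw [e3, ← Real.rpow_mul (by positivity), hs]
      congr 1
      ring
    have e4 : (M ^ 2 * |β|) ^ (-s) ≤ ((1 + M ^ 2 * |β|) / 2) ^ (-s) :=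
      Real.rpow_le_rpow_of_nonpos (by positivity) (by linarith) (by rw [hs]; linarith)
    have e5 : ((1 + M ^ 2 * |β|) / 2) ^ (-s) ≤ 2 * (1 + M ^ 2 * |β|) ^ (-s) := by
      rw [Real.div_rpow (by positivity) (by norm_num), Real.rpow_neg (show (0 : ℝ) ≤ 2 by norm_num),
        div_inv_eq_mul, mul_comm]
      gcongr
      calc (2 : ℝ) ^ s ≤ 2 ^ (1 : ℝ) :=
            Real.rpow_le_rpow_of_exponent_le (by norm_num) (by rw [hs]; linarith)
        _ = 2 := Real.rpow_one _
    rw [e1, e2]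
    gcongr
    exact e4.trans e5
  rw [hsplit]
  refine (norm_add_le _ _).trans ?_
  have hnn : 0 ≤ M * (1 + M ^ 2 * |β|) ^ (-s) := by positivity
  linarith

/-- The argument is that for the majorant of the squares: a main term below the error goes into the
first alternative, and otherwise it dominates. With `U = 1` the greatest common divisor with `2U` is
at most `2` automatically. -/
theorem norm_quadSum_powWeight_dichotomy {τ : ℝ} (hτ : 0 < τ) (hτ1 : τ < 1) {M : ℝ}
    (hM : 500 ^ 10 ≤ M) (φ : ℝ) :
    ‖quadSum 1 0 (fun x => ((x : ℝ) / M) ^ τ) (⌊M⌋₊ + 1) φ‖ ≤ 800 * M ^ (19 / 20 : ℝ) ∨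
    ∃ (q : ℕ) (a : ℤ), 1 ≤ q ∧ IsCoprime a q ∧ (q : ℝ) ≤ 2 * M ^ (1 / 5 : ℝ) ∧
      |φ - a / q| ≤ M ^ (-(17 / 10) : ℝ) ∧
      ‖quadSum 1 0 (fun x => ((x : ℝ) / M) ^ τ) (⌊M⌋₊ + 1) φ‖ ≤
        32 * M * ((q : ℝ) ^ (-(1 / 2) : ℝ) * (1 + M ^ 2 * |φ - a / q|) ^ (-((1 + τ) / 2))) := by
  set X := ⌊M⌋₊ + 1 with hXdef
  have hM1 : (1 : ℝ) ≤ M := le_trans (by norm_num) hM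
  have hM0 : 0 < M := by linarith
  have hX : 1 ≤ X := by omega
  have hMX : M ≤ X := by rw [hXdef]; push_cast; exact (Nat.lt_floor_add_one M).le
  have hXM : (X : ℝ) ≤ 2 * M := by
    have := Nat.floor_le hM0.le
    rw [hXdef]; push_cast; linarith
  have hXpos : (0 : ℝ) < X := by linarith
  have hM10 : (500 : ℝ) ≤ M ^ (1 / 10 : ℝ) := by
    have := Real.rpow_le_rpow (by positivity) hM (show (0 : ℝ) ≤ 1 / 10 by norm_num)
    rwa [← Real.rpow_natCast, ← Real.rpow_mul (by positivity),
      show ((10 : ℕ) : ℝ) * (1 / 10) = 1 by norm_num, Real.rpow_one] at this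
  have hUX : (2 * (1 : ℕ) : ℝ) ≤ (X : ℝ) ^ (1 / 10 : ℝ) := by
    have : M ^ (1 / 10 : ℝ) ≤ (X : ℝ) ^ (1 / 10 : ℝ) := by gcongr
    push_cast
    linarith
  have hX500 : (500 : ℝ) ≤ (X : ℝ) ^ (1 / 5 : ℝ) := by
    have h1 : M ^ (1 / 5 : ℝ) ≤ (X : ℝ) ^ (1 / 5 : ℝ) := by gcongr
    have h2 : M ^ (1 / 10 : ℝ) ≤ M ^ (1 / 5 : ℝ) :=
      Real.rpow_le_rpow_of_exponent_le hM1 (by norm_num)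
    linarith
  have h2pow : ∀ c : ℝ, 0 ≤ c → c ≤ 1 → (X : ℝ) ^ c ≤ 2 * M ^ c := by
    intro c hc hc1
    calc (X : ℝ) ^ c ≤ (2 * M) ^ c := by gcongr
      _ = 2 ^ c * M ^ c := Real.mul_rpow (by norm_num) hM0.le
      _ ≤ 2 ^ (1 : ℝ) * M ^ c := by gcongr; norm_num
      _ = 2 * M ^ c := by rw [Real.rpow_one]
  have hgX := powWeight_le_two hτ hτ1 hM1
  rw [← hXdef] at hgX
  have hminor : 100 * ((X : ℝ) / M) ^ τ * (X : ℝ) ^ (19 / 20 : ℝ) ≤ 400 * M ^ (19 / 20 : ℝ) := by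
    have := h2pow (19 / 20) (by norm_num) (by norm_num)
    calc 100 * ((X : ℝ) / M) ^ τ * (X : ℝ) ^ (19 / 20 : ℝ)
        ≤ 100 * 2 * (2 * M ^ (19 / 20 : ℝ)) := by gcongr
      _ = _ := by ring
  have hnn : 0 ≤ M ^ (19 / 20 : ℝ) := by positivity
  rcases quadSum_dichotomy (le_refl 1) (Nat.zero_le _) hX hUX (powWeight_mono hτ hM0)
    (powWeight_nonneg hM0) φ with h | ⟨q, a, hq, hcop, hqX, hβ, h⟩
  · left
    linarith
  set β := φ - a / q with hβdef
  set S : ℝ → ℂ := quadSum 1 0 (fun x : ℕ => ((x : ℝ) / M) ^ τ) X with hS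
  by_cases hcase : ‖quadGauss 1 0 q a‖ / q * ‖S β‖ ≤ 400 * M ^ (19 / 20 : ℝ)
  · left
    linarith
  right
  refine ⟨q, a, hq, hcop, hqX.trans (h2pow _ (by norm_num) (by norm_num)), hβ.trans
    (Real.rpow_le_rpow_of_nonpos hM0 hMX (by norm_num)), ?_⟩
  have hg2 : q.gcd (2 * 1) ≤ 2 := Nat.le_of_dvd (by norm_num) (Nat.gcd_dvd_right _ _)
  have hgauss := norm_quadGauss_div_le (ξ := 0) hq hcop hg2
  have hS := norm_quadSum_powWeight_le hτ hτ1 hM1 (mul_sq_le_half hX hUX hX500 hβ)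
  have hbig : ‖S φ‖ ≤ 2 * (‖quadGauss 1 0 q a‖ / q * ‖S β‖) := by
    linarith [not_le.1 hcase]
  refine hbig.trans ?_
  calc _ ≤ 2 * (2 * (q : ℝ) ^ (-(1 / 2) : ℝ) * (8 * M * (1 + M ^ 2 * |β|) ^ (-((1 + τ) / 2)))) := by
        gcongr
    _ = _ := by ring

/-- `∑_{x ≤ M} (M / x) ^ τ ≪ M`. -/
theorem sum_rpow_neg_le {τ M : ℝ} (hτ : 0 < τ) (hτ1 : τ < 1) (hM : 0 < M) :
    ∑ x ∈ Finset.Icc 1 ⌊M⌋₊, ((x : ℝ) / M) ^ (-τ) ≤ M / (1 - τ) := by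
  have h1 : ∀ n : ℕ, ∑ x ∈ Finset.Icc 1 n, (x : ℝ) ^ (-τ) ≤ (n : ℝ) ^ (1 - τ) / (1 - τ) := by
    intro n
    induction n with
    | zero => simp [Real.zero_rpow (show 1 - τ ≠ 0 by linarith)]
    | succ n ih =>
      rw [Finset.sum_Icc_succ_top (by omega)]
      have hn : (0 : ℝ) < ((n + 1 : ℕ) : ℝ) := by positivity
      -- Bernoulli's inequality for the exponent `1 - τ`, at `1 - 1/(n + 1)`.
      have h2 : (n : ℝ) ^ (1 - τ) ≤
          ((n + 1 : ℕ) : ℝ) ^ (1 - τ) - (1 - τ) * ((n + 1 : ℕ) : ℝ) ^ (-τ) := by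
        have h3 := rpow_one_add_le_one_add_mul_self (s := -(1 / ((n + 1 : ℕ) : ℝ)))
          (p := 1 - τ) (by
            have : 1 / ((n + 1 : ℕ) : ℝ) ≤ 1 := by
              rw [div_le_one hn]; push_cast; linarith [(Nat.cast_nonneg n : (0 : ℝ) ≤ n)]
            linarith) (by linarith) (by linarith)
        have h4 : 1 + -(1 / ((n + 1 : ℕ) : ℝ)) = n / ((n + 1 : ℕ) : ℝ) := by
          field_simp
          push_cast
          ring
        rw [h4, Real.div_rpow (Nat.cast_nonneg n) hn.le, div_le_iff₀ (by positivity)] at h3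
        refine h3.trans (le_of_eq ?_)
        have h5 : ((n + 1 : ℕ) : ℝ) ^ (-τ) = ((n + 1 : ℕ) : ℝ) ^ (1 - τ) / ((n + 1 : ℕ) : ℝ) := by
          rw [← Real.rpow_sub_one hn.ne']
          ring_nf
        rw [h5]
        ring
      rw [le_div_iff₀ (by linarith)] at ih ⊢
      rw [add_mul]
      linarith
  have h2 : ∀ x : ℕ, ((x : ℝ) / M) ^ (-τ) = (x : ℝ) ^ (-τ) * M ^ τ := by
    intro x
    rw [Real.div_rpow (Nat.cast_nonneg x) hM.le, Real.rpow_neg hM.le, div_inv_eq_mul]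
  simp_rw [h2]
  rw [← Finset.sum_mul]
  have h3 : (⌊M⌋₊ : ℝ) ^ (1 - τ) ≤ M ^ (1 - τ) := by
    have := Nat.floor_le hM.le
    gcongr
  have h4 : M ^ (1 - τ) * M ^ τ = M := by
    rw [← Real.rpow_add hM]
    simp
  have h5 : 0 < 1 - τ := by linarith
  calc _ ≤ (M ^ (1 - τ) / (1 - τ)) * M ^ τ := by
        gcongr
        exact (h1 _).trans (by gcongr)
    _ = M / (1 - τ) := by rw [div_mul_eq_mul_div, h4]

/-! ### The Dirichlet kernel and the kernel of the majorant -/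

/-- The Dirichlet kernel `∑_{1 ≤ x ≤ m} e(φ x)`. -/
noncomputable def linSum (m : ℕ) (φ : ℝ) : ℂ := ∑ x ∈ Finset.Icc 1 m, addChar (φ * (x : ℝ))

theorem norm_linSum_le (m : ℕ) (φ : ℝ) : ‖linSum m φ‖ ≤ m := by
  refine (norm_sum_le _ _).trans ?_
  simp [norm_addChar]

theorem norm_linSum_mul_le (m : ℕ) (φ : ℝ) : ‖linSum m φ‖ * (2 * |φ - round φ|) ≤ 1 := by
  have h : linSum m φ = addChar φ * ∑ x ∈ Finset.range m, addChar ((x : ℝ) * φ) := by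
    unfold linSum
    rw [Finset.range_eq_Ico, Finset.mul_sum, ← Finset.Ico_add_one_right_eq_Icc,
      Finset.sum_Ico_eq_sum_range, Finset.range_eq_Ico]
    refine Finset.sum_congr (by simp) fun x _ => ?_
    rw [← addChar_add]
    congr 1
    push_cast
    ring
  rw [h, norm_mul, norm_addChar, one_mul]
  exact norm_geom_sum_addChar_mul_le m φ

/-- The exponential sum with coefficients `1_[N] + ν`. -/
noncomputable def majorantSum (U ξ N : ℕ) (φ : ℝ) : ℂ :=
  ∑ n ∈ Finset.Icc (1 : ℤ) N, ((1 + squareMajorant N (2 * U) ξ n : ℝ) : ℂ) * addChar (φ * (n : ℝ))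

theorem sum_Icc_int_eq_sum_Icc {E : Type*} [AddCommMonoid E] (N : ℕ) (h : ℤ → E) :
    ∑ n ∈ Finset.Icc (1 : ℤ) N, h n = ∑ n ∈ Finset.Icc 1 N, h (n : ℤ) := by
  refine (Finset.sum_nbij' (fun n : ℕ => (n : ℤ)) Int.toNat ?_ ?_ ?_ ?_ ?_).symm
  all_goals intro n hn; simp only [Finset.mem_Icc] at hn ⊢
  all_goals omega

theorem majorantSum_eq {U ξ : ℕ} (hU : 1 ≤ U) (hξ : ξ ≤ 2 * U) (N : ℕ) (φ : ℝ) :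
    majorantSum U ξ N φ =
      linSum N φ + quadSum U ξ (derivWeight U ξ) (lastRoot U ξ N + 1) φ := by
  have h := sum_squareMajorant_mul hU hξ N (fun n => addChar (φ * (n : ℝ)))
  unfold majorantSum linSum quadSum
  have e : ∑ x ∈ Finset.range (lastRoot U ξ N + 1), (derivWeight U ξ x : ℂ) *
      addChar (φ * (quadPoly U ξ x : ℝ)) = ∑ x ∈ Finset.range (lastRoot U ξ N + 1),
      (derivWeight U ξ x : ℂ) * addChar (φ * (((quadPoly U ξ x : ℕ) : ℤ) : ℝ)) := by
    simp
  rw [e, ← h]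
  have e2 : ∑ x ∈ Finset.Icc 1 N, addChar (φ * (x : ℝ)) =
      ∑ n ∈ Finset.Icc (1 : ℤ) N, addChar (φ * (n : ℝ)) := by
    rw [sum_Icc_int_eq_sum_Icc]
    simp
  rw [e2, ← Finset.sum_add_distrib]
  refine Finset.sum_congr rfl fun n _ => ?_
  push_cast
  ring

theorem sum_squareMajorant_mul_real {U ξ : ℕ} (hU : 1 ≤ U) (hξ : ξ ≤ 2 * U) (N : ℕ) (h : ℤ → ℝ) :
    ∑ n ∈ Finset.Icc (1 : ℤ) N, squareMajorant N (2 * U) ξ n * h n =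
      ∑ x ∈ Finset.range (lastRoot U ξ N + 1), derivWeight U ξ x * h (quadPoly U ξ x) := by
  exact_mod_cast sum_squareMajorant_mul hU hξ N (fun n => (h n : ℂ))

theorem sum_squareMajorant_le {U ξ N : ℕ} (hU : 1 ≤ U) (hξ : ξ ≤ 2 * U) (hN : (500 * U) ^ 25 ≤ N) :
    ∑ n ∈ Finset.Icc (1 : ℤ) N, squareMajorant N (2 * U) ξ n ≤ 16 * N := by
  have h := sum_squareMajorant_mul_real hU hξ N (fun _ => 1)
  simp only [mul_one] at h
  rw [h]
  obtain ⟨-, -, -, hb⟩ := lastRoot_bounds hU hξ hN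
  refine (Finset.sum_le_sum (g := fun _ => derivWeight U ξ (lastRoot U ξ N + 1))
    fun x hx => derivWeight_mono U ξ (Finset.mem_range.1 hx).le).trans ?_
  rw [Finset.sum_const, Finset.card_range, nsmul_eq_mul, mul_comm]
  exact hb

theorem sum_one_add_squareMajorant_le {U ξ N : ℕ} (hU : 1 ≤ U) (hξ : ξ ≤ 2 * U)
    (hN : (500 * U) ^ 25 ≤ N) :
    ∑ n ∈ Finset.Icc (1 : ℤ) N, (1 + squareMajorant N (2 * U) ξ n) ≤ 17 * N := by
  rw [Finset.sum_add_distrib]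
  have := sum_squareMajorant_le hU hξ hN
  simp
  linarith

theorem norm_majorantSum_le {U ξ N : ℕ} (hU : 1 ≤ U) (hξ : ξ ≤ 2 * U) (hN : (500 * U) ^ 25 ≤ N)
    (φ : ℝ) : ‖majorantSum U ξ N φ‖ ≤ 17 * N := by
  refine (norm_sum_le _ _).trans (le_trans (Finset.sum_le_sum fun n _ => ?_)
    (sum_one_add_squareMajorant_le hU hξ hN))
  rw [norm_mul, norm_addChar, mul_one, Complex.norm_real, Real.norm_of_nonneg]
  linarith [squareMajorant_nonneg hU hξ (N := N) n]

theorem norm_linSum_le_inv (N : ℕ) (hN : 0 < N) (φ : ℝ) :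
    ‖linSum N φ‖ ≤ 2 * N * (1 + N * |φ - round φ|)⁻¹ := by
  have h1 := norm_linSum_le N φ
  have h2 := norm_linSum_mul_le N φ
  have hN' : (0 : ℝ) < N := by exact_mod_cast hN
  rw [← div_eq_mul_inv, le_div_iff₀ (by positivity)]
  nlinarith [norm_nonneg (linSum N φ), abs_nonneg (φ - round φ)]

/-- The larger of the Dirichlet kernel and the quadratic sum decides, at the cost of a factor `2`.
-/
theorem norm_majorantSum_dichotomy {U ξ N : ℕ} (hU : 1 ≤ U) (hξ : ξ ≤ 2 * U)
    (hco : Nat.Coprime ξ (2 * U)) (hN : (500 * U) ^ 25 ≤ N) (φ : ℝ) :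
    ‖majorantSum U ξ N φ‖ ≤ 6400 * (N : ℝ) ^ (49 / 50 : ℝ) ∨
    ∃ (q : ℕ) (a : ℤ), 1 ≤ q ∧ IsCoprime a q ∧ (q : ℝ) ≤ 2 * (N : ℝ) ^ (1 / 10 : ℝ) ∧
      |φ - a / q| ≤ (N : ℝ) ^ (-(17 / 25) : ℝ) ∧
      (∀ V : ℕ, (∀ l : ℕ, l.Prime → l ∣ V → l ∣ 2 * U) → q.gcd V ≤ 2) ∧
      ‖majorantSum U ξ N φ‖ ≤ 136 * N * ((q : ℝ) ^ (-(1 / 2) : ℝ) * (1 + N * |φ - a / q|)⁻¹) := by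
  have hN1 : 1 ≤ N := le_trans (Nat.one_le_pow _ _ (by omega)) hN
  have hNr : (1 : ℝ) ≤ N := by exact_mod_cast hN1
  set S := quadSum U ξ (derivWeight U ξ) (lastRoot U ξ N + 1) φ with hS
  have hsum : ‖majorantSum U ξ N φ‖ ≤ ‖linSum N φ‖ + ‖S‖ := by
    rw [majorantSum_eq hU hξ]
    exact norm_add_le _ _
  rcases le_total ‖linSum N φ‖ ‖S‖ with hle | hle
  · rcases norm_quadSum_derivWeight_dichotomy hU hξ hco hN φ with h | ⟨q, a, h1, h2, h3, h4, h5, h6⟩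
    · left
      linarith
    · right
      refine ⟨q, a, h1, h2, h3, h4, h5, ?_⟩
      rw [← hS] at h6
      linarith
  -- The Dirichlet kernel concentrates at integers, that is, on the arc with `q = 1`.
  · by_cases hφ : |φ - round φ| ≤ (N : ℝ) ^ (-(17 / 25) : ℝ)
    · right
      have h1 := norm_linSum_le_inv N hN1 φ
      have hnn : 0 ≤ (N : ℝ) * (1 + N * |φ - round φ|)⁻¹ := by positivity
      refine ⟨1, round φ, le_rfl, by simp [isCoprime_one_right], ?_, by simpa using hφ,
        by simp, ?_⟩
      · have := Real.one_le_rpow hNr (show (0 : ℝ) ≤ 1 / 10 by norm_num)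
        push_cast
        linarith
      · simp only [Nat.cast_one, Real.one_rpow, one_mul, div_one]
        linarith
    · left
      have h1 := norm_linSum_mul_le N φ
      have h2 : (0 : ℝ) < (N : ℝ) ^ (-(17 / 25) : ℝ) := by positivity
      have h3 : ‖linSum N φ‖ ≤ (N : ℝ) ^ (17 / 25 : ℝ) := by
        have h4 : (N : ℝ) ^ (17 / 25 : ℝ) * (N : ℝ) ^ (-(17 / 25) : ℝ) = 1 := by
          rw [← Real.rpow_add (by linarith)]
          norm_num
        have h5 : ‖linSum N φ‖ * (N : ℝ) ^ (-(17 / 25) : ℝ) ≤ 1 := by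
          nlinarith [norm_nonneg (linSum N φ), not_le.1 hφ]
        rw [← h4] at h5
        exact le_of_mul_le_mul_right h5 h2
      have h6 : (N : ℝ) ^ (17 / 25 : ℝ) ≤ (N : ℝ) ^ (49 / 50 : ℝ) :=
        Real.rpow_le_rpow_of_exponent_le hNr (by norm_num)
      have : 0 ≤ (N : ℝ) ^ (17 / 25 : ℝ) := by positivity
      linarith

theorem norm_quadSum_powWeight_le_self {τ M : ℝ} (hτ : 0 < τ) (hM : 0 < M) (φ : ℝ) :
    ‖quadSum 1 0 (fun x => ((x : ℝ) / M) ^ τ) (⌊M⌋₊ + 1) φ‖ ≤ M := by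
  have hle : (⌊M⌋₊ : ℝ) ≤ M := Nat.floor_le hM.le
  unfold quadSum
  rw [Finset.sum_range_succ']
  simp only [Nat.cast_zero, zero_div, Real.zero_rpow hτ.ne', Complex.ofReal_zero, zero_mul, add_zero]
  refine (norm_sum_le _ _).trans ((Finset.sum_le_sum (g := fun _ => (1 : ℝ)) fun x hx => ?_).trans
    (by simpa using hle))
  rw [norm_mul, norm_addChar, mul_one, Complex.norm_real, Real.norm_of_nonneg (by positivity)]
  refine Real.rpow_le_one (by positivity) ?_ hτ.le
  rw [div_le_one hM]
  refine le_trans ?_ hle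
  exact_mod_cast Finset.mem_range.1 hx

/-- If `c θ` is close to `a / q` but `b a / (q c)` is not an integer, then `b θ` is far from
integers. -/
theorem norm_linSum_le_of_not_dvd {m q : ℕ} {a b c : ℤ} {θ : ℝ} (hq : 1 ≤ q) (hc : c ≠ 0)
    (hnd : ¬ (q * c : ℤ) ∣ b * a) (hβ : 2 * |(b : ℝ)| * q * |c * θ - a / q| ≤ 1) :
    ‖linSum m (b * θ)‖ ≤ q * |(c : ℝ)| := by
  have hq' : (0 : ℝ) < q := by exact_mod_cast hq
  have hc' : (0 : ℝ) < |(c : ℝ)| := abs_pos.2 (by exact_mod_cast hc)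
  have hc0 : (c : ℝ) ≠ 0 := by exact_mod_cast hc
  set r := round ((b : ℝ) * θ) with hr
  have h1 : (1 : ℝ) ≤ |(b : ℝ) * a - r * (q * c)| := by
    have : b * a - r * (q * c) ≠ 0 := fun h => hnd ⟨r, by linarith⟩
    exact_mod_cast Int.one_le_abs this
  -- The integer in `h1` is nonzero by the divisibility hypothesis. This identity expresses it
  -- through the distance of `bθ` to the nearest integer and the approximation error, and the latter
  -- accounts for at most `1/2`.
  have h2 : (b : ℝ) * a - r * (q * c) = q * c * (b * θ - r) - b * q * (c * θ - a / q) := by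
    field_simp
    ring
  have h3 : (1 : ℝ) ≤ q * |(c : ℝ)| * |b * θ - r| + |(b : ℝ)| * q * |c * θ - a / q| := by
    rw [h2] at h1
    refine h1.trans ((abs_sub _ _).trans (le_of_eq ?_))
    simp only [abs_mul, Nat.abs_cast]
  have h4 := norm_linSum_mul_le m (b * θ)
  rw [← hr] at h4
  have h5 : (1 : ℝ) ≤ q * |(c : ℝ)| * (2 * |b * θ - r|) := by linarith
  have h6 : 0 < |b * θ - r| := by
    by_contra h
    have : |b * θ - r| = 0 := le_antisymm (not_lt.1 h) (abs_nonneg _)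
    rw [this] at h5
    norm_num at h5
  exact le_of_mul_le_mul_right (h4.trans h5) (by positivity)

/-! ### Second moments -/

theorem integral_norm_expSum_sq_le {ι : Type*} (s : Finset ι) (c : ι → ℂ) (k : ι → ℤ) :
    ∫ α in (0 : ℝ)..1, ‖expSum s c k α‖ ^ 2 ≤
      ∑ i ∈ s, ∑ j ∈ s, if k i = k j then ‖c i‖ * ‖c j‖ else 0 := by
  have h1 : ∀ α : ℝ, ((‖expSum s c k α‖ ^ 2 : ℝ) : ℂ) =
      ∑ i ∈ s, ∑ j ∈ s, c i * (starRingEnd ℂ) (c j) * addChar (((k i - k j : ℤ) : ℝ) * α) := by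
    intro α
    push_cast
    rw [← Complex.mul_conj']
    unfold expSum
    rw [map_sum, Finset.sum_mul_sum]
    refine Finset.sum_congr rfl fun i _ => Finset.sum_congr rfl fun j _ => ?_
    rw [map_mul, conj_addChar, sub_mul, sub_eq_add_neg, addChar_add]
    ring
  have hcont : ∀ i j, Continuous fun α : ℝ =>
      c i * (starRingEnd ℂ) (c j) * addChar (((k i - k j : ℤ) : ℝ) * α) := fun i j =>
    continuous_const.mul (continuous_addChar.comp (by fun_prop))
  have h2 : ((∫ α in (0 : ℝ)..1, ‖expSum s c k α‖ ^ 2 : ℝ) : ℂ) =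
      ∑ i ∈ s, ∑ j ∈ s, c i * (starRingEnd ℂ) (c j) * (if k i = k j then 1 else 0) := by
    rw [← intervalIntegral.integral_ofReal]
    simp_rw [h1]
    rw [intervalIntegral.integral_finsetSum]
    · refine Finset.sum_congr rfl fun i _ => ?_
      rw [intervalIntegral.integral_finsetSum]
      · refine Finset.sum_congr rfl fun j _ => ?_
        rw [intervalIntegral.integral_const_mul, integral_addChar_int_mul]
        simp only [sub_eq_zero]
      · exact fun j _ => (hcont i j).intervalIntegrable _ _
    · exact fun i _ => (continuous_finsetSum _ fun j _ => hcont i j).intervalIntegrable _ _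
  have h3 : ∫ α in (0 : ℝ)..1, ‖expSum s c k α‖ ^ 2 ≤
      ‖((∫ α in (0 : ℝ)..1, ‖expSum s c k α‖ ^ 2 : ℝ) : ℂ)‖ := by
    rw [Complex.norm_real]
    exact Real.le_norm_self _
  refine h3.trans ?_
  rw [h2]
  refine (norm_sum_le _ _).trans (Finset.sum_le_sum fun i _ => (norm_sum_le _ _).trans
    (Finset.sum_le_sum fun j _ => ?_))
  split_ifs
  · simp
  · simp

/-- The correlation `∑_{k i - k j = h} u i u j`. -/
noncomputable def correlation {ι : Type*} (s : Finset ι) (u : ι → ℝ) (k : ι → ℤ) (h : ℤ) : ℝ :=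
  ∑ i ∈ s, ∑ j ∈ s, if k i - k j = h then u i * u j else 0

theorem expSum_product {ι κ : Type*} (s : Finset ι) (t : Finset κ) (c : ι → ℂ) (d : κ → ℂ)
    (k : ι → ℤ) (l : κ → ℤ) (α : ℝ) :
    expSum (s ×ˢ t) (fun p => c p.1 * d p.2) (fun p => k p.1 + l p.2) α =
      expSum s c k α * expSum t d l α := by
  unfold expSum
  rw [Finset.sum_mul_sum, Finset.sum_product]
  refine Finset.sum_congr rfl fun i _ => Finset.sum_congr rfl fun j _ => ?_
  push_cast
  rw [add_mul, addChar_add]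
  ring

/-- The second moment of a product of two exponential sums, in terms of the correlations of the
first factor. -/
theorem integral_norm_expSum_product_sq_le {ι κ : Type*} (s : Finset ι) (t : Finset κ) {c : ι → ℂ}
    (d : κ → ℂ) (k : ι → ℤ) (l : κ → ℤ) {u : ι → ℝ} {A₀ A₁ : ℝ} (hc : ∀ i ∈ s, ‖c i‖ ≤ u i)
    (h₀ : correlation s u k 0 ≤ A₀) (h₁ : ∀ h ≠ 0, correlation s u k h ≤ A₁) (hA₁ : 0 ≤ A₁) :
    ∫ α in (0 : ℝ)..1,
        ‖expSum (s ×ˢ t) (fun p => c p.1 * d p.2) (fun p => k p.1 + l p.2) α‖ ^ 2 ≤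
      A₁ * (∑ j ∈ t, ‖d j‖) ^ 2 +
        A₀ * ∑ j ∈ t, ∑ j' ∈ t, if l j = l j' then ‖d j‖ * ‖d j'‖ else 0 := by
  refine (integral_norm_expSum_sq_le _ _ _).trans ?_
  have e : ∑ p ∈ s ×ˢ t, ∑ p' ∈ s ×ˢ t, (if k p.1 + l p.2 = k p'.1 + l p'.2 then
      ‖c p.1 * d p.2‖ * ‖c p'.1 * d p'.2‖ else 0) =
      ∑ j ∈ t, ∑ j' ∈ t, ‖d j‖ * ‖d j'‖ * ∑ i ∈ s, ∑ i' ∈ s,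
        if k i - k i' = l j' - l j then ‖c i‖ * ‖c i'‖ else 0 := by
    rw [Finset.sum_product_right]
    refine Finset.sum_congr rfl fun j _ => ?_
    simp_rw [Finset.sum_product_right]
    rw [Finset.sum_comm]
    refine Finset.sum_congr rfl fun j' _ => ?_
    rw [Finset.mul_sum]
    refine Finset.sum_congr rfl fun i _ => ?_
    rw [Finset.mul_sum]
    refine Finset.sum_congr rfl fun i' _ => ?_
    have : (k i + l j = k i' + l j') ↔ (k i - k i' = l j' - l j) := by omega
    simp only [this, norm_mul]
    split_ifs <;> ring
  rw [e, sq, Finset.sum_mul_sum, Finset.mul_sum, Finset.mul_sum, ← Finset.sum_add_distrib]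
  refine Finset.sum_le_sum fun j _ => ?_
  rw [Finset.mul_sum, Finset.mul_sum, ← Finset.sum_add_distrib]
  refine Finset.sum_le_sum fun j' _ => ?_
  have hcorr : ∑ i ∈ s, ∑ i' ∈ s, (if k i - k i' = l j' - l j then ‖c i‖ * ‖c i'‖ else 0) ≤
      correlation s u k (l j' - l j) := by
    refine Finset.sum_le_sum fun i hi => Finset.sum_le_sum fun i' hi' => ?_
    split_ifs
    · exact mul_le_mul (hc i hi) (hc i' hi') (norm_nonneg _) ((norm_nonneg _).trans (hc i hi))
    · rfl
  have hd : 0 ≤ ‖d j‖ * ‖d j'‖ := by positivity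
  -- Pairs with equal frequency in the second factor meet the correlation at `0`; all others meet a
  -- nonzero shift and cost `A₁`.
  split_ifs with hl
  · rw [hl, sub_self] at hcorr
    have := mul_le_mul_of_nonneg_left (hcorr.trans h₀) hd
    rw [hl, sub_self]
    nlinarith
  · have hne : l j' - l j ≠ 0 := by omega
    have := mul_le_mul_of_nonneg_left (hcorr.trans (h₁ _ hne)) hd
    nlinarith

theorem sum_sum_ite_le_of_injOn {κ : Type*} (t : Finset κ) {d : κ → ℂ} {l : κ → ℤ}
    (hl : Set.InjOn l t) (hd : ∀ j ∈ t, ‖d j‖ ≤ 1) :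
    ∑ j ∈ t, ∑ j' ∈ t, (if l j = l j' then ‖d j‖ * ‖d j'‖ else 0) ≤ t.card := by
  classical
  have : ∀ j ∈ t, ∑ j' ∈ t, (if l j = l j' then ‖d j‖ * ‖d j'‖ else 0) ≤ 1 := by
    intro j hj
    rw [Finset.sum_eq_single_of_mem j hj]
    · rw [if_pos rfl]
      nlinarith [hd j hj, norm_nonneg (d j)]
    · intro j' hj' hne
      rw [if_neg]
      exact fun h => hne (hl hj hj' h).symm
  exact (Finset.sum_le_sum this).trans (by simp)

/-! ### Counting differences of values of a quadratic polynomial -/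

/-- The difference of two values factors as `(x - y)(U(x + y) + ξ)`. So `|x - y|` divides `g`, and
together with `g` it determines the pair. -/
theorem card_quadPoly_sub_eq_le {U : ℕ} (hU : 1 ≤ U) (ξ : ℕ) (s : Finset ℕ) {g : ℤ} (hg : g ≠ 0) :
    ((s ×ˢ s).filter fun p => (quadPoly U ξ p.1 : ℤ) - quadPoly U ξ p.2 = g).card ≤
      g.natAbs.divisors.card := by
  have key : ∀ x y : ℕ, (quadPoly U ξ x : ℤ) - quadPoly U ξ y =
      ((x : ℤ) - y) * (U * (x + y) + ξ) := by
    intro x y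
    simp only [quadPoly]
    push_cast
    ring
  refine Finset.card_le_card_of_injOn (fun p => ((p.1 : ℤ) - p.2).natAbs) ?_ ?_
  · rintro ⟨x, y⟩ hp
    have hp' := (Finset.mem_filter.1 hp).2
    rw [key] at hp'
    simp only [Finset.mem_coe, Nat.mem_divisors]
    refine ⟨?_, by simpa using hg⟩
    rw [← hp', Int.natAbs_mul]
    exact dvd_mul_right _ _
  · rintro ⟨x, y⟩ hp ⟨x', y'⟩ hp' h
    have h1 := (Finset.mem_filter.1 hp).2
    have h2 := (Finset.mem_filter.1 hp').2
    rw [key] at h1 h2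
    simp only at h h1 h2
    have hU' : (1 : ℤ) ≤ U := by exact_mod_cast hU
    have hne : (x : ℤ) - y ≠ 0 := by
      intro h0
      rw [h0, zero_mul] at h1
      exact hg h1.symm
    have hxy : (0 : ℤ) < x + y := by omega
    have hpos : (0 : ℤ) < U * (x + y) + ξ := by positivity
    rcases Int.natAbs_eq_natAbs_iff.1 h with h3 | h3
    · rw [← h2, ← h3] at h1
      have h4 := mul_left_cancel₀ hne h1
      have h5 : (U : ℤ) * (x + y) = U * (x' + y') := by linarith
      have h6 := mul_left_cancel₀ (by omega : (U : ℤ) ≠ 0) h5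
      ext <;> simp only <;> omega
    · exfalso
      have hpos' : (0 : ℤ) ≤ U * (x' + y') + ξ := by positivity
      have h4 : ((x : ℤ) - y) * ((U * (x + y) + ξ) + (U * (x' + y') + ξ)) = 0 := by
        have : (x' : ℤ) - y' = -((x : ℤ) - y) := by omega
        rw [this] at h2
        linarith
      rcases mul_eq_zero.1 h4 with h5 | h5
      · exact hne h5
      · omega

theorem correlation_one_mul_quadPoly_le {U : ℕ} (hU : 1 ≤ U) (ξ : ℕ) (s : Finset ℕ) {b : ℤ}
    (hb : b ≠ 0) {D : ℝ} (hD : ∀ n : ℕ, n ≠ 0 → (∃ x ∈ s, n ≤ quadPoly U ξ x) →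
      (n.divisors.card : ℝ) ≤ D) (hD0 : 0 ≤ D) {h : ℤ} (hh : h ≠ 0) :
    correlation s (fun _ => 1) (fun x => b * quadPoly U ξ x) h ≤ D := by
  have hsum : correlation s (fun _ => 1) (fun x => b * quadPoly U ξ x) h =
      ((s ×ˢ s).filter fun p => b * (quadPoly U ξ p.1 : ℤ) - b * quadPoly U ξ p.2 = h).card := by
    unfold correlation
    rw [← Finset.sum_product', Finset.sum_ite]
    simp
  rw [hsum]
  by_cases hdvd : b ∣ h
  · obtain ⟨g, rfl⟩ := hdvd
    have hg : g ≠ 0 := by rintro rfl; simp at hh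
    have e : ∀ p : ℕ × ℕ, (b * (quadPoly U ξ p.1 : ℤ) - b * quadPoly U ξ p.2 = b * g) ↔
        ((quadPoly U ξ p.1 : ℤ) - quadPoly U ξ p.2 = g) := by
      intro p
      rw [← mul_sub, mul_right_inj' hb]
    simp only [e]
    rcases Finset.eq_empty_or_nonempty ((s ×ˢ s).filter fun p =>
      (quadPoly U ξ p.1 : ℤ) - quadPoly U ξ p.2 = g) with he | ⟨⟨x, y⟩, hp⟩
    · rw [he]
      simpa using hD0
    · rw [Finset.mem_filter, Finset.mem_product] at hp
      have h1 := hp.2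
      simp only at h1
      have h2 : ∃ x ∈ s, g.natAbs ≤ quadPoly U ξ x := by
        rcases le_or_gt 0 g with h3 | h3
        · exact ⟨x, hp.1.1, by omega⟩
        · exact ⟨y, hp.1.2, by omega⟩
      refine le_trans ?_ (hD g.natAbs (by simpa using hg) h2)
      exact_mod_cast card_quadPoly_sub_eq_le hU ξ s hg
  · rw [Finset.filter_false_of_mem]
    · simpa using hD0
    · rintro p _ rfl
      exact hdvd (dvd_sub (dvd_mul_right _ _) (dvd_mul_right _ _))

/-! ### Correlations of the majorant -/

/-- `(2Ux + ξ)²` equals `4U (Ux² + ξx) + ξ²`, at most `4UN + 4U²`. -/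
theorem derivWeight_sq_le {U ξ N x : ℕ} (hξ : ξ ≤ 2 * U) (hUN : U ≤ N)
    (hx : quadPoly U ξ x ≤ N) : (2 * U * x + ξ : ℝ) ^ 2 ≤ 8 * U * N := by
  have h1 : (U * (x : ℝ) ^ 2 + ξ * x : ℝ) ≤ N := by exact_mod_cast hx
  have h2 : (ξ : ℝ) ≤ 2 * U := by exact_mod_cast hξ
  have h3 : (U : ℝ) ≤ N := by exact_mod_cast hUN
  have h4 : (0 : ℝ) ≤ U := Nat.cast_nonneg U
  have h5 : (ξ : ℝ) ^ 2 ≤ (2 * U) ^ 2 := by gcongr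
  nlinarith

theorem derivWeight_sq_le' {U ξ N x : ℕ} (hξ : ξ ≤ 2 * U) (hUN : U ≤ N)
    (hx : quadPoly U ξ x ≤ N) : derivWeight U ξ x ^ 2 ≤ 8 * U * N := by
  unfold derivWeight
  split_ifs
  · rw [zero_pow two_ne_zero]
    positivity
  · exact derivWeight_sq_le hξ hUN hx

theorem squareMajorant_le {U ξ N : ℕ} (hU : 1 ≤ U) (hξ : ξ ≤ 2 * U) (hUN : U ≤ N) (n : ℤ) :
    squareMajorant N (2 * U) ξ n ≤ 3 * U * (N : ℝ) ^ (1 / 2 : ℝ) := by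
  by_cases hn : n ∈ initialInterval N
  · by_cases h : ∀ x : ℕ, (quadPoly U ξ x : ℤ) ≠ n
    · rw [squareMajorant_eq_zero hU hξ hn.1 h]
      positivity
    · push Not at h
      obtain ⟨x, rfl⟩ := h
      have hxN : quadPoly U ξ x ≤ N := by exact_mod_cast hn.2
      rw [squareMajorant_quadPoly (by exact_mod_cast hn.1) hxN]
      have h1 := derivWeight_sq_le hξ hUN hxN
      refine abs_le_of_sq_le_sq' (h1.trans ?_) (by positivity) |>.2
      have hU1 : (1 : ℝ) ≤ U := by exact_mod_cast hU
      rw [mul_pow, ← Real.sqrt_eq_rpow, Real.sq_sqrt (Nat.cast_nonneg N)]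
      have : (0 : ℝ) ≤ N := Nat.cast_nonneg N
      gcongr
      nlinarith
  · unfold squareMajorant
    rw [dif_neg (fun h => hn h.1)]
    positivity

theorem sum_ite_sub_eq_le (s : Finset ℤ) {u : ℤ → ℝ} (hu : ∀ n ∈ s, 0 ≤ u n) (g : ℤ) :
    ∑ n ∈ s, ∑ m ∈ s, (if n - m = g then u n else 0) ≤ ∑ n ∈ s, u n := by
  refine Finset.sum_le_sum fun n hn => ?_
  have : ∀ m, (n - m = g) ↔ (n - g = m) := by intro m; omega
  simp only [this, Finset.sum_ite_eq]
  split_ifs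
  · rfl
  · exact hu n hn

theorem sum_ite_sub_eq_le' (s : Finset ℤ) {u : ℤ → ℝ} (hu : ∀ n ∈ s, 0 ≤ u n) (g : ℤ) :
    ∑ n ∈ s, ∑ m ∈ s, (if n - m = g then u m else 0) ≤ ∑ n ∈ s, u n := by
  rw [Finset.sum_comm]
  refine Finset.sum_le_sum fun n hn => ?_
  have : ∀ m, (m - n = g) ↔ (n + g = m) := by intro m; omega
  simp only [this, Finset.sum_ite_eq]
  split_ifs
  · rfl
  · exact hu n hn

/-- Two weights multiply to at most `8UN`, and the divisor bound limits the number of pairs. -/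
theorem correlation_squareMajorant_le {U ξ N : ℕ} (hU : 1 ≤ U) (hξ : ξ ≤ 2 * U) (hUN : U ≤ N)
    {D : ℝ} (hD : ∀ n : ℕ, n ≠ 0 → n ≤ N → (n.divisors.card : ℝ) ≤ D) (hD0 : 0 ≤ D)
    {g : ℤ} (hg : g ≠ 0) :
    correlation (Finset.Icc (1 : ℤ) N) (squareMajorant N (2 * U) ξ) id g ≤ 8 * U * N * D := by
  set s := Finset.range (lastRoot U ξ N + 1) with hs
  have hsN : ∀ x ∈ s, quadPoly U ξ x ≤ N := fun x hx =>
    (le_lastRoot_iff hU ξ N x).1 (Nat.lt_succ_iff.1 (Finset.mem_range.1 hx))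
  have e : correlation (Finset.Icc (1 : ℤ) N) (squareMajorant N (2 * U) ξ) id g =
      ∑ x ∈ s, ∑ y ∈ s, derivWeight U ξ x * derivWeight U ξ y *
        (if (quadPoly U ξ x : ℤ) - quadPoly U ξ y = g then 1 else 0) := by
    unfold correlation
    have h1 : ∀ n : ℤ, ∑ m ∈ Finset.Icc (1 : ℤ) N, (if id n - id m = g then
        squareMajorant N (2 * U) ξ n * squareMajorant N (2 * U) ξ m else 0) =
        squareMajorant N (2 * U) ξ n * ∑ y ∈ s, derivWeight U ξ y *
          (if n - quadPoly U ξ y = g then 1 else 0) := by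
      intro n
      rw [← sum_squareMajorant_mul_real hU hξ N (fun m => if n - m = g then 1 else 0),
        Finset.mul_sum]
      refine Finset.sum_congr rfl fun m _ => ?_
      simp only [id]
      split_ifs <;> simp
    simp_rw [h1]
    rw [sum_squareMajorant_mul_real hU hξ N (fun n => ∑ y ∈ s, derivWeight U ξ y *
          (if n - quadPoly U ξ y = g then 1 else 0))]
    refine Finset.sum_congr rfl fun x _ => ?_
    rw [Finset.mul_sum]
    refine Finset.sum_congr rfl fun y _ => ?_
    ring
  rw [e]
  have h2 : ∑ x ∈ s, ∑ y ∈ s, derivWeight U ξ x * derivWeight U ξ y *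
        (if (quadPoly U ξ x : ℤ) - quadPoly U ξ y = g then 1 else 0) ≤
      ∑ x ∈ s, ∑ y ∈ s, (8 * U * N : ℝ) *
        (if (1 : ℤ) * quadPoly U ξ x - 1 * quadPoly U ξ y = g then 1 * 1 else 0) := by
    refine Finset.sum_le_sum fun x hx => Finset.sum_le_sum fun y hy => ?_
    simp only [one_mul]
    have hx' := derivWeight_sq_le' hξ hUN (hsN x hx)
    have hy' := derivWeight_sq_le' hξ hUN (hsN y hy)
    have : derivWeight U ξ x * derivWeight U ξ y ≤ 8 * U * N := by
      nlinarith [sq_nonneg (derivWeight U ξ x - derivWeight U ξ y)]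
    gcongr
  refine h2.trans ?_
  simp_rw [← Finset.mul_sum]
  refine mul_le_mul_of_nonneg_left ?_ (by positivity)
  refine correlation_one_mul_quadPoly_le hU ξ s one_ne_zero ?_ hD0 hg
  rintro n hn ⟨x, hx, hnx⟩
  exact hD n hn (hnx.trans (hsN x hx))

/-- Expand `(1 + ν)(1 + ν') = (1 + ν) + ν' + νν'`. The first two parts are bounded by total masses,
`17N` and `16N`, and the third is the correlation of `ν`. -/
theorem correlation_one_add_squareMajorant_le {U ξ N : ℕ} (hU : 1 ≤ U) (hξ : ξ ≤ 2 * U)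
    (hN : (500 * U) ^ 25 ≤ N) {D : ℝ} (hD : ∀ n : ℕ, n ≠ 0 → n ≤ N → (n.divisors.card : ℝ) ≤ D)
    (hD1 : 1 ≤ D) {b : ℤ} (hb : b ≠ 0) {h : ℤ} (hh : h ≠ 0) :
    correlation (Finset.Icc (1 : ℤ) N) (fun n => 1 + squareMajorant N (2 * U) ξ n)
      (fun n => b * n) h ≤ 41 * U * N * D := by
  have hUr : (1 : ℝ) ≤ U := by exact_mod_cast hU
  have hUN : U ≤ N := by
    refine le_trans ?_ hN
    calc U ≤ 500 * U := by omega
      _ ≤ (500 * U) ^ 25 := Nat.le_self_pow (by norm_num) _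
  have hD0 : 0 ≤ D := by linarith
  have hU0 : (0 : ℝ) ≤ U := Nat.cast_nonneg U
  have hN0 : (0 : ℝ) ≤ N := Nat.cast_nonneg N
  by_cases hdvd : b ∣ h
  · obtain ⟨g, rfl⟩ := hdvd
    have hg : g ≠ 0 := by rintro rfl; simp at hh
    set ν := squareMajorant N (2 * U) ξ with hν
    have hν0 : ∀ n, 0 ≤ ν n := squareMajorant_nonneg hU hξ
    have e : correlation (Finset.Icc (1 : ℤ) N) (fun n => 1 + ν n) (fun n => b * n) (b * g) =
        ∑ n ∈ Finset.Icc (1 : ℤ) N, ∑ m ∈ Finset.Icc (1 : ℤ) N, (if n - m = g then 1 + ν n else 0) +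
        ∑ n ∈ Finset.Icc (1 : ℤ) N, ∑ m ∈ Finset.Icc (1 : ℤ) N, (if n - m = g then ν m else 0) +
        correlation (Finset.Icc (1 : ℤ) N) ν id g := by
      unfold correlation
      simp only [← Finset.sum_add_distrib]
      refine Finset.sum_congr rfl fun n _ => Finset.sum_congr rfl fun m _ => ?_
      have : (b * n - b * m = b * g) ↔ (n - m = g) := by rw [← mul_sub, mul_right_inj' hb]
      simp only [this, id]
      split_ifs <;> ring
    rw [e]
    have h1 := (sum_ite_sub_eq_le (Finset.Icc (1 : ℤ) N) (u := fun n => 1 + ν n)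
      (fun n _ => by linarith [hν0 n]) g).trans (sum_one_add_squareMajorant_le hU hξ hN)
    have h2 := (sum_ite_sub_eq_le' (Finset.Icc (1 : ℤ) N) (u := ν)
      (fun n _ => hν0 n) g).trans (sum_squareMajorant_le hU hξ hN)
    have h3 := correlation_squareMajorant_le hU hξ hUN hD hD0 hg
    have h4 : (N : ℝ) ≤ U * N * D := by
      have := mul_le_mul hUr hD1 zero_le_one hU0
      nlinarith
    linarith
  · unfold correlation
    rw [Finset.sum_eq_zero]
    · positivity
    · intro n _
      refine Finset.sum_eq_zero fun m _ => ?_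
      rw [if_neg]
      rintro rfl
      exact hdvd (dvd_sub (dvd_mul_right _ _) (dvd_mul_right _ _))

/-- The supremum of `1 + ν`, at most `4U N^{1/2}`, times its mass `17N`. -/
theorem correlation_one_add_squareMajorant_zero_le {U ξ N : ℕ} (hU : 1 ≤ U) (hξ : ξ ≤ 2 * U)
    (hN : (500 * U) ^ 25 ≤ N) {b : ℤ} (hb : b ≠ 0) :
    correlation (Finset.Icc (1 : ℤ) N) (fun n => 1 + squareMajorant N (2 * U) ξ n)
      (fun n => b * n) 0 ≤ 68 * U * (N : ℝ) ^ (1 / 2 : ℝ) * N := by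
  have hUr : (1 : ℝ) ≤ U := by exact_mod_cast hU
  have hUN : U ≤ N := by
    refine le_trans ?_ hN
    calc U ≤ 500 * U := by omega
      _ ≤ (500 * U) ^ 25 := Nat.le_self_pow (by norm_num) _
  have hNr : (1 : ℝ) ≤ N := by exact_mod_cast hU.trans hUN
  set ν := squareMajorant N (2 * U) ξ with hν
  have hν0 : ∀ n, 0 ≤ ν n := squareMajorant_nonneg hU hξ
  have e : correlation (Finset.Icc (1 : ℤ) N) (fun n => 1 + ν n) (fun n => b * n) 0 =
      ∑ n ∈ Finset.Icc (1 : ℤ) N, (1 + ν n) * (1 + ν n) := by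
    unfold correlation
    refine Finset.sum_congr rfl fun n hn => ?_
    have : ∀ m, (b * n - b * m = 0) ↔ (n = m) := by
      intro m
      rw [← mul_sub, mul_eq_zero, sub_eq_zero]
      simp [hb]
    simp only [this, Finset.sum_ite_eq, hn, if_true]
  rw [e]
  have h1 : ∀ n, 1 + ν n ≤ 4 * U * (N : ℝ) ^ (1 / 2 : ℝ) := by
    intro n
    have h2 := squareMajorant_le hU hξ hUN n
    have h3 : (1 : ℝ) ≤ (N : ℝ) ^ (1 / 2 : ℝ) := Real.one_le_rpow hNr (by norm_num)
    have h4 : (1 : ℝ) ≤ U * (N : ℝ) ^ (1 / 2 : ℝ) := by nlinarith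
    linarith
  calc _ ≤ ∑ n ∈ Finset.Icc (1 : ℤ) N, 4 * U * (N : ℝ) ^ (1 / 2 : ℝ) * (1 + ν n) :=
        Finset.sum_le_sum fun n _ => mul_le_mul_of_nonneg_right (h1 n) (by linarith [hν0 n])
    _ ≤ 4 * U * (N : ℝ) ^ (1 / 2 : ℝ) * (17 * N) := by
        rw [← Finset.mul_sum]
        exact mul_le_mul_of_nonneg_left (sum_one_add_squareMajorant_le hU hξ hN) (by positivity)
    _ = _ := by ring

/-! ### The product kernels on the major and minor arcs -/

/-- The length `N` dominates a power of the other parameters, and `M = (N / W₂) ^ (1/2)`. -/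
structure IsLarge (K U W₂ N : ℕ) (M : ℝ) : Prop where
  one_le_K : 1 ≤ K
  one_le_U : 1 ≤ U
  one_le_W₂ : 1 ≤ W₂
  M_pos : 0 < M
  M_sq : M ^ 2 * W₂ = N
  large : (10 ^ 6 * K ^ 2 * (U * W₂) : ℝ) ≤ (N : ℝ) ^ (1 / 200 : ℝ)

namespace IsLarge
variable {K U W₂ N : ℕ} {M : ℝ}

/-- Below, powers of `N` become natural powers of `y = N^{1/200}` and powers of `M` natural powers
of `z = M^{1/20}`, so that the comparison of error terms is polynomial. -/
theorem rpow_eq (_ : IsLarge K U W₂ N M) {c : ℝ} {k : ℕ} (hk : 1 / 200 * (k : ℝ) = c) :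
    (N : ℝ) ^ c = ((N : ℝ) ^ (1 / 200 : ℝ)) ^ k := by
  rw [← Real.rpow_natCast, ← Real.rpow_mul (Nat.cast_nonneg N), hk]

theorem rpow_eq_M (h : IsLarge K U W₂ N M) {c : ℝ} {k : ℕ} (hk : 1 / 20 * (k : ℝ) = c) :
    M ^ c = (M ^ (1 / 20 : ℝ)) ^ k := by
  rw [← Real.rpow_natCast, ← Real.rpow_mul h.M_pos.le, hk]

theorem million_le (h : IsLarge K U W₂ N M) {a : ℕ} (ha : a ≤ K ^ 2 * (U * W₂)) :
    (10 ^ 6 * a : ℝ) ≤ (N : ℝ) ^ (1 / 200 : ℝ) := by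
  refine le_trans ?_ h.large
  rw [mul_assoc]
  gcongr
  exact_mod_cast ha

theorem million_le_one (h : IsLarge K U W₂ N M) : (10 ^ 6 : ℝ) ≤ (N : ℝ) ^ (1 / 200 : ℝ) := by
  have := h.one_le_K
  have := h.one_le_U
  have := h.one_le_W₂
  have := h.million_le (a := 1) (Nat.succ_le_of_lt (by positivity))
  simpa using this

theorem million_le_K (h : IsLarge K U W₂ N M) : (10 ^ 6 * K : ℝ) ≤ (N : ℝ) ^ (1 / 200 : ℝ) := by
  have h1 := h.one_le_K
  have h2 : 1 ≤ U * W₂ := Nat.mul_pos h.one_le_U h.one_le_W₂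
  exact h.million_le (a := K) (by nlinarith)

theorem million_le_U (h : IsLarge K U W₂ N M) : (10 ^ 6 * U : ℝ) ≤ (N : ℝ) ^ (1 / 200 : ℝ) := by
  have h1 : 1 ≤ K ^ 2 := Nat.one_le_pow _ _ h.one_le_K
  have h2 : U ≤ U * W₂ := Nat.le_mul_of_pos_right _ h.one_le_W₂
  exact h.million_le (a := U) (by nlinarith)

theorem million_le_KW₂ (h : IsLarge K U W₂ N M) :
    (10 ^ 6 * (K * W₂) : ℝ) ≤ (N : ℝ) ^ (1 / 200 : ℝ) := by
  have h1 : K ≤ K ^ 2 := Nat.le_self_pow two_ne_zero K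
  have h2 : W₂ ≤ U * W₂ := Nat.le_mul_of_pos_left _ h.one_le_U
  have := h.million_le (a := K * W₂) (Nat.mul_le_mul h1 h2)
  exact_mod_cast this

theorem million_le_W₂ (h : IsLarge K U W₂ N M) :
    (10 ^ 6 * W₂ : ℝ) ≤ (N : ℝ) ^ (1 / 200 : ℝ) := by
  refine le_trans ?_ h.million_le_KW₂
  have : (1 : ℝ) ≤ K := by exact_mod_cast h.one_le_K
  have h2 : (0 : ℝ) ≤ W₂ := Nat.cast_nonneg _
  nlinarith

theorem N_eq (h : IsLarge K U W₂ N M) : (N : ℝ) = ((N : ℝ) ^ (1 / 200 : ℝ)) ^ 200 := by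
  rw [← h.rpow_eq (c := 1) (by norm_num), Real.rpow_one]

theorem M_eq (h : IsLarge K U W₂ N M) : M = (M ^ (1 / 20 : ℝ)) ^ 20 := by
  rw [← h.rpow_eq_M (c := 1) (by norm_num), Real.rpow_one]

/-- In the notation `y`, `z`: `z^40 W₂ = y^200` and `W₂ ≤ y`, so `z^40 ≥ y^199 ≥ y^160`. -/
theorem pow_le_rpow_M (h : IsLarge K U W₂ N M) :
    ((N : ℝ) ^ (1 / 200 : ℝ)) ^ 4 ≤ M ^ (1 / 20 : ℝ) := by
  set y := (N : ℝ) ^ (1 / 200 : ℝ) with hy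
  set z := M ^ (1 / 20 : ℝ) with hz
  have hz0 : 0 ≤ z := Real.rpow_nonneg h.M_pos.le _
  have hy1 : 10 ^ 6 ≤ y := h.million_le_one
  have hW : (W₂ : ℝ) ≤ y := by
    have := h.million_le_W₂
    have h2 : (0 : ℝ) ≤ W₂ := Nat.cast_nonneg _
    linarith
  have h1 : z ^ 40 * W₂ = y ^ 200 := by
    rw [hy, ← h.N_eq, ← h.M_sq]
    congr 1
    conv_rhs => rw [h.M_eq]
    rw [← pow_mul]
  have h2 : y ^ 200 ≤ z ^ 40 * y := by
    rw [← h1]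
    gcongr
  have hy0 : 0 < y := by linarith
  have h3 : y ^ 199 ≤ z ^ 40 := by
    have : y ^ 199 * y ≤ z ^ 40 * y := by rw [← pow_succ]; exact h2
    exact le_of_mul_le_mul_right this hy0
  have h4 : (y ^ 4) ^ 40 ≤ z ^ 40 := by
    rw [← pow_mul]
    exact (pow_le_pow_right₀ (by linarith) (by norm_num)).trans h3
  exact (pow_le_pow_iff_left₀ (by positivity) hz0 (by norm_num)).1 h4

theorem pow_25_le (h : IsLarge K U W₂ N M) : (500 * U) ^ 25 ≤ N := by
  have h1 : (500 * U : ℝ) ≤ (N : ℝ) ^ (1 / 200 : ℝ) := by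
    have := h.million_le_U
    have h2 : (0 : ℝ) ≤ U := Nat.cast_nonneg _
    linarith
  have h2 : ((500 * U : ℝ)) ^ 25 ≤ N := by
    rw [h.N_eq]
    refine (pow_le_pow_left₀ (by positivity) h1 25).trans ?_
    exact pow_le_pow_right₀ (le_trans (by norm_num) h.million_le_one) (by norm_num)
  exact_mod_cast h2

theorem pow_10_le (h : IsLarge K U W₂ N M) : (500 : ℝ) ^ 10 ≤ M := by
  rw [h.M_eq]
  have h1 : (500 : ℝ) ≤ M ^ (1 / 20 : ℝ) := by
    refine le_trans ?_ h.pow_le_rpow_M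
    refine le_trans ?_ (pow_le_pow_left₀ (by norm_num) h.million_le_one 4)
    norm_num
  refine (pow_le_pow_left₀ (by positivity) h1 10).trans ?_
  exact pow_le_pow_right₀ (by linarith) (by norm_num)

theorem one_le_N (h : IsLarge K U W₂ N M) : 1 ≤ N :=
  (Nat.one_le_pow _ _ (by have := h.one_le_U; omega)).trans h.pow_25_le

end IsLarge

theorem rpow_neg_le_mul {x y c s : ℝ} (hx : 0 < x) (hy : 0 < y) (hc : 1 ≤ c) (hs : 0 ≤ s)
    (hs1 : s ≤ 1) (h : y ≤ c * x) : x ^ (-s) ≤ c * y ^ (-s) := by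
  have hc0 : 0 < c := by linarith
  have h1 : (c * x) ^ (-s) ≤ y ^ (-s) := Real.rpow_le_rpow_of_nonpos hy h (by linarith)
  rw [Real.mul_rpow hc0.le hx.le, Real.rpow_neg hc0.le] at h1
  have h2 : c ^ s ≤ c := by
    calc c ^ s ≤ c ^ (1 : ℝ) := Real.rpow_le_rpow_of_exponent_le hc hs1
      _ = c := Real.rpow_one c
  have h3 : 0 < c ^ s := by positivity
  calc x ^ (-s) = c ^ s * ((c ^ s)⁻¹ * x ^ (-s)) := by field_simp
    _ ≤ c * y ^ (-s) := by gcongr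

theorem inv_le_rpow_neg {x s : ℝ} (hx : 1 ≤ x) (hs1 : s ≤ 1) : x⁻¹ ≤ x ^ (-s) := by
  rw [← Real.rpow_neg_one]
  exact Real.rpow_le_rpow_of_exponent_le hx (by linarith)

/-- Passing from an approximation of `b θ` to one of `θ`. -/
theorem exists_approx_of_mul {b : ℤ} {K q : ℕ} (hb : b ≠ 0) (hbK : |b| ≤ K) (hq : 1 ≤ q) (a : ℤ)
    (θ : ℝ) : ∃ (q' : ℕ) (a' : ℤ), 1 ≤ q' ∧ (q' : ℝ) ≤ q * K ∧
      θ - a' / q' = (b * θ - a / q) / b := by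
  have hb0 : (b : ℝ) ≠ 0 := by exact_mod_cast hb
  have hq0 : (q : ℝ) ≠ 0 := by positivity
  refine ⟨q * b.natAbs, a * b.sign, Nat.mul_pos hq (Int.natAbs_pos.2 hb), ?_, ?_⟩
  · push_cast
    gcongr
    have : (b.natAbs : ℤ) ≤ K := by rwa [Int.natCast_natAbs]
    exact_mod_cast this
  · have hs : (b.sign : ℝ) * b.natAbs = b := by
      have := congrArg (Int.cast : ℤ → ℝ) (Int.sign_mul_natAbs b)
      rwa [Int.cast_mul, Int.cast_natCast] at this
    have hn : (b.natAbs : ℝ) ≠ 0 := by exact_mod_cast Int.natAbs_ne_zero.2 hb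
    have hs2 : (b.sign : ℝ) * b.sign = 1 := by
      rcases lt_or_gt_of_ne hb with h | h
      · rw [Int.sign_eq_neg_one_of_neg h]; norm_num
      · rw [Int.sign_eq_one_of_pos h]; norm_num
    rw [← hs]
    have hsne : (b.sign : ℝ) ≠ 0 := by
      intro h0; rw [h0] at hs2; norm_num at hs2
    push_cast
    field_simp
    linear_combination (-(a : ℝ)) * hs2

theorem abs_approx_le {b : ℤ} (hb : b ≠ 0) (x : ℝ) : |x / b| ≤ |x| := by
  rw [abs_div]
  refine div_le_self (abs_nonneg _) ?_
  exact_mod_cast Int.one_le_abs hb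

/-- Two sufficiently good rational approximations to multiples of the same number agree. -/
theorem mul_eq_mul_of_approx {q q₂ W₂ K : ℕ} {a a₂ b₁ b₂ : ℤ} {θ y : ℝ} (hq : 1 ≤ q)
    (hq₂ : 1 ≤ q₂) (hb₁r : |(b₁ : ℝ)| ≤ K) (hb₂r : |(b₂ : ℝ)| ≤ K) (hK1 : (1 : ℝ) ≤ K)
    (hW1 : (1 : ℝ) ≤ W₂) (hy : 1 ≤ y) (hyKW : 16 * (K * W₂ : ℝ) ≤ y) (hqy : (q : ℝ) ≤ 2 * y ^ 20)
    (hq₂y : (q₂ : ℝ) ≤ 2 * y ^ 20) (hβy : |b₁ * θ - a / q| ≤ (y ^ 136)⁻¹)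
    (hβ₂y : |b₂ * W₂ * θ - a₂ / q₂| ≤ (y ^ 136)⁻¹) :
    b₂ * W₂ * a * q₂ = b₁ * a₂ * q := by
  have hy0 : 0 < y := by linarith
  have hq0 : (q : ℝ) ≠ 0 := by positivity
  have hq₂0 : (q₂ : ℝ) ≠ 0 := by positivity
  by_contra hne
  -- Otherwise the difference is a nonzero integer, while the approximations bound it by a constant
  -- times `K W₂ y^{40-136}`, less than `1`.
  have h1 : (1 : ℝ) ≤ |(b₂ : ℝ) * W₂ * a * q₂ - b₁ * a₂ * q| := by
    exact_mod_cast Int.one_le_abs (sub_ne_zero.2 hne)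
  have h2 : (b₂ : ℝ) * W₂ * a * q₂ - b₁ * a₂ * q =
      q * q₂ * (b₁ * (b₂ * W₂ * θ - a₂ / q₂) - b₂ * W₂ * (b₁ * θ - a / q)) := by
    field_simp
    ring
  have h3 : |(b₂ : ℝ) * W₂ * a * q₂ - b₁ * a₂ * q| ≤
      (2 * y ^ 20) * (2 * y ^ 20) * (K * (y ^ 136)⁻¹ + K * W₂ * (y ^ 136)⁻¹) := by
    rw [h2, abs_mul, abs_mul, Nat.abs_cast, Nat.abs_cast]
    gcongr
    refine (abs_sub _ _).trans ?_
    rw [abs_mul, abs_mul, abs_mul, Nat.abs_cast]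
    gcongr
  have hKW : (K : ℝ) ≤ K * W₂ := le_mul_of_one_le_right (by linarith) hW1
  have h4 : (2 * y ^ 20) * (2 * y ^ 20) * (K * (y ^ 136)⁻¹ + K * W₂ * (y ^ 136)⁻¹) ≤
      (4 * (y ^ 136)⁻¹ * y ^ 40) * (2 * (K * W₂)) := by
    have : 0 ≤ 4 * (y ^ 136)⁻¹ * y ^ 40 := by positivity
    nlinarith
  have h5 : (4 * (y ^ 136)⁻¹ * y ^ 40) * (2 * (K * W₂)) ≤ (y ^ 136)⁻¹ * y ^ 40 * y * (1 / 2) := by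
    have : 0 ≤ (y ^ 136)⁻¹ * y ^ 40 := by positivity
    nlinarith
  have h6 : (y ^ 136)⁻¹ * y ^ 40 * y ≤ 1 := by
    rw [mul_assoc, ← pow_succ, inv_mul_le_iff₀ (by positivity), mul_one]
    exact pow_le_pow_right₀ (by linarith) (by norm_num)
  linarith

/-- As `q` is coprime to `a`, it divides `W₂ b₂ q₂`. Only a factor at most `2` can be shared with
`W₂`, so the rest of `q` is carried by `b₂ q₂`. -/
theorem le_mul_of_mul_eq_mul {q q₂ W₂ K : ℕ} {a a₂ b₁ b₂ : ℤ} (hq : 1 ≤ q)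
    (hq₂ : 1 ≤ q₂) (hcop : IsCoprime a q) (hb₂ : b₂ ≠ 0) (hb₂K : |b₂| ≤ K) (hgcd : q.gcd W₂ ≤ 2)
    (hfrac : b₂ * W₂ * a * q₂ = b₁ * a₂ * q) : (q : ℝ) ≤ 2 * K * q₂ := by
  have h1 : (q : ℤ) ∣ (W₂ : ℤ) * (b₂ * q₂) := by
    have : (q : ℤ) ∣ (W₂ * (b₂ * q₂)) * a := ⟨b₁ * a₂, by linarith⟩
    exact hcop.symm.dvd_of_dvd_mul_right this
  have h2 : q ∣ W₂ * (b₂ * q₂).natAbs := by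
    have := Int.natAbs_dvd_natAbs.2 h1
    rwa [Int.natAbs_natCast, Int.natAbs_mul, Int.natAbs_natCast] at this
  have h3 : q ∣ q.gcd W₂ * (b₂ * q₂).natAbs :=
    (Nat.dvd_gcd (dvd_mul_right _ _) h2).trans (by rw [Nat.gcd_mul_right])
  have hpos : 0 < (b₂ * q₂).natAbs := Int.natAbs_pos.2 (mul_ne_zero hb₂ (by omega))
  have h4 : q ≤ 2 * (b₂ * q₂).natAbs :=
    (Nat.le_of_dvd (Nat.mul_pos (Nat.gcd_pos_of_pos_left _ hq) hpos) h3).trans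
      (Nat.mul_le_mul_right _ hgcd)
  have h5 : (b₂ * q₂).natAbs ≤ K * q₂ := by
    rw [Int.natAbs_mul, Int.natAbs_natCast]
    refine Nat.mul_le_mul_right _ ?_
    rw [← Int.natCast_natAbs] at hb₂K
    exact_mod_cast hb₂K
  have h6 : q ≤ 2 * (K * q₂) := h4.trans (by omega)
  have h7 : (q : ℝ) ≤ 2 * (K * q₂) := by exact_mod_cast h6
  linarith

/-! ### Pointwise bounds for the product kernels. -/

section Kernels
variable {K U W₂ N ξ : ℕ} {M s : ℝ} {b₁ b₂ : ℤ}

theorem norm_linSum_floor_le (hM : 0 < M) (φ : ℝ) : ‖linSum ⌊M⌋₊ φ‖ ≤ M :=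
  (norm_linSum_le _ _).trans (Nat.floor_le hM.le)

/-- Let `b₁θ` be near `a/q`. If `q b₁ ∤ b₂ a`, then `b₂θ` stays away from the integers and the
Dirichlet kernel is `O(q |b₁|)`, far below `M`. Otherwise `q ∣ b₂`, so `q ≤ K`, and the decay `(1 +
Nβ)⁻¹` of the majorant kernel is all that is needed. -/
theorem kernel_hat_hat (h : IsLarge K U W₂ N M) (hξ : ξ ≤ 2 * U) (hco : Nat.Coprime ξ (2 * U))
    (hb₁ : b₁ ≠ 0) (hb₂ : b₂ ≠ 0) (hb₁K : |b₁| ≤ K) (hb₂K : |b₂| ≤ K) (hs : 0 ≤ s) (hs1 : s ≤ 1)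
    (θ : ℝ) :
    ‖majorantSum U ξ N (b₁ * θ) * linSum ⌊M⌋₊ (b₂ * θ)‖ ≤ N * M * (N : ℝ) ^ (-(1 / 200) : ℝ) ∨
    ∃ (q : ℕ) (a : ℤ), 1 ≤ q ∧ ‖majorantSum U ξ N (b₁ * θ) * linSum ⌊M⌋₊ (b₂ * θ)‖ ≤
      136 * K ^ 2 * (N * M) * (q * (1 + N * |θ - a / q|)) ^ (-s) := by
  have hM := h.M_pos
  have hD := norm_linSum_floor_le hM (b₂ * θ)
  have hy := h.million_le_one
  have hyK := h.million_le_K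
  have hyz := h.pow_le_rpow_M
  set y := (N : ℝ) ^ (1 / 200 : ℝ) with hydef
  have hy0 : 0 < y := by linarith
  have hK1 : (1 : ℝ) ≤ K := by exact_mod_cast h.one_le_K
  have hyneg : (N : ℝ) ^ (-(1 / 200) : ℝ) = y⁻¹ := Real.rpow_neg (Nat.cast_nonneg N) _
  have hN0 : (0 : ℝ) < N := by exact_mod_cast h.one_le_N
  have hMy : y ^ 80 ≤ M := by
    rw [h.M_eq]
    calc y ^ 80 = (y ^ 4) ^ 20 := by ring
      _ ≤ _ := by gcongr
  rw [norm_mul, hyneg]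
  rcases norm_majorantSum_dichotomy h.one_le_U hξ hco h.pow_25_le (b₁ * θ) with
    hG | ⟨q, a, hq, hcop, hqN, hβ, -, hG⟩
  · left
    rw [h.rpow_eq (k := 196) (by norm_num), ← hydef] at hG
    calc _ ≤ (6400 * y ^ 196) * M := by gcongr
      _ ≤ (y * y ^ 196) * M := by gcongr; linarith
      _ ≤ y ^ 199 * M := by
          gcongr
          rw [← pow_succ']
          exact pow_le_pow_right₀ (by linarith) (by norm_num)
      _ = y ^ 200 * M * y⁻¹ := by field_simp
      _ = N * M * y⁻¹ := by rw [hydef, ← h.N_eq]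
  have hqr : (1 : ℝ) ≤ q := by exact_mod_cast hq
  by_cases hdvd : (q * b₁ : ℤ) ∣ b₂ * a
  · right
    have hqb : (q : ℤ) ∣ b₂ := by
      have h1 : (q : ℤ) ∣ b₂ * a := (dvd_mul_right _ _).trans hdvd
      exact hcop.symm.dvd_of_dvd_mul_right h1
    have hqK : (q : ℝ) ≤ K := by
      have h1 : (q : ℤ) ≤ |b₂| := Int.le_of_dvd (abs_pos.2 hb₂) ((dvd_abs _ _).2 hqb)
      exact_mod_cast h1.trans hb₂K
    obtain ⟨q', a', hq', hq'K, he⟩ := exists_approx_of_mul hb₁ hb₁K hq a θ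
    refine ⟨q', a', hq', ?_⟩
    have hβ' := abs_approx_le hb₁ (b₁ * θ - a / q)
    rw [← he] at hβ'
    set β := |b₁ * θ - a / q| with hβdef
    have hβ0 : 0 ≤ β := abs_nonneg _
    have hq'r : (1 : ℝ) ≤ q' := by exact_mod_cast hq'
    have h2 : (1 + N * β)⁻¹ ≤ K ^ 2 * (q' * (1 + N * |θ - a' / q'|)) ^ (-s) := by
      refine (inv_le_rpow_neg (by nlinarith) hs1).trans ?_
      refine rpow_neg_le_mul (by positivity) (by positivity) (one_le_pow₀ hK1) hs hs1 ?_
      have : (q' : ℝ) ≤ K ^ 2 := by nlinarith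
      gcongr
    have h3 : (q : ℝ) ^ (-(1 / 2) : ℝ) ≤ 1 := Real.rpow_le_one_of_one_le_of_nonpos hqr (by norm_num)
    calc _ ≤ 136 * N * ((q : ℝ) ^ (-(1 / 2) : ℝ) * (1 + N * β)⁻¹) * M := by gcongr
      _ ≤ 136 * N * (1 * (K ^ 2 * (q' * (1 + N * |θ - a' / q'|)) ^ (-s))) * M := by gcongr
      _ = _ := by ring
  · left
    have hqy : (q : ℝ) ≤ 2 * y ^ 20 := by
      rwa [h.rpow_eq (k := 20) (by norm_num), ← hydef] at hqN
    have hβy : |b₁ * θ - a / q| ≤ (y ^ 136)⁻¹ := by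
      rwa [Real.rpow_neg (Nat.cast_nonneg N), h.rpow_eq (k := 136) (by norm_num), ← hydef] at hβ
    have hb₁r : |(b₁ : ℝ)| ≤ K := by exact_mod_cast hb₁K
    have hb₂r : |(b₂ : ℝ)| ≤ K := by exact_mod_cast hb₂K
    have hD' := norm_linSum_le_of_not_dvd (m := ⌊M⌋₊) hq hb₁ hdvd (by
      calc 2 * |(b₂ : ℝ)| * q * |b₁ * θ - a / q| ≤ 2 * K * (2 * y ^ 20) * (y ^ 136)⁻¹ := by gcongr
        _ ≤ y * y ^ 20 * (y ^ 136)⁻¹ := by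
          have : (4 : ℝ) * K ≤ y := by linarith
          have := mul_le_mul_of_nonneg_right this (show 0 ≤ y ^ 20 * (y ^ 136)⁻¹ by positivity)
          linarith
        _ ≤ 1 := by
          rw [← pow_succ', mul_inv_le_iff₀ (by positivity), one_mul]
          exact pow_le_pow_right₀ (by linarith) (by norm_num))
    calc _ ≤ (17 * N) * (q * |(b₁ : ℝ)|) := by
          gcongr
          exact norm_majorantSum_le h.one_le_U hξ h.pow_25_le _
      _ ≤ (17 * N) * (2 * y ^ 20 * K) := by gcongr
      _ = N * (y ^ 20 * (34 * K)) := by ring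
      _ ≤ N * (y ^ 20 * y) := by gcongr; linarith
      _ ≤ N * y ^ 79 := by
          gcongr
          rw [← pow_succ]
          exact pow_le_pow_right₀ (by linarith) (by norm_num)
      _ = N * y ^ 80 * y⁻¹ := by field_simp
      _ ≤ N * M * y⁻¹ := by gcongr

/-- The Dirichlet kernel of length `M` only resolves the scale `1/M`, so the decay at scale `1/N`
must come from the squares; hence the power weight. When `q b₁ W₂ ∣ b₂ a`, the point `θ` is near a
fraction `m / b₂` with error `β / (b₁ W₂)`, and `M² W₂ = N` matches the two scales. -/
theorem kernel_tilde_hat {τ : ℝ} (h : IsLarge K U W₂ N M) (hτ : 0 < τ) (hτ1 : τ < 1)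
    (hb₁ : b₁ ≠ 0) (hb₂ : b₂ ≠ 0) (hb₁K : |b₁| ≤ K) (hb₂K : |b₂| ≤ K) (θ : ℝ) :
    ‖quadSum 1 0 (fun x => ((x : ℝ) / M) ^ τ) (⌊M⌋₊ + 1) (b₁ * W₂ * θ) * linSum ⌊M⌋₊ (b₂ * θ)‖ ≤
      M ^ 2 * (N : ℝ) ^ (-(1 / 200) : ℝ) ∨
    ∃ (q : ℕ) (a : ℤ), 1 ≤ q ∧
      ‖quadSum 1 0 (fun x => ((x : ℝ) / M) ^ τ) (⌊M⌋₊ + 1) (b₁ * W₂ * θ) *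
        linSum ⌊M⌋₊ (b₂ * θ)‖ ≤
      32 * K * M ^ 2 * (q * (1 + N * |θ - a / q|)) ^ (-((1 + τ) / 2)) := by
  have hM := h.M_pos
  have hD := norm_linSum_floor_le hM (b₂ * θ)
  have hS0 := norm_quadSum_powWeight_le_self hτ hM (b₁ * W₂ * θ)
  have hy := h.million_le_one
  have hyKW := h.million_le_KW₂
  have hyz := h.pow_le_rpow_M
  set S := quadSum 1 0 (fun x => ((x : ℝ) / M) ^ τ) (⌊M⌋₊ + 1) (b₁ * W₂ * θ) with hS
  set y := (N : ℝ) ^ (1 / 200 : ℝ) with hydef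
  have hy0 : 0 < y := by linarith
  have hK1 : (1 : ℝ) ≤ K := by exact_mod_cast h.one_le_K
  have hW1 : (1 : ℝ) ≤ W₂ := by exact_mod_cast h.one_le_W₂
  have hyneg : (N : ℝ) ^ (-(1 / 200) : ℝ) = y⁻¹ := Real.rpow_neg (Nat.cast_nonneg N) _
  have hN0 : (0 : ℝ) < N := by exact_mod_cast h.one_le_N
  set z := M ^ (1 / 20 : ℝ) with hzdef
  have hMz : M = z ^ 20 := h.M_eq
  have hyy : y ≤ y ^ 4 := le_self_pow₀ (by linarith) (by norm_num)
  have hyz2 : 10 ^ 6 * y ≤ z := by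
    calc 10 ^ 6 * y ≤ y * y := by gcongr
      _ = y ^ 2 := by ring
      _ ≤ y ^ 4 := pow_le_pow_right₀ (by linarith) (by norm_num)
      _ ≤ z := hyz
  have hz1 : 1 ≤ z := by linarith
  have hz0 : 0 < z := by linarith
  have hW0 : (W₂ : ℝ) ≠ 0 := by positivity
  have hc : b₁ * W₂ ≠ 0 := mul_ne_zero hb₁ (by exact_mod_cast hW0)
  rw [norm_mul, hyneg]
  rcases norm_quadSum_powWeight_dichotomy hτ hτ1 h.pow_10_le (b₁ * W₂ * θ) with
    hS1 | ⟨q, a, hq, hcop, hqM, hβ, hS1⟩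
  · left
    rw [← hS, h.rpow_eq_M (k := 19) (by norm_num), ← hzdef] at hS1
    calc _ ≤ (800 * z ^ 19) * M := by gcongr
      _ = (z ^ 19 * (800 * y)) * M * y⁻¹ := by field_simp
      _ ≤ (z ^ 19 * z) * M * y⁻¹ := by gcongr; linarith
      _ = M ^ 2 * y⁻¹ := by rw [← pow_succ, ← hMz]; ring
  rw [← hS] at hS1
  have hqr : (1 : ℝ) ≤ q := by exact_mod_cast hq
  by_cases hdvd : (q * (b₁ * W₂ : ℤ) : ℤ) ∣ b₂ * a
  · right
    obtain ⟨m, hm⟩ := hdvd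
    have hb₂0 : (b₂ : ℝ) ≠ 0 := by exact_mod_cast hb₂
    have hb₁0 : (b₁ : ℝ) ≠ 0 := by exact_mod_cast hb₁
    have hq0 : (q : ℝ) ≠ 0 := by positivity
    obtain ⟨q', a', hq', hq'K, he⟩ := exists_approx_of_mul hb₂ hb₂K le_rfl m θ
    refine ⟨q', a', hq', ?_⟩
    have hm' : (b₂ : ℝ) * a = q * (b₁ * W₂) * m := by exact_mod_cast hm
    have he' : θ - a' / q' = (b₁ * W₂ * θ - a / q) / (b₁ * W₂) := by
      rw [he]
      push_cast
      have : (a : ℝ) = q * (b₁ * W₂) * m / b₂ := by rw [eq_div_iff hb₂0, ← hm']; ring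
      rw [this]
      field_simp
    set β := |b₁ * W₂ * θ - a / q| with hβdef
    have hNβ : N * |θ - a' / q'| ≤ M ^ 2 * β := by
      rw [he', abs_div, ← hβdef, ← h.M_sq, abs_mul, Nat.abs_cast]
      have hb1 : (1 : ℝ) ≤ |(b₁ : ℝ)| := by exact_mod_cast Int.one_le_abs hb₁
      have hβ0 : 0 ≤ β := abs_nonneg _
      have e : M ^ 2 * W₂ * (β / (|(b₁ : ℝ)| * W₂)) = M ^ 2 * (β / |(b₁ : ℝ)|) := by field_simp
      rw [e]
      gcongr
      exact div_le_self hβ0 hb1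
    have hq'r : (1 : ℝ) ≤ q' := by exact_mod_cast hq'
    have h2 : (1 + M ^ 2 * β) ^ (-((1 + τ) / 2)) ≤
        K * (q' * (1 + N * |θ - a' / q'|)) ^ (-((1 + τ) / 2)) := by
      have hβ0 : 0 ≤ β := abs_nonneg _
      refine rpow_neg_le_mul (by positivity) (by positivity) hK1 (by linarith) (by linarith) ?_
      push_cast at hq'K
      rw [one_mul] at hq'K
      gcongr
    have h3 : (q : ℝ) ^ (-(1 / 2) : ℝ) ≤ 1 := Real.rpow_le_one_of_one_le_of_nonpos hqr (by norm_num)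
    calc _ ≤ 32 * M * ((q : ℝ) ^ (-(1 / 2) : ℝ) * (1 + M ^ 2 * β) ^ (-((1 + τ) / 2))) * M := by
          gcongr
      _ ≤ 32 * M * (1 * (K * (q' * (1 + N * |θ - a' / q'|)) ^ (-((1 + τ) / 2)))) * M := by gcongr
      _ = _ := by ring
  · left
    have hqz : (q : ℝ) ≤ 2 * z ^ 4 := by
      rwa [h.rpow_eq_M (k := 4) (by norm_num), ← hzdef] at hqM
    have hβz : |b₁ * W₂ * θ - a / q| ≤ (z ^ 34)⁻¹ := by
      rwa [Real.rpow_neg hM.le, h.rpow_eq_M (k := 34) (by norm_num), ← hzdef] at hβ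
    have hb₁r : |(b₁ : ℝ)| ≤ K := by exact_mod_cast hb₁K
    have hb₂r : |(b₂ : ℝ)| ≤ K := by exact_mod_cast hb₂K
    have hKy : 4 * (K * W₂ : ℝ) ≤ y := by
      have : (0 : ℝ) ≤ K * W₂ := by positivity
      linarith
    have hKz : 4 * (K : ℝ) ≤ z := by
      have : (K : ℝ) ≤ K * W₂ := le_mul_of_one_le_right (by linarith) hW1
      linarith
    have hD' := norm_linSum_le_of_not_dvd (m := ⌊M⌋₊) (θ := θ) hq hc hdvd (by
      calc 2 * |(b₂ : ℝ)| * q * |((b₁ * W₂ : ℤ) : ℝ) * θ - a / q|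
          ≤ 2 * K * (2 * z ^ 4) * (z ^ 34)⁻¹ := by
            gcongr
            push_cast
            exact hβz
        _ ≤ z * z ^ 4 * (z ^ 34)⁻¹ := by
          have := mul_le_mul_of_nonneg_right hKz (show 0 ≤ z ^ 4 * (z ^ 34)⁻¹ by positivity)
          linarith
        _ ≤ 1 := by
          rw [← pow_succ', mul_inv_le_iff₀ (by positivity), one_mul]
          exact pow_le_pow_right₀ hz1 (by norm_num))
    calc _ ≤ M * (q * |((b₁ * W₂ : ℤ) : ℝ)|) := by gcongr
      _ = M * (q * (|(b₁ : ℝ)| * W₂)) := by push_cast; rw [abs_mul, Nat.abs_cast]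
      _ ≤ M * (2 * z ^ 4 * (K * W₂)) := by gcongr
      _ = M * z ^ 4 * ((2 * (K * W₂)) * y) * y⁻¹ := by field_simp
      _ ≤ M * z ^ 4 * (y * y) * y⁻¹ := by gcongr; linarith
      _ ≤ M * z ^ 4 * (z * z) * y⁻¹ := by
          have : y ≤ z := by linarith
          gcongr
      _ = M * z ^ 6 * y⁻¹ := by ring
      _ ≤ M * z ^ 20 * y⁻¹ := by
          gcongr
          norm_num
      _ = M ^ 2 * y⁻¹ := by rw [← hMz]; ring

-- On common major arcs the kernels save `q^{-1/2}` and `q₂^{-1/2}`. Both fractions approximate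
-- multiples of the same `θ`, so they satisfy an exact relation, and `gcd(q, W₂) ≤ 2` then gives `q
-- ≤ 2K q₂`. Together the savings are `q⁻¹`, and the decay in `β` is supplied by the majorant
-- kernel.
set_option maxHeartbeats 1000000 in
theorem kernel_hat_tilde {τ : ℝ} (h : IsLarge K U W₂ N M) (hξ : ξ ≤ 2 * U)
    (hco : Nat.Coprime ξ (2 * U)) (hW : ∀ l : ℕ, l.Prime → l ∣ W₂ → l ∣ 2 * U)
    (hτ : 0 < τ) (hτ1 : τ < 1) (hb₁ : b₁ ≠ 0) (hb₂ : b₂ ≠ 0) (hb₁K : |b₁| ≤ K) (hb₂K : |b₂| ≤ K)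
    (hs : 0 ≤ s) (hs1 : s ≤ 1) (θ : ℝ) :
    ‖majorantSum U ξ N (b₁ * θ) *
        quadSum 1 0 (fun x => ((x : ℝ) / M) ^ τ) (⌊M⌋₊ + 1) (b₂ * W₂ * θ)‖ ≤
      N * M * (N : ℝ) ^ (-(1 / 200) : ℝ) ∨
    ∃ (q : ℕ) (a : ℤ), 1 ≤ q ∧ ‖majorantSum U ξ N (b₁ * θ) *
        quadSum 1 0 (fun x => ((x : ℝ) / M) ^ τ) (⌊M⌋₊ + 1) (b₂ * W₂ * θ)‖ ≤
      (8704 * K ^ 2) * (N * M) * (q * (1 + N * |θ - a / q|)) ^ (-s) := by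
  have hM := h.M_pos
  have hS0 := norm_quadSum_powWeight_le_self hτ hM (b₂ * W₂ * θ)
  have hG0 := norm_majorantSum_le h.one_le_U hξ h.pow_25_le (b₁ * θ)
  have hy := h.million_le_one
  have hyKW := h.million_le_KW₂
  have hyz := h.pow_le_rpow_M
  set S := quadSum 1 0 (fun x => ((x : ℝ) / M) ^ τ) (⌊M⌋₊ + 1) (b₂ * W₂ * θ) with hS
  set y := (N : ℝ) ^ (1 / 200 : ℝ) with hydef
  have hy0 : 0 < y := by linarith
  have hK1 : (1 : ℝ) ≤ K := by exact_mod_cast h.one_le_K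
  have hW1 : (1 : ℝ) ≤ W₂ := by exact_mod_cast h.one_le_W₂
  have hyneg : (N : ℝ) ^ (-(1 / 200) : ℝ) = y⁻¹ := Real.rpow_neg (Nat.cast_nonneg N) _
  have hN0 : (0 : ℝ) < N := by exact_mod_cast h.one_le_N
  have hNy : (N : ℝ) = y ^ 200 := h.N_eq
  set z := M ^ (1 / 20 : ℝ) with hzdef
  have hMz : M = z ^ 20 := h.M_eq
  have hyz2 : 10 ^ 6 * y ≤ z := by
    calc 10 ^ 6 * y ≤ y * y := by gcongr
      _ = y ^ 2 := by ring
      _ ≤ y ^ 4 := pow_le_pow_right₀ (by linarith) (by norm_num)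
      _ ≤ z := hyz
  have hz1 : 1 ≤ z := by linarith
  have hz0 : 0 < z := by linarith
  rw [norm_mul, hyneg]
  rcases norm_majorantSum_dichotomy h.one_le_U hξ hco h.pow_25_le (b₁ * θ) with
    hG | ⟨q, a, hq, hcop, hqN, hβ, hgcd, hG⟩
  · left
    rw [h.rpow_eq (k := 196) (by norm_num), ← hydef] at hG
    calc _ ≤ (6400 * y ^ 196) * M := by gcongr
      _ ≤ (y * y ^ 196) * M := by gcongr; linarith
      _ ≤ y ^ 199 * M := by
          gcongr
          rw [← pow_succ']
          exact pow_le_pow_right₀ (by linarith) (by norm_num)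
      _ = y ^ 200 * M * y⁻¹ := by field_simp
      _ = N * M * y⁻¹ := by rw [hNy]
  rcases norm_quadSum_powWeight_dichotomy hτ hτ1 h.pow_10_le (b₂ * W₂ * θ) with
    hS1 | ⟨q₂, a₂, hq₂, hcop₂, hq₂M, hβ₂, hS1⟩
  · left
    rw [← hS, h.rpow_eq_M (k := 19) (by norm_num), ← hzdef] at hS1
    calc _ ≤ (17 * N) * (800 * z ^ 19) := by gcongr
      _ = N * (z ^ 19 * (13600 * y)) * y⁻¹ := by field_simp; norm_num
      _ ≤ N * (z ^ 19 * z) * y⁻¹ := by gcongr; linarith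
      _ = N * M * y⁻¹ := by rw [← pow_succ, ← hMz]
  right
  rw [← hS] at hS1
  have hqr : (1 : ℝ) ≤ q := by exact_mod_cast hq
  have hq₂r : (1 : ℝ) ≤ q₂ := by exact_mod_cast hq₂
  have hq0 : (q : ℝ) ≠ 0 := by positivity
  have hq₂0 : (q₂ : ℝ) ≠ 0 := by positivity
  have hb₁r : |(b₁ : ℝ)| ≤ K := by exact_mod_cast hb₁K
  have hb₂r : |(b₂ : ℝ)| ≤ K := by exact_mod_cast hb₂K
  have hqy : (q : ℝ) ≤ 2 * y ^ 20 := by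
    rwa [h.rpow_eq (k := 20) (by norm_num), ← hydef] at hqN
  have hβy : |b₁ * θ - a / q| ≤ (y ^ 136)⁻¹ := by
    rwa [Real.rpow_neg (Nat.cast_nonneg N), h.rpow_eq (k := 136) (by norm_num), ← hydef] at hβ
  have hMN : M ^ 2 ≤ N := by
    rw [← h.M_sq]
    exact le_mul_of_one_le_right (by positivity) hW1
  have hzy : z ≤ y ^ 5 := by
    rw [← pow_le_pow_iff_left₀ hz0.le (by positivity) (show 40 ≠ 0 by norm_num), ← pow_mul]
    calc z ^ 40 = M ^ 2 := by rw [hMz, ← pow_mul]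
      _ ≤ y ^ (5 * 40) := hMN.trans hNy.le
  have hq₂y : (q₂ : ℝ) ≤ 2 * y ^ 20 := by
    rw [h.rpow_eq_M (k := 4) (by norm_num), ← hzdef] at hq₂M
    refine hq₂M.trans ?_
    calc 2 * z ^ 4 ≤ 2 * (y ^ 5) ^ 4 := by gcongr
      _ = _ := by ring
  have hβ₂y : |b₂ * W₂ * θ - a₂ / q₂| ≤ (y ^ 136)⁻¹ := by
    rw [Real.rpow_neg hM.le, h.rpow_eq_M (k := 34) (by norm_num), ← hzdef] at hβ₂
    refine hβ₂.trans ?_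
    gcongr
    calc y ^ 136 = (y ^ 4) ^ 34 := by ring
      _ ≤ z ^ 34 := by gcongr
  have hfrac : b₂ * W₂ * a * q₂ = b₁ * a₂ * q :=
    mul_eq_mul_of_approx hq hq₂ hb₁r hb₂r hK1 hW1 (by linarith) (by
      have : (0 : ℝ) ≤ K * W₂ := by positivity
      linarith) hqy hq₂y hβy hβ₂y
  have hqq₂ : (q : ℝ) ≤ 2 * K * q₂ :=
    le_mul_of_mul_eq_mul hq hq₂ hcop hb₂ hb₂K (hgcd W₂ hW) hfrac
  obtain ⟨q', a', hq', hq'K, he⟩ := exists_approx_of_mul hb₁ hb₁K hq a θ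
  refine ⟨q', a', hq', ?_⟩
  have hβ' := abs_approx_le hb₁ (b₁ * θ - a / q)
  rw [← he] at hβ'
  set β := |b₁ * θ - a / q| with hβdef
  have hβ0 : 0 ≤ β := abs_nonneg _
  have hq'r : (1 : ℝ) ≤ q' := by exact_mod_cast hq'
  have hβ1 : 1 ≤ 1 + N * β := by nlinarith
  have h1 : (q₂ : ℝ) ^ (-(1 / 2) : ℝ) ≤ 2 * K * (q : ℝ) ^ (-(1 / 2) : ℝ) :=
    rpow_neg_le_mul (by positivity) (by positivity) (by linarith) (by norm_num) (by norm_num) hqq₂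
  have h2 : (q * (1 + N * β))⁻¹ ≤ K * (q' * (1 + N * |θ - a' / q'|)) ^ (-s) := by
    refine (inv_le_rpow_neg (by nlinarith) hs1).trans ?_
    refine rpow_neg_le_mul (by positivity) (by positivity) hK1 hs hs1 ?_
    calc (q' : ℝ) * (1 + N * |θ - a' / q'|) ≤ (q * K) * (1 + N * β) := by gcongr
      _ = _ := by ring
  have h3 : (1 + M ^ 2 * |b₂ * W₂ * θ - a₂ / q₂|) ^ (-((1 + τ) / 2)) ≤ 1 := by
    refine Real.rpow_le_one_of_one_le_of_nonpos ?_ (by linarith)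
    have : 0 ≤ M ^ 2 * |b₂ * W₂ * θ - a₂ / q₂| := by positivity
    linarith
  have h4 : (q : ℝ) ^ (-(1 / 2) : ℝ) * (q : ℝ) ^ (-(1 / 2) : ℝ) = (q : ℝ)⁻¹ := by
    rw [← Real.rpow_add (by positivity), ← Real.rpow_neg_one]
    norm_num
  calc _ ≤ (136 * N * ((q : ℝ) ^ (-(1 / 2) : ℝ) * (1 + N * β)⁻¹)) *
        (32 * M * ((2 * K * (q : ℝ) ^ (-(1 / 2) : ℝ)) * 1)) := by
        refine mul_le_mul hG (hS1.trans ?_) (norm_nonneg _) (by positivity)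
        gcongr
    _ = 8704 * K * (N * M) * (((q : ℝ) ^ (-(1 / 2) : ℝ) * (q : ℝ) ^ (-(1 / 2) : ℝ)) *
        (1 + N * β)⁻¹) := by ring
    _ = 8704 * K * (N * M) * (q * (1 + N * β))⁻¹ := by rw [h4, mul_inv]
    _ ≤ 8704 * K * (N * M) * (K * (q' * (1 + N * |θ - a' / q'|)) ^ (-s)) := by gcongr
    _ = _ := by ring

/-- Without a second factor only `q^{-1/2}` is available, and the decay in `β` is weakened to the
same exponent. -/
theorem kernel_hat (h : IsLarge K U W₂ N M) (hξ : ξ ≤ 2 * U) (hco : Nat.Coprime ξ (2 * U))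
    (θ : ℝ) :
    ‖majorantSum U ξ N θ‖ ≤ N * (N : ℝ) ^ (-(1 / 200) : ℝ) ∨
    ∃ (q : ℕ) (a : ℤ), 1 ≤ q ∧ ‖majorantSum U ξ N θ‖ ≤
      136 * N * (q * (1 + N * |θ - a / q|)) ^ (-(1 / 2) : ℝ) := by
  have hy := h.million_le_one
  set y := (N : ℝ) ^ (1 / 200 : ℝ) with hydef
  have hy0 : 0 < y := by linarith
  have hyneg : (N : ℝ) ^ (-(1 / 200) : ℝ) = y⁻¹ := Real.rpow_neg (Nat.cast_nonneg N) _
  rw [hyneg]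
  rcases norm_majorantSum_dichotomy h.one_le_U hξ hco h.pow_25_le θ with
    hG | ⟨q, a, hq, hcop, hqN, hβ, -, hG⟩
  · left
    rw [h.rpow_eq (k := 196) (by norm_num), ← hydef] at hG
    calc _ ≤ 6400 * y ^ 196 := hG
      _ ≤ y * y ^ 196 := by gcongr; linarith
      _ ≤ y ^ 199 := by
          rw [← pow_succ']
          exact pow_le_pow_right₀ (by linarith) (by norm_num)
      _ = y ^ 200 * y⁻¹ := by field_simp
      _ = N * y⁻¹ := by rw [hydef, ← h.N_eq]
  · right
    refine ⟨q, a, hq, hG.trans ?_⟩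
    have h1 : (1 : ℝ) ≤ 1 + N * |θ - a / q| := by
      have : 0 ≤ (N : ℝ) * |θ - a / q| := by positivity
      linarith
    rw [Real.mul_rpow (by positivity) (by positivity)]
    have := inv_le_rpow_neg h1 (show (1 / 2 : ℝ) ≤ 1 by norm_num)
    gcongr

end Kernels

/-! ### Restriction estimates for products -/

theorem expSum_majorant (U ξ N : ℕ) (b : ℤ) (θ : ℝ) :
    expSum (Finset.Icc (1 : ℤ) N) (fun n => ((1 + squareMajorant N (2 * U) ξ n : ℝ) : ℂ))
      (fun n => b * n) θ = majorantSum U ξ N (b * θ) := by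
  unfold expSum majorantSum
  refine Finset.sum_congr rfl fun n _ => ?_
  congr 2
  push_cast
  ring

theorem expSum_linear (m : ℕ) (b : ℤ) (θ : ℝ) :
    expSum (Finset.Icc 1 m) (fun _ => ((1 : ℝ) : ℂ)) (fun x : ℕ => b * (x : ℤ)) θ =
      linSum m (b * θ) := by
  unfold expSum linSum
  refine Finset.sum_congr rfl fun n _ => ?_
  rw [Complex.ofReal_one, one_mul]
  congr 1
  push_cast
  ring

theorem expSum_square {τ : ℝ} (hτ : 0 < τ) (M : ℝ) (b : ℤ) (W : ℕ) (θ : ℝ) :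
    expSum (Finset.Icc 1 ⌊M⌋₊) (fun x : ℕ => ((((x : ℝ) / M) ^ τ : ℝ) : ℂ))
      (fun x : ℕ => b * W * (quadPoly 1 0 x : ℤ)) θ =
      quadSum 1 0 (fun x => ((x : ℝ) / M) ^ τ) (⌊M⌋₊ + 1) (b * W * θ) := by
  unfold expSum quadSum
  have hsub : Finset.Icc 1 ⌊M⌋₊ ⊆ Finset.range (⌊M⌋₊ + 1) := fun x hx =>
    Finset.mem_range.2 (Nat.lt_succ_of_le (Finset.mem_Icc.1 hx).2)
  rw [← Finset.sum_subset hsub]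
  · refine Finset.sum_congr rfl fun n _ => ?_
    congr 2
    push_cast
    ring
  · intro x hx hx'
    have : x = 0 := by
      rw [Finset.mem_range] at hx
      rw [Finset.mem_Icc] at hx'
      omega
    rw [this]
    simp [Real.zero_rpow hτ.ne']

/-- The abstract restriction theorem for a product of two exponential sums. -/
theorem exists_integral_mul_rpow_le {p C₀ : ℝ} (hp : 2 < p) (hC₀ : 1 ≤ C₀) :
    ∃ ε C : ℝ, 0 < ε ∧ 0 ≤ C ∧ ∀ (ι κ : Type) (s : Finset ι) (t : Finset κ) (c : ι → ℂ) (d : κ → ℂ)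
      (k : ι → ℤ) (l : κ → ℤ) (ω₁ v₁ : ι → ℝ) (ω₂ v₂ : κ → ℝ) (N : ℕ) (T : ℝ), 0 < N → 0 < T →
      (∀ i ∈ s, 0 ≤ ω₁ i) → (∀ i ∈ s, 0 ≤ v₁ i) → (∀ j ∈ t, 0 ≤ ω₂ j) → (∀ j ∈ t, 0 ≤ v₂ j) →
      (∀ i ∈ s, ‖c i‖ ^ 2 ≤ ω₁ i * v₁ i) → (∀ j ∈ t, ‖d j‖ ^ 2 ≤ ω₂ j * v₂ j) →
      (∑ i ∈ s, ω₁ i) * ∑ j ∈ t, ω₂ j ≤ T → (∑ i ∈ s, v₁ i) * ∑ j ∈ t, v₂ j ≤ T →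
      (∀ θ : ℝ, ‖expSum s (fun i => (ω₁ i : ℂ)) k θ * expSum t (fun j => (ω₂ j : ℂ)) l θ‖ ≤
          T * (N : ℝ) ^ (-(1 / 200) : ℝ) ∨
        ∃ (q : ℕ) (a : ℤ), 1 ≤ q ∧
          ‖expSum s (fun i => (ω₁ i : ℂ)) k θ * expSum t (fun j => (ω₂ j : ℂ)) l θ‖ ≤
            C₀ * T * (q * (1 + N * |θ - a / q|)) ^ (-((1 + 2 / p) / 2))) →
      ∫ α in (0 : ℝ)..1, ‖expSum s c k α * expSum t d l α‖ ^ 2 ≤ T ^ 2 * (N : ℝ) ^ (-1 + ε) →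
      ∫ α in (0 : ℝ)..1, ‖expSum s c k α * expSum t d l α‖ ^ p ≤ C * T ^ p / N := by
  have hp0 : 0 < p := by linarith
  have h2p : 2 / p < 1 := by rw [div_lt_one hp0]; exact hp
  have h2p0 : 0 < 2 / p := by positivity
  have hsp : 2 / ((1 + 2 / p) / 2) < p := by
    rw [div_lt_iff₀ (by positivity)]
    have : p * ((1 + 2 / p) / 2) = p / 2 + 1 := by field_simp
    linarith
  obtain ⟨ε, C, hε, hC, H⟩ := exists_integral_norm_rpow_le (s := (1 + 2 / p) / 2) (p := p) (p₀ := 2)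
    (η := 1 / 200) (C₀ := C₀) (by positivity) (by linarith) hsp (by norm_num) hp (by norm_num) hC₀
  refine ⟨ε, C, hε, hC, ?_⟩
  intro ι κ s t c d k l ω₁ v₁ ω₂ v₂ N T hN hT hω₁ hv₁ hω₂ hv₂ hc hd hω hv hK hL
  -- The product is one exponential sum over pairs, with frequencies added and weights multiplied.
  have hmain := H (ι × κ) (s ×ˢ t) (fun p => c p.1 * d p.2) (fun p => ω₁ p.1 * ω₂ p.2)
    (fun p => v₁ p.1 * v₂ p.2) (fun p => k p.1 + l p.2) N T hN hT
    (fun p hp => mul_nonneg (hω₁ _ (Finset.mem_product.1 hp).1) (hω₂ _ (Finset.mem_product.1 hp).2))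
    (fun p hp => mul_nonneg (hv₁ _ (Finset.mem_product.1 hp).1) (hv₂ _ (Finset.mem_product.1 hp).2))
    (fun p hp => by
      have h1 := hc _ (Finset.mem_product.1 hp).1
      have h2 := hd _ (Finset.mem_product.1 hp).2
      rw [norm_mul, mul_pow]
      calc _ ≤ (ω₁ p.1 * v₁ p.1) * (ω₂ p.2 * v₂ p.2) :=
            mul_le_mul h1 h2 (by positivity) ((sq_nonneg _).trans h1)
        _ = _ := by ring)
    (by rwa [Finset.sum_mul_sum, ← Finset.sum_product'] at hω)
    (by rwa [Finset.sum_mul_sum, ← Finset.sum_product'] at hv)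
  have e : ∀ θ, expSum (s ×ˢ t) (fun p => ((ω₁ p.1 * ω₂ p.2 : ℝ) : ℂ))
      (fun p => k p.1 + l p.2) θ =
      expSum s (fun i => (ω₁ i : ℂ)) k θ * expSum t (fun j => (ω₂ j : ℂ)) l θ := by
    intro θ
    rw [← expSum_product]
    simp only [Complex.ofReal_mul]
  simp only [e, expSum_product] at hmain
  refine hmain hK ?_
  simpa only [Real.rpow_two] using hL

/-! ### Second and fourth moments with a power loss -/

section Lossy
variable {K U W₂ N ξ : ℕ} {M ε Cd : ℝ}

theorem card_divisors_le_of_le (hε : 0 ≤ ε) (hCd : 0 ≤ Cd)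
    (hd : ∀ n : ℕ, n ≠ 0 → (n.divisors.card : ℝ) ≤ Cd * (n : ℝ) ^ (ε / 2)) {n : ℕ} (hn : n ≠ 0)
    (hnN : n ≤ N) : (n.divisors.card : ℝ) ≤ Cd * (N : ℝ) ^ (ε / 2) := by
  refine (hd n hn).trans ?_
  gcongr

theorem rpow_half_mul_self (N : ℕ) (ε : ℝ) (hN : 0 < N) :
    (N : ℝ) ^ (ε / 2) * (N : ℝ) ^ (ε / 2) = (N : ℝ) ^ ε := by
  rw [← Real.rpow_add (by exact_mod_cast hN)]
  ring_nf

theorem rpow_sub_one (N : ℕ) (ε : ℝ) (hN : 0 < N) : N * (N : ℝ) ^ (-1 + ε) = (N : ℝ) ^ ε := by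
  have hN' : (0 : ℝ) < N := by exact_mod_cast hN
  rw [Real.rpow_add hN', Real.rpow_neg_one, ← mul_assoc, mul_inv_cancel₀ hN'.ne', one_mul]

/-- Counting solutions: nonzero differences are controlled by the divisor bound. The diagonal is
`O(U N^{1/2} · N · M)`, which is affordable because `N^{1/2} ≤ W₂ M`. -/
theorem integral_hat_mul_sq_le (h : IsLarge K U W₂ N M) (hξ : ξ ≤ 2 * U) (hε : 0 < ε)
    (hCd : 1 ≤ Cd) (hd : ∀ n : ℕ, n ≠ 0 → (n.divisors.card : ℝ) ≤ Cd * (n : ℝ) ^ (ε / 2))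
    (hbig : 68 * Cd * (U * W₂) ≤ (N : ℝ) ^ (ε / 2)) {c : ℤ → ℂ}
    (hc : ∀ n ∈ Finset.Icc (1 : ℤ) N, ‖c n‖ ≤ 1 + squareMajorant N (2 * U) ξ n) {b : ℤ} (hb : b ≠ 0)
    {d : ℕ → ℂ} (hd1 : ∀ j ∈ Finset.Icc 1 ⌊M⌋₊, ‖d j‖ ≤ 1) {l : ℕ → ℤ}
    (hl : Set.InjOn l (Finset.Icc 1 ⌊M⌋₊)) :
    ∫ α in (0 : ℝ)..1, ‖expSum (Finset.Icc (1 : ℤ) N) c (fun n => b * n) α *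
      expSum (Finset.Icc 1 ⌊M⌋₊) d l α‖ ^ 2 ≤ 2 * (N * M) ^ 2 * (N : ℝ) ^ (-1 + ε) := by
  have hN := h.one_le_N
  have hNr : (1 : ℝ) ≤ N := by exact_mod_cast hN
  have hN0 : (0 : ℝ) < N := by linarith
  have hU1 : (1 : ℝ) ≤ U := by exact_mod_cast h.one_le_U
  have hW1 : (1 : ℝ) ≤ W₂ := by exact_mod_cast h.one_le_W₂
  have hUW : (U : ℝ) ≤ U * W₂ := le_mul_of_one_le_right (by linarith) hW1
  have hM := h.M_pos
  have hR1 : 1 ≤ (N : ℝ) ^ (ε / 2) := Real.one_le_rpow hNr (by positivity)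
  have hRR := rpow_half_mul_self N ε hN
  have hR := rpow_sub_one N ε hN
  set R := (N : ℝ) ^ (ε / 2) with hRdef
  have hfloor : (⌊M⌋₊ : ℝ) ≤ M := Nat.floor_le hM.le
  have h1 := integral_norm_expSum_product_sq_le (Finset.Icc (1 : ℤ) N) (Finset.Icc 1 ⌊M⌋₊) d
    (fun n => b * n) l hc (correlation_one_add_squareMajorant_zero_le h.one_le_U hξ h.pow_25_le hb)
    (fun g hg => correlation_one_add_squareMajorant_le h.one_le_U hξ h.pow_25_le
      (fun n hn hnN => card_divisors_le_of_le hε.le (by linarith) hd hn hnN)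
      (one_le_mul_of_one_le_of_one_le hCd hR1) hb hg) (by positivity)
  simp only [expSum_product] at h1
  refine h1.trans ?_
  have h2 : ∑ j ∈ Finset.Icc 1 ⌊M⌋₊, ‖d j‖ ≤ M := by
    refine (Finset.sum_le_sum hd1).trans ?_
    simpa using hfloor
  have h3 : ∑ j ∈ Finset.Icc 1 ⌊M⌋₊, ∑ j' ∈ Finset.Icc 1 ⌊M⌋₊,
      (if l j = l j' then ‖d j‖ * ‖d j'‖ else 0) ≤ M := by
    refine (sum_sum_ite_le_of_injOn _ hl hd1).trans ?_
    simpa using hfloor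
  have h4 : (N : ℝ) ^ (1 / 2 : ℝ) ≤ W₂ * M := by
    rw [← Real.sqrt_eq_rpow]
    refine Real.sqrt_le_iff.2 ⟨by positivity, ?_⟩
    rw [← h.M_sq, mul_pow]
    have : M ^ 2 * W₂ * 1 ≤ M ^ 2 * W₂ * W₂ := by gcongr
    nlinarith
  have hUC : 41 * U * Cd ≤ R := by
    have : Cd * U ≤ Cd * (U * W₂) := by gcongr
    have h0 : 0 ≤ Cd * U := by positivity
    linarith
  have hUW' : 68 * (U * W₂) ≤ R := by
    have : 1 * (U * W₂ : ℝ) ≤ Cd * (U * W₂) := by gcongr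
    linarith
  calc _ ≤ 41 * U * N * (Cd * R) * M ^ 2 + 68 * U * (W₂ * M) * N * M := by
        gcongr
    _ = N * M ^ 2 * ((41 * U * Cd) * R + (68 * (U * W₂)) * 1) := by ring
    _ ≤ N * M ^ 2 * (R * R + R * R) := by gcongr
    _ = 2 * (N * M ^ 2) * (N * (N : ℝ) ^ (-1 + ε)) := by rw [hRR, hR]; ring
    _ = _ := by ring

/-- The squares are distinct, and a nonzero difference of two of them has few representations. The
target is `M² N^ε / W₂`, so the hypothesis `hbig` also absorbs a factor `W₂`. -/
theorem integral_tilde_mul_hat_sq_le (h : IsLarge K U W₂ N M) (hε : 0 < ε)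
    (hCd : 1 ≤ Cd) (hd : ∀ n : ℕ, n ≠ 0 → (n.divisors.card : ℝ) ≤ Cd * (n : ℝ) ^ (ε / 2))
    (hbig : 68 * Cd * (U * W₂) ≤ (N : ℝ) ^ (ε / 2)) {c : ℕ → ℂ}
    (hc : ∀ n ∈ Finset.Icc 1 ⌊M⌋₊, ‖c n‖ ≤ 1) {b₁ b₂ : ℤ} (hb₁ : b₁ ≠ 0) (hb₂ : b₂ ≠ 0) :
    ∫ α in (0 : ℝ)..1, ‖expSum (Finset.Icc 1 ⌊M⌋₊) c (fun x => b₁ * W₂ * (quadPoly 1 0 x : ℤ)) α *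
      expSum (Finset.Icc 1 ⌊M⌋₊) c (fun x => b₂ * (x : ℤ)) α‖ ^ 2 ≤
      (M ^ 2) ^ 2 * (N : ℝ) ^ (-1 + ε) := by
  have hN := h.one_le_N
  have hNr : (1 : ℝ) ≤ N := by exact_mod_cast hN
  have hN0 : (0 : ℝ) < N := by linarith
  have hU1 : (1 : ℝ) ≤ U := by exact_mod_cast h.one_le_U
  have hW1 : (1 : ℝ) ≤ W₂ := by exact_mod_cast h.one_le_W₂
  have hUW : (W₂ : ℝ) ≤ U * W₂ := le_mul_of_one_le_left (by linarith) hU1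
  have hM := h.M_pos
  have hR1 : 1 ≤ (N : ℝ) ^ (ε / 2) := Real.one_le_rpow hNr (by positivity)
  have hRR := rpow_half_mul_self N ε hN
  have hR := rpow_sub_one N ε hN
  set R := (N : ℝ) ^ (ε / 2) with hRdef
  have hfloor : (⌊M⌋₊ : ℝ) ≤ M := Nat.floor_le hM.le
  have hbW : b₁ * (W₂ : ℤ) ≠ 0 :=
    mul_ne_zero hb₁ (by have := h.one_le_W₂; omega)
  have hinj1 : Function.Injective fun x : ℕ => b₁ * W₂ * (quadPoly 1 0 x : ℤ) := by
    intro x y hxy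
    have h1 := mul_left_cancel₀ hbW hxy
    exact (quadPoly_strictMono le_rfl 0).injective (by exact_mod_cast h1)
  have hinj2 : Function.Injective fun x : ℕ => b₂ * (x : ℤ) := by
    intro x y hxy
    exact_mod_cast mul_left_cancel₀ hb₂ hxy
  have hzero : correlation (Finset.Icc 1 ⌊M⌋₊) (fun _ => 1)
      (fun x => b₁ * W₂ * (quadPoly 1 0 x : ℤ)) 0 ≤ M := by
    have := sum_sum_ite_le_of_injOn (Finset.Icc 1 ⌊M⌋₊) (d := fun _ => 1)
      (l := fun x => b₁ * W₂ * (quadPoly 1 0 x : ℤ)) hinj1.injOn (by simp)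
    unfold correlation
    simp only [norm_one, ← sub_eq_zero (a := b₁ * (W₂ : ℤ) * _)] at this
    exact this.trans (by simpa using hfloor)
  have hval : ∀ n : ℕ, n ≠ 0 → (∃ x ∈ Finset.Icc 1 ⌊M⌋₊, n ≤ quadPoly 1 0 x) →
      (n.divisors.card : ℝ) ≤ Cd * R := by
    rintro n hn ⟨x, hx, hnx⟩
    refine card_divisors_le_of_le hε.le (by linarith) hd hn (hnx.trans ?_)
    have hxM : (x : ℝ) ≤ M := (by exact_mod_cast (Finset.mem_Icc.1 hx).2 : (x : ℝ) ≤ ⌊M⌋₊).trans hfloor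
    have h2 : ((quadPoly 1 0 x : ℕ) : ℝ) ≤ N := by
      rw [← h.M_sq]
      simp only [quadPoly]
      push_cast
      have : (x : ℝ) ^ 2 ≤ M ^ 2 := by gcongr
      nlinarith [sq_nonneg M]
    exact_mod_cast h2
  have h1 := integral_norm_expSum_product_sq_le (Finset.Icc 1 ⌊M⌋₊) (Finset.Icc 1 ⌊M⌋₊) c
    (fun x => b₁ * W₂ * (quadPoly 1 0 x : ℤ)) (fun x => b₂ * (x : ℤ)) hc hzero
    (fun g hg => correlation_one_mul_quadPoly_le le_rfl 0 _ hbW hval (by positivity) hg)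
    (by positivity)
  have e := fun α => expSum_product (Finset.Icc 1 ⌊M⌋₊) (Finset.Icc 1 ⌊M⌋₊) c c
    (fun x => b₁ * W₂ * (quadPoly 1 0 x : ℤ)) (fun x => b₂ * (x : ℤ)) α
  simp only [e] at h1
  refine h1.trans ?_
  have h2 : ∑ j ∈ Finset.Icc 1 ⌊M⌋₊, ‖c j‖ ≤ M := by
    refine (Finset.sum_le_sum hc).trans ?_
    simpa using hfloor
  have h3 : ∑ j ∈ Finset.Icc 1 ⌊M⌋₊, ∑ j' ∈ Finset.Icc 1 ⌊M⌋₊,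
      (if b₂ * (j : ℤ) = b₂ * (j' : ℤ) then ‖c j‖ * ‖c j'‖ else 0) ≤ M := by
    refine (sum_sum_ite_le_of_injOn _ hinj2.injOn hc).trans ?_
    simpa using hfloor
  have hUC : 2 * Cd * W₂ ≤ R := by
    have : Cd * W₂ ≤ Cd * (U * W₂) := by gcongr
    have h0 : 0 ≤ Cd * W₂ := by positivity
    linarith
  have hW0 : (W₂ : ℝ) ≠ 0 := by positivity
  have hCR : 1 ≤ Cd * R := one_le_mul_of_one_le_of_one_le hCd hR1
  calc _ ≤ Cd * R * M ^ 2 + M * M := by gcongr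
    _ ≤ Cd * R * M ^ 2 + (Cd * R) * (M * M) := by
        have := mul_le_mul_of_nonneg_right hCR (show 0 ≤ M * M by positivity)
        linarith
    _ = M ^ 2 * ((2 * Cd * W₂) * R) / W₂ := by field_simp; ring
    _ ≤ M ^ 2 * (R * R) / W₂ := by gcongr
    _ = M ^ 2 * (M ^ 2 * W₂ * (N : ℝ) ^ (-1 + ε)) / W₂ := by rw [hRR, ← hR, h.M_sq]
    _ = _ := by field_simp

/-- The fourth moment is the second moment of the product of the sum with itself. -/
theorem integral_hat_pow_four_le (h : IsLarge K U W₂ N M) (hξ : ξ ≤ 2 * U) (hε : 0 < ε)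
    (hCd : 1 ≤ Cd) (hd : ∀ n : ℕ, n ≠ 0 → (n.divisors.card : ℝ) ≤ Cd * (n : ℝ) ^ (ε / 2))
    (hbig : 68 * Cd * (U * W₂) ≤ (N : ℝ) ^ (ε / 2)) {c : ℤ → ℂ}
    (hc : ∀ n ∈ Finset.Icc (1 : ℤ) N, ‖c n‖ ≤ 1 + squareMajorant N (2 * U) ξ n) :
    ∫ α in (0 : ℝ)..1, ‖expSum (Finset.Icc (1 : ℤ) N) c (fun n => 1 * n) α‖ ^ 4 ≤
      (17 * N) ^ 4 * (N : ℝ) ^ (-1 + ε) := by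
  have hN := h.one_le_N
  have hNr : (1 : ℝ) ≤ N := by exact_mod_cast hN
  have hN0 : (0 : ℝ) < N := by linarith
  have hU1 : (1 : ℝ) ≤ U := by exact_mod_cast h.one_le_U
  have hW1 : (1 : ℝ) ≤ W₂ := by exact_mod_cast h.one_le_W₂
  have hUW : (U : ℝ) ≤ U * W₂ := le_mul_of_one_le_right (by linarith) hW1
  have hR1 : 1 ≤ (N : ℝ) ^ (ε / 2) := Real.one_le_rpow hNr (by positivity)
  have hRR := rpow_half_mul_self N ε hN
  have hR := rpow_sub_one N ε hN
  set R := (N : ℝ) ^ (ε / 2) with hRdef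
  have hcorr := correlation_one_add_squareMajorant_zero_le h.one_le_U hξ h.pow_25_le
    (one_ne_zero (α := ℤ))
  have h1 := integral_norm_expSum_product_sq_le (Finset.Icc (1 : ℤ) N) (Finset.Icc (1 : ℤ) N) c
    (fun n => 1 * n) (fun n => 1 * n) hc hcorr
    (fun g hg => correlation_one_add_squareMajorant_le h.one_le_U hξ h.pow_25_le
      (fun n hn hnN => card_divisors_le_of_le hε.le (by linarith) hd hn hnN)
      (one_le_mul_of_one_le_of_one_le hCd hR1) one_ne_zero hg) (by positivity)
  simp only [expSum_product] at h1
  have e : ∀ x : ℂ, ‖x * x‖ ^ 2 = ‖x‖ ^ 4 := by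
    intro x
    rw [norm_mul]
    ring
  simp only [e] at h1
  refine h1.trans ?_
  have h2 : ∑ j ∈ Finset.Icc (1 : ℤ) N, ‖c j‖ ≤ 17 * N :=
    (Finset.sum_le_sum hc).trans (sum_one_add_squareMajorant_le h.one_le_U hξ h.pow_25_le)
  have h3 : ∑ j ∈ Finset.Icc (1 : ℤ) N, ∑ j' ∈ Finset.Icc (1 : ℤ) N,
      (if 1 * j = 1 * j' then ‖c j‖ * ‖c j'‖ else 0) ≤ 68 * U * (N : ℝ) ^ (1 / 2 : ℝ) * N := by
    refine le_trans ?_ hcorr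
    refine Finset.sum_le_sum fun i hi => Finset.sum_le_sum fun j hj => ?_
    simp only [sub_eq_zero]
    split_ifs
    · exact mul_le_mul (hc i hi) (hc j hj) (norm_nonneg _) ((norm_nonneg _).trans (hc i hi))
    · rfl
  have hsq : (N : ℝ) ^ (1 / 2 : ℝ) * (N : ℝ) ^ (1 / 2 : ℝ) = N := by
    rw [← Real.rpow_add hN0]
    norm_num
  have hUC : 41 * U * Cd ≤ R := by
    have : Cd * U ≤ Cd * (U * W₂) := by gcongr
    have h0 : 0 ≤ Cd * U := by positivity
    linarith
  have hU' : 68 * (U : ℝ) ≤ R := by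
    have : 1 * (U * W₂ : ℝ) ≤ Cd * (U * W₂) := by gcongr
    linarith
  calc _ ≤ 41 * U * N * (Cd * R) * (17 * N) ^ 2 + 68 * U * (N : ℝ) ^ (1 / 2 : ℝ) * N *
        (68 * U * (N : ℝ) ^ (1 / 2 : ℝ) * N) := by
        gcongr
    _ = N ^ 3 * (289 * ((41 * U * Cd) * R)) +
        N ^ 2 * ((N : ℝ) ^ (1 / 2 : ℝ) * (N : ℝ) ^ (1 / 2 : ℝ)) * ((68 * U) * (68 * U)) := by ring
    _ = N ^ 3 * (289 * ((41 * U * Cd) * R) + (68 * U) * (68 * U)) := by rw [hsq]; ring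
    _ ≤ N ^ 3 * (289 * (R * R) + R * R) := by gcongr
    _ = 290 * (N ^ 3 * (N * (N : ℝ) ^ (-1 + ε))) := by rw [hRR, hR]; ring
    _ ≤ 83521 * (N ^ 3 * (N * (N : ℝ) ^ (-1 + ε))) := by gcongr; norm_num
    _ = _ := by ring

end Lossy

/-! ### Assembly of the restriction estimates for finite sums. -/

theorem sum_powWeight_le {τ M : ℝ} (hτ : 0 < τ) (hM : 0 < M) :
    ∑ x ∈ Finset.Icc 1 ⌊M⌋₊, ((x : ℝ) / M) ^ τ ≤ M := by
  have hfloor : (⌊M⌋₊ : ℝ) ≤ M := Nat.floor_le hM.le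
  refine (Finset.sum_le_sum (g := fun _ => (1 : ℝ)) fun x hx => ?_).trans (by simpa using hfloor)
  refine Real.rpow_le_one (by positivity) ?_ hτ.le
  rw [div_le_one hM]
  exact (by exact_mod_cast (Finset.mem_Icc.1 hx).2 : (x : ℝ) ≤ ⌊M⌋₊).trans hfloor

theorem one_le_powWeight_mul {τ M : ℝ} (hM : 0 < M) {x : ℕ} (hx : 1 ≤ x) :
    1 ≤ ((x : ℝ) / M) ^ τ * ((x : ℝ) / M) ^ (-τ) := by
  have : 0 < (x : ℝ) / M := by positivity
  rw [← Real.rpow_add this]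
  simp

/-- The three mixed restriction estimates for finite exponential sums. -/
theorem exists_mixed_restriction {p : ℝ} (hp : 2 < p) (K : ℕ) :
    ∃ δ L C : ℝ, 0 < δ ∧ 0 ≤ C ∧ ∀ (U W₂ N ξ : ℕ) (M : ℝ) (b₁ b₂ : ℤ) (c : ℤ → ℂ) (d : ℕ → ℂ),
      IsLarge K U W₂ N M → L * (U * W₂) ≤ (N : ℝ) ^ δ → ξ ≤ 2 * U → Nat.Coprime ξ (2 * U) →
      (∀ l : ℕ, l.Prime → l ∣ W₂ → l ∣ 2 * U) → b₁ ≠ 0 → b₂ ≠ 0 → |b₁| ≤ K → |b₂| ≤ K →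
      (∀ n ∈ Finset.Icc (1 : ℤ) N, ‖c n‖ ≤ 1 + squareMajorant N (2 * U) ξ n) →
      (∀ j ∈ Finset.Icc 1 ⌊M⌋₊, ‖d j‖ ≤ 1) →
      ∫ α in (0 : ℝ)..1, ‖expSum (Finset.Icc (1 : ℤ) N) c (fun n => b₁ * n) α *
          expSum (Finset.Icc 1 ⌊M⌋₊) d (fun x => b₂ * (x : ℤ)) α‖ ^ p ≤ C * ((N * M) ^ p / N) ∧
      ∫ α in (0 : ℝ)..1, ‖expSum (Finset.Icc (1 : ℤ) N) c (fun n => b₁ * n) α *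
          expSum (Finset.Icc 1 ⌊M⌋₊) d (fun x => b₂ * W₂ * (quadPoly 1 0 x : ℤ)) α‖ ^ p ≤
        C * ((N * M) ^ p / N) ∧
      ∫ α in (0 : ℝ)..1,
          ‖expSum (Finset.Icc 1 ⌊M⌋₊) d (fun x => b₁ * W₂ * (quadPoly 1 0 x : ℤ)) α *
          expSum (Finset.Icc 1 ⌊M⌋₊) d (fun x => b₂ * (x : ℤ)) α‖ ^ p ≤ C * ((M ^ 2) ^ p / N) := by
  have hp0 : 0 < p := by linarith
  -- With this `τ` the decay exponent `(1 + τ)/2` of the weighted squares is the one required by the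
  -- abstract theorem.
  set τ := 2 / p with hτdef
  have hτ : 0 < τ := by positivity
  have hτ1 : τ < 1 := by rw [hτdef, div_lt_one hp0]; exact hp
  obtain ⟨ε, C, hε, hC, H⟩ := exists_integral_mul_rpow_le (C₀ := 8704 * (K : ℝ) ^ 2 + 1) hp
    (by linarith [(by positivity : 0 ≤ 8704 * (K : ℝ) ^ 2)])
  rw [← hτdef] at H
  obtain ⟨Cd, hCd, hdiv⟩ := exists_card_divisors_le (half_pos hε)
  -- The factor by which the mass of the dual weight `(x/M)^{-τ}` may exceed `M`. All three
  -- estimates use `17κ` times the trivial size as their `T`.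
  set κ := 1 / (1 - τ) with hκdef
  have hκ1 : 1 ≤ κ := by
    rw [hκdef, le_div_iff₀ (by linarith)]
    linarith
  have hκ0 : 0 < κ := by linarith
  refine ⟨ε / 2, 68 * Cd, C * (17 * κ) ^ p, by positivity, by positivity, ?_⟩
  intro U W₂ N ξ M b₁ b₂ c d h hbig hξ hco hW hb₁ hb₂ hb₁K hb₂K hc hd
  have hM := h.M_pos
  have hN : 0 < N := h.one_le_N
  have hN0 : (0 : ℝ) < N := by exact_mod_cast hN
  have hK1 : (1 : ℝ) ≤ K := by exact_mod_cast h.one_le_K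
  have hfloor : (⌊M⌋₊ : ℝ) ≤ M := Nat.floor_le hM.le
  have hμ0 : ∀ n ∈ Finset.Icc (1 : ℤ) N, 0 ≤ 1 + squareMajorant N (2 * U) ξ n := fun n _ => by
    linarith [squareMajorant_nonneg h.one_le_U hξ (N := N) n]
  have hμT := sum_one_add_squareMajorant_le h.one_le_U hξ h.pow_25_le
  have hcsq : ∀ n ∈ Finset.Icc (1 : ℤ) N, ‖c n‖ ^ 2 ≤
      (1 + squareMajorant N (2 * U) ξ n) * (1 + squareMajorant N (2 * U) ξ n) := fun n hn => by
    rw [sq]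
    exact mul_self_le_mul_self (norm_nonneg _) (hc n hn)
  have hdsq : ∀ j ∈ Finset.Icc 1 ⌊M⌋₊, ‖d j‖ ^ 2 ≤ 1 := fun j hj =>
    pow_le_one₀ (norm_nonneg _) (hd j hj)
  have hdpow : ∀ j ∈ Finset.Icc 1 ⌊M⌋₊, ‖d j‖ ^ 2 ≤ ((j : ℝ) / M) ^ τ * ((j : ℝ) / M) ^ (-τ) :=
    fun j hj => (hdsq j hj).trans (one_le_powWeight_mul hM (Finset.mem_Icc.1 hj).1)
  have hω := sum_powWeight_le hτ hM
  have hv : ∑ x ∈ Finset.Icc 1 ⌊M⌋₊, ((x : ℝ) / M) ^ (-τ) ≤ κ * M := by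
    rw [hκdef, one_div_mul_eq_div]
    exact sum_rpow_neg_le hτ hτ1 hM
  have hone : ∑ _x ∈ Finset.Icc 1 ⌊M⌋₊, (1 : ℝ) ≤ M := by simpa using hfloor
  have hpow0 : ∀ (σ : ℝ), ∀ j ∈ Finset.Icc 1 ⌊M⌋₊, 0 ≤ ((j : ℝ) / M) ^ σ := fun σ j _ => by
    positivity
  have hNM : 0 < N * M := by positivity
  have hNMT : N * M ≤ 17 * κ * (N * M) := le_mul_of_one_le_left hNM.le (by linarith)
  have hMκ : M ≤ κ * M := le_mul_of_one_le_left hM.le hκ1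
  have hT1 : 17 * N * M ≤ 17 * κ * (N * M) := by
    calc _ ≤ 17 * N * (κ * M) := by gcongr
      _ = _ := by ring
  have hinv0 : 0 ≤ (N : ℝ) ^ (-(1 / 200) : ℝ) := by positivity
  have hlossy : 2 * (N * M) ^ 2 * (N : ℝ) ^ (-1 + ε) ≤
      (17 * κ * (N * M)) ^ 2 * (N : ℝ) ^ (-1 + ε) := by
    gcongr
    have h2 : (2 : ℝ) ≤ (17 * κ) ^ 2 := by nlinarith
    calc 2 * (N * M) ^ 2 ≤ (17 * κ) ^ 2 * (N * M) ^ 2 := by gcongr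
      _ = _ := by ring
  have hfinal : ∀ X : ℝ, 0 ≤ X → C * (17 * κ * X) ^ p / N = C * (17 * κ) ^ p * (X ^ p / N) := by
    intro X hX
    rw [Real.mul_rpow (by positivity) hX]
    ring
  refine ⟨?_, ?_, ?_⟩
  · rw [← hfinal _ hNM.le]
    refine H ℤ ℕ _ _ c d _ _ (fun n => 1 + squareMajorant N (2 * U) ξ n)
      (fun n => 1 + squareMajorant N (2 * U) ξ n) (fun _ => 1) (fun _ => 1) N _ hN (by positivity)
      hμ0 hμ0 (by simp) (by simp) hcsq (by simpa using hdsq) ?_ ?_ ?_ ?_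
    · exact (mul_le_mul hμT hone (by simp) (by positivity)).trans hT1
    · exact (mul_le_mul hμT hone (by simp) (by positivity)).trans hT1
    · intro θ
      rw [expSum_majorant, expSum_linear]
      rcases kernel_hat_hat h hξ hco hb₁ hb₂ hb₁K hb₂K (show 0 ≤ (1 + τ) / 2 by linarith)
        (by linarith) θ with h1 | ⟨q, a, hq, h1⟩
      · exact Or.inl (h1.trans (by gcongr))
      · refine Or.inr ⟨q, a, hq, h1.trans ?_⟩
        gcongr
        linarith [(by positivity : 0 ≤ (K : ℝ) ^ 2)]
    · refine le_trans ?_ hlossy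
      exact integral_hat_mul_sq_le h hξ hε hCd hdiv hbig hc hb₁ hd
        (fun x _ y _ hxy => by exact_mod_cast mul_left_cancel₀ hb₂ hxy)
  · rw [← hfinal _ hNM.le]
    have hbW : b₂ * (W₂ : ℤ) ≠ 0 := mul_ne_zero hb₂ (by have := h.one_le_W₂; omega)
    -- The bound `‖d j‖² ≤ 1` is split as `(j/M)^τ (j/M)^{-τ}`; the increasing factor enters the
    -- kernel.
    refine H ℤ ℕ _ _ c d _ _ (fun n => 1 + squareMajorant N (2 * U) ξ n)
      (fun n => 1 + squareMajorant N (2 * U) ξ n) (fun j => ((j : ℝ) / M) ^ τ)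
      (fun j => ((j : ℝ) / M) ^ (-τ)) N _ hN (by positivity)
      hμ0 hμ0 (hpow0 _) (hpow0 _) hcsq hdpow ?_ ?_ ?_ ?_
    · exact (mul_le_mul hμT hω (Finset.sum_nonneg (hpow0 _)) (by positivity)).trans hT1
    · refine (mul_le_mul hμT hv (Finset.sum_nonneg (hpow0 _)) (by positivity)).trans (le_of_eq ?_)
      ring
    · intro θ
      rw [expSum_majorant, expSum_square hτ]
      rcases kernel_hat_tilde h hξ hco hW hτ hτ1 hb₁ hb₂ hb₁K hb₂K
        (show 0 ≤ (1 + τ) / 2 by linarith) (by linarith) θ with h1 | ⟨q, a, hq, h1⟩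
      · exact Or.inl (h1.trans (by gcongr))
      · refine Or.inr ⟨q, a, hq, h1.trans ?_⟩
        gcongr
        linarith
    · refine le_trans ?_ hlossy
      refine integral_hat_mul_sq_le h hξ hε hCd hdiv hbig hc hb₁ hd fun x _ y _ hxy => ?_
      exact (quadPoly_strictMono le_rfl 0).injective (by exact_mod_cast mul_left_cancel₀ hbW hxy)
  · have hM2 : 0 < M ^ 2 := by positivity
    have hM2T : M ^ 2 ≤ 17 * κ * M ^ 2 := le_mul_of_one_le_left hM2.le (by linarith)
    have hT3 : κ * M * M ≤ 17 * κ * M ^ 2 := by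
      have : 0 ≤ κ * M ^ 2 := by positivity
      nlinarith
    rw [← hfinal _ hM2.le]
    -- The power weight is put on the squares only; the linear factor keeps the constant weight and
    -- hence a genuine Dirichlet kernel.
    refine H ℕ ℕ _ _ d d _ _ (fun j => ((j : ℝ) / M) ^ τ)
      (fun j => ((j : ℝ) / M) ^ (-τ)) (fun _ => 1) (fun _ => 1) N _ hN (by positivity)
      (hpow0 _) (hpow0 _) (by simp) (by simp) hdpow (by simpa using hdsq) ?_ ?_ ?_ ?_
    · exact (mul_le_mul (hω.trans hMκ) hone (by simp) (by positivity)).trans hT3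
    · exact (mul_le_mul hv hone (by simp) (by positivity)).trans hT3
    · intro θ
      rw [expSum_square hτ, expSum_linear]
      rcases kernel_tilde_hat h hτ hτ1 hb₁ hb₂ hb₁K hb₂K θ with h1 | ⟨q, a, hq, h1⟩
      · exact Or.inl (h1.trans (by gcongr))
      · refine Or.inr ⟨q, a, hq, h1.trans ?_⟩
        have : (K : ℝ) ≤ (K : ℝ) ^ 2 := le_self_pow₀ hK1 two_ne_zero
        gcongr
        linarith
    · refine (integral_tilde_mul_hat_sq_le h hε hCd hdiv hbig hd hb₁ hb₂).trans ?_
      gcongr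

/-- The restriction estimate for the majorant `1_[N] + ν`. -/
theorem exists_restriction_majorant {p : ℝ} (hp : 2 < p) (K : ℕ) :
    ∃ δ L C : ℝ, 0 < δ ∧ 0 ≤ C ∧ ∀ (U W₂ N ξ : ℕ) (M : ℝ) (c : ℤ → ℂ),
      IsLarge K U W₂ N M → L * (U * W₂) ≤ (N : ℝ) ^ δ → ξ ≤ 2 * U → Nat.Coprime ξ (2 * U) →
      (∀ n ∈ Finset.Icc (1 : ℤ) N, ‖c n‖ ≤ 1 + squareMajorant N (2 * U) ξ n) →
      ∫ α in (0 : ℝ)..1, ‖expSum (Finset.Icc (1 : ℤ) N) c (fun n => 1 * n) α‖ ^ (2 * p) ≤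
        C * ((N : ℝ) ^ (2 * p) / N) := by
  -- For `s = 1/2` the critical exponent is `2/s = 4`, which is below `2p` and equals the exponent
  -- of the lossy moment.
  obtain ⟨ε, C, hε, hC, H⟩ := exists_integral_norm_rpow_le (s := 1 / 2) (p := 2 * p) (p₀ := 4)
    (η := 1 / 200) (C₀ := 136) (by norm_num) (by norm_num) (by linarith) (by norm_num)
    (by linarith) (by norm_num) (by norm_num)
  obtain ⟨Cd, hCd, hdiv⟩ := exists_card_divisors_le (half_pos hε)
  refine ⟨ε / 2, 68 * Cd, C * 17 ^ (2 * p), by positivity, by positivity, ?_⟩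
  intro U W₂ N ξ M c h hbig hξ hco hc
  have hN : 0 < N := h.one_le_N
  have hN0 : (0 : ℝ) < N := by exact_mod_cast hN
  have hμ0 : ∀ n ∈ Finset.Icc (1 : ℤ) N, 0 ≤ 1 + squareMajorant N (2 * U) ξ n := fun n _ => by
    linarith [squareMajorant_nonneg h.one_le_U hξ (N := N) n]
  have hμT := sum_one_add_squareMajorant_le h.one_le_U hξ h.pow_25_le
  have hcsq : ∀ n ∈ Finset.Icc (1 : ℤ) N, ‖c n‖ ^ 2 ≤
      (1 + squareMajorant N (2 * U) ξ n) * (1 + squareMajorant N (2 * U) ξ n) := fun n hn => by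
    rw [sq]
    exact mul_self_le_mul_self (norm_nonneg _) (hc n hn)
  have hfinal : C * (17 * N : ℝ) ^ (2 * p) / N = C * 17 ^ (2 * p) * ((N : ℝ) ^ (2 * p) / N) := by
    rw [Real.mul_rpow (by positivity) hN0.le]
    ring
  rw [← hfinal]
  refine H ℤ _ c (fun n => 1 + squareMajorant N (2 * U) ξ n)
    (fun n => 1 + squareMajorant N (2 * U) ξ n) _ N (17 * N) hN (by positivity) hμ0 hμ0 hcsq hμT hμT
    ?_ ?_
  · intro θ
    have e := expSum_majorant U ξ N 1 θ
    rw [Int.cast_one, one_mul] at e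
    rw [e]
    rcases kernel_hat h hξ hco θ with h1 | ⟨q, a, hq, h1⟩
    · refine Or.inl (h1.trans ?_)
      gcongr
      linarith
    · refine Or.inr ⟨q, a, hq, h1.trans ?_⟩
      gcongr
      linarith
  · have := integral_hat_pow_four_le h hξ hε hCd hdiv hbig hc
    rw [← Real.rpow_natCast] at this
    simp_rw [← Real.rpow_natCast] at this
    exact_mod_cast this

/-! ### Transference to the functions of the statement -/

theorem fourierHat_eq_expSum {f : ℤ → ℂ} {N : ℕ} (hf : ∀ n, n ∉ Finset.Icc (1 : ℤ) N → f n = 0)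
    (b : ℤ) (α : ℝ) :
    fourierHat f (b * α) = expSum (Finset.Icc (1 : ℤ) N) f (fun n => b * n) α := by
  unfold fourierHat expSum
  rw [finsum_eq_sum_of_support_subset (s := Finset.Icc (1 : ℤ) N)]
  · refine Finset.sum_congr rfl fun n _ => ?_
    congr 2
    push_cast
    ring
  · intro n hn
    by_contra h
    exact hn (by simp [hf n h])

theorem mem_initialInterval_iff {M : ℝ} (hM : 0 ≤ M) (n : ℤ) :
    n ∈ initialInterval M ↔ n ∈ Finset.Icc (1 : ℤ) ⌊M⌋₊ := by
  rw [Finset.mem_Icc]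
  refine and_congr_right fun h1 => ?_
  lift n to ℕ using by omega
  rw [Nat.cast_le, Nat.le_floor_iff hM, Int.cast_natCast]

theorem indicator_eq_zero {B : Set ℤ} {M : ℝ} (hM : 0 ≤ M) (hB : B ⊆ initialInterval M) (n : ℤ)
    (hn : n ∉ Finset.Icc (1 : ℤ) ⌊M⌋₊) : B.indicator (fun _ => (1 : ℂ)) n = 0 :=
  Set.indicator_of_notMem (fun h => hn ((mem_initialInterval_iff hM n).1 (hB h))) _

theorem fourierHat_indicator_eq_expSum {B : Set ℤ} {M : ℝ} (hM : 0 ≤ M)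
    (hB : B ⊆ initialInterval M) (b : ℤ) (α : ℝ) :
    fourierHat (B.indicator fun _ => 1) (b * α) =
      expSum (Finset.Icc 1 ⌊M⌋₊) (fun x : ℕ => B.indicator (fun _ => 1) (x : ℤ))
        (fun x : ℕ => b * (x : ℤ)) α := by
  rw [fourierHat_eq_expSum (indicator_eq_zero hM hB)]
  unfold expSum
  rw [sum_Icc_int_eq_sum_Icc]

theorem fourierTilde_indicator_eq_expSum {B : Set ℤ} {M : ℝ} (hM : 0 ≤ M)
    (hB : B ⊆ initialInterval M) (b : ℤ) (W : ℕ) (α : ℝ) :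
    fourierTilde (B.indicator fun _ => 1) (b * W * α) =
      expSum (Finset.Icc 1 ⌊M⌋₊) (fun x : ℕ => B.indicator (fun _ => 1) (x : ℤ))
        (fun x : ℕ => b * W * (quadPoly 1 0 x : ℤ)) α := by
  unfold fourierTilde expSum
  rw [finsum_eq_sum_of_support_subset (s := Finset.Icc (1 : ℤ) ⌊M⌋₊), sum_Icc_int_eq_sum_Icc]
  · refine Finset.sum_congr rfl fun n _ => ?_
    congr 2
    simp only [quadPoly]
    push_cast
    ring
  · intro n hn
    by_contra h
    exact hn (by simp [indicator_eq_zero hM hB n h])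

theorem squareMajorant_eq_zero_of_notMem {N W ξ : ℕ} {n : ℤ} (hn : n ∉ initialInterval N) :
    squareMajorant N W ξ n = 0 := by
  unfold squareMajorant
  rw [dif_neg fun h => hn h.1]

end MixedRestriction

/-! ### The main theorem. -/

open MixedRestriction in
theorem mainTheorem8 (p : ℝ) (hp : 2 < p) (K : ℕ) :
    ∃ (A : ℕ) (C : ℝ), ∀ (b₁ b₂ : ℤ), b₁ ≠ 0 → b₂ ≠ 0 → |b₁| ≤ K → |b₂| ≤ K →
      ∀ (w : ℝ) (W₁ W₂ ξ N : ℕ), 0 < W₁ → 0 < W₂ →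
        IsWSmooth w W₁ → IsWSmooth w W₂ → 2 * primorial ⌊w⌋₊ ∣ W₁ →
        1 ≤ ξ → ξ ≤ W₁ → Nat.Coprime ξ W₁ →
        (N : ℝ) ≤ C * ((W₁ : ℝ) * (W₂ : ℝ)) ^ A ∨
        ∀ (f : ℤ → ℂ) (B : Set ℤ),
          (∀ n : ℤ, ‖f n‖ ≤
            (initialInterval (N : ℝ)).indicator (fun _ => (1 : ℝ)) n + squareMajorant N W₁ ξ n) →
          B ⊆ initialInterval (((N : ℝ) / W₂) ^ (1 / 2 : ℝ)) →
          (∫ α in (0 : ℝ)..1,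
              ‖fourierHat f (b₁ * α) * fourierHat (B.indicator fun _ => 1) (b₂ * α)‖ ^ p)
            ≤ C * ((N : ℝ) ^ (3 * p / 2 - 1) * (W₂ : ℝ) ^ (-(p / 2))) ∧
          (∫ α in (0 : ℝ)..1,
              ‖fourierHat f (b₁ * α) * fourierTilde (B.indicator fun _ => 1) (b₂ * W₂ * α)‖ ^ p)
            ≤ C * ((N : ℝ) ^ (3 * p / 2 - 1) * (W₂ : ℝ) ^ (-(p / 2))) ∧
          (∫ α in (0 : ℝ)..1,
              ‖fourierTilde (B.indicator fun _ => 1) (b₁ * W₂ * α) *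
                fourierHat (B.indicator fun _ => 1) (b₂ * α)‖ ^ p)
            ≤ C * ((N : ℝ) ^ (p - 1) * (W₂ : ℝ) ^ (-p)) ∧
          (∫ α in (0 : ℝ)..1, ‖fourierHat f α‖ ^ (2 * p)) ≤ C * (N : ℝ) ^ (2 * p - 1) := by
  obtain ⟨δ₁, L₁, C₁, hδ₁, hC₁, H₁⟩ := exists_mixed_restriction hp K
  obtain ⟨δ₂, L₂, C₂, hδ₂, hC₂, H₂⟩ := exists_restriction_majorant hp K
  set δ := min (1 / 200) (min δ₁ δ₂) with hδdef
  have hδ : 0 < δ := lt_min (by norm_num) (lt_min hδ₁ hδ₂)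
  -- `L` and `δ` collect the three largeness conditions. Since `A ≥ 1/δ`, the inequality `(L U W₂)^A
  -- ≤ N` yields all of them.
  set L := max 1 (max (10 ^ 6 * (K : ℝ) ^ 2) (max L₁ L₂)) with hLdef
  have hL1 : 1 ≤ L := le_max_left _ _
  obtain ⟨A, hA⟩ := exists_nat_gt (1 / δ)
  have hA0 : (0 : ℝ) < A := lt_trans (by positivity) hA
  have hAne : A ≠ 0 := by rintro rfl; simp at hA0
  have hAδ : 1 / (A : ℝ) ≤ δ := by
    rw [div_le_iff₀ hA0]
    rw [div_lt_iff₀ hδ] at hA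
    linarith
  refine ⟨A, L ^ A + C₁ + C₂, ?_⟩
  intro b₁ b₂ hb₁ hb₂ hb₁K hb₂K w W₁ W₂ ξ N hW₁ hW₂ hs₁ hs₂ hprim hξ1 hξ hco
  by_cases hN : (N : ℝ) ≤ (L ^ A + C₁ + C₂) * ((W₁ : ℝ) * (W₂ : ℝ)) ^ A
  · exact Or.inl hN
  right
  intro f B hf hB
  obtain ⟨U, rfl⟩ : 2 ∣ W₁ := (dvd_mul_right _ _).trans hprim
  have hU : 1 ≤ U := by omega
  have hUr : (1 : ℝ) ≤ U := by exact_mod_cast hU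
  have hW₂r : (1 : ℝ) ≤ W₂ := by exact_mod_cast hW₂
  have hK : 1 ≤ K := by
    have := Int.one_le_abs hb₁
    omega
  have hUW1 : (1 : ℝ) ≤ U * W₂ := one_le_mul_of_one_le_of_one_le hUr hW₂r
  have hNbig : (L * (U * W₂)) ^ A ≤ (N : ℝ) := by
    refine le_trans ?_ (not_le.1 hN).le
    rw [mul_pow]
    push_cast
    gcongr
    · linarith
    · linarith
  have hNr : (1 : ℝ) ≤ N :=
    le_trans (one_le_pow₀ (one_le_mul_of_one_le_of_one_le hL1 hUW1)) hNbig
  have hN0 : (0 : ℝ) < N := by linarith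
  have hbase : L * (U * W₂) ≤ (N : ℝ) ^ δ := by
    calc L * (U * W₂) = ((L * (U * W₂)) ^ A) ^ (1 / (A : ℝ)) := by
          rw [one_div, Real.pow_rpow_inv_natCast (by positivity) hAne]
      _ ≤ (N : ℝ) ^ (1 / (A : ℝ)) := by gcongr
      _ ≤ (N : ℝ) ^ δ := Real.rpow_le_rpow_of_exponent_le hNr hAδ
  have hlarge : ∀ L' δ' : ℝ, L' ≤ L → δ ≤ δ' → L' * (U * W₂) ≤ (N : ℝ) ^ δ' := by
    intro L' δ' hL' hδ'
    calc L' * (U * W₂) ≤ L * (U * W₂) := by gcongr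
      _ ≤ (N : ℝ) ^ δ := hbase
      _ ≤ (N : ℝ) ^ δ' := Real.rpow_le_rpow_of_exponent_le hNr hδ'
  set M := ((N : ℝ) / W₂) ^ (1 / 2 : ℝ) with hMdef
  have hM : 0 < M := by positivity
  have hM2 : M ^ 2 = N / W₂ := by
    rw [hMdef, ← Real.sqrt_eq_rpow, Real.sq_sqrt (by positivity)]
  have hlg : IsLarge K U W₂ N M :=
    ⟨hK, hU, hW₂, hM, by rw [hM2]; field_simp, hlarge _ _
      ((le_max_left _ _).trans (le_max_right _ _)) (min_le_left _ _)⟩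
  -- A prime factor of `W₂` is at most `w` by smoothness, so it divides the primorial and therefore
  -- `W₁ = 2U`.
  have hprime : ∀ l : ℕ, l.Prime → l ∣ W₂ → l ∣ 2 * U := by
    intro l hl hlW
    refine dvd_trans ?_ ((dvd_mul_left _ _).trans hprim)
    exact (Nat.Prime.dvd_primorial_iff hl).2 (Nat.le_floor (hs₂ l hl hlW))
  have hf0 : ∀ n, n ∉ Finset.Icc (1 : ℤ) N → f n = 0 := by
    intro n hn
    have hn' : n ∉ initialInterval (N : ℝ) := by
      rwa [mem_initialInterval_iff hN0.le, Nat.floor_natCast]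
    have := hf n
    rw [Set.indicator_of_notMem hn', squareMajorant_eq_zero_of_notMem hn', add_zero] at this
    exact norm_le_zero_iff.1 this
  have hfle : ∀ n ∈ Finset.Icc (1 : ℤ) N, ‖f n‖ ≤ 1 + squareMajorant N (2 * U) ξ n := by
    intro n hn
    have hn' : n ∈ initialInterval (N : ℝ) := by
      rwa [mem_initialInterval_iff hN0.le, Nat.floor_natCast]
    have := hf n
    rwa [Set.indicator_of_mem hn'] at this
  have hd1 : ∀ j ∈ Finset.Icc 1 ⌊M⌋₊, ‖B.indicator (fun _ => (1 : ℂ)) (j : ℤ)‖ ≤ 1 := by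
    intro j _
    by_cases hj : (j : ℤ) ∈ B
    · simp [hj]
    · simp [hj]
  obtain ⟨h1, h2, h3⟩ := H₁ U W₂ N ξ M b₁ b₂ f (fun j => B.indicator (fun _ => 1) (j : ℤ)) hlg
    (hlarge _ _ ((le_max_left _ _).trans ((le_max_right _ _).trans (le_max_right _ _)))
      ((min_le_right _ _).trans (min_le_left _ _))) hξ hco hprime hb₁ hb₂ hb₁K hb₂K hfle hd1
  have h4 := H₂ U W₂ N ξ M f hlg
    (hlarge _ _ ((le_max_right _ _).trans ((le_max_right _ _).trans (le_max_right _ _)))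
      ((min_le_right _ _).trans (min_le_right _ _))) hξ hco hfle
  have hLA : 0 ≤ L ^ A := by positivity
  have hC₁' : C₁ ≤ L ^ A + C₁ + C₂ := by linarith
  have hC₂' : C₂ ≤ L ^ A + C₁ + C₂ := by linarith
  have hW0 : (0 : ℝ) < W₂ := by linarith
  -- Here `N M = N^{3/2} W₂^{-1/2}`, which gives the exponents of the statement.
  have e12 : (N * M) ^ p / N = (N : ℝ) ^ (3 * p / 2 - 1) * (W₂ : ℝ) ^ (-(p / 2)) := by
    rw [hMdef, Real.mul_rpow hN0.le (by positivity), ← Real.rpow_mul (by positivity),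
      Real.div_rpow hN0.le hW0.le, Real.rpow_neg hW0.le, Real.rpow_sub_one hN0.ne',
      show 3 * p / 2 = p + 1 / 2 * p by ring, Real.rpow_add hN0,
      show p / 2 = 1 / 2 * p by ring]
    field_simp
  have e3 : (M ^ 2) ^ p / N = (N : ℝ) ^ (p - 1) * (W₂ : ℝ) ^ (-p) := by
    rw [hM2, Real.div_rpow hN0.le hW0.le, Real.rpow_neg hW0.le, Real.rpow_sub_one hN0.ne']
    field_simp
  have e4 : (N : ℝ) ^ (2 * p) / N = (N : ℝ) ^ (2 * p - 1) := by rw [Real.rpow_sub_one hN0.ne']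
  rw [e12] at h1 h2
  rw [e3] at h3
  rw [e4] at h4
  simp_rw [fourierHat_indicator_eq_expSum hM.le hB, fourierTilde_indicator_eq_expSum hM.le hB,
    fourierHat_eq_expSum hf0]
  have e : ∀ α, fourierHat f α = expSum (Finset.Icc (1 : ℤ) N) f (fun n => 1 * n) α := by
    intro α
    have := fourierHat_eq_expSum hf0 1 α
    rwa [Int.cast_one, one_mul] at this
  simp_rw [e]
  refine ⟨h1.trans ?_, h2.trans ?_, h3.trans ?_, h4.trans ?_⟩ <;> gcongr
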